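/- **Setting.** A Markov automaton (MA) $\mathcal M$ has a finite nonempty state space $S$ with initial state $s_0$, a finite set of probabilistic transitions $(s,\alpha,\mu)$ ($s\in S$, $\alpha$ an action, $\mu$ a distribution on $S$) and a finite set of Markovian transitions $(s,\lambda,s')$ with rates $\lambda>0$; all actions are internal, and every state has an outgoing transition. A state is *probabilistic* if it has an outgoing probabilistic transition, and *Markovian* otherwise. In a probabilistic state an outgoing probabilistic transition $(s,\alpha,\mu)$ is chosen and taken instantaneously, with successor distribution $\mathbf P(s,(s,\alpha,\mu),\cdot)=\mu$. In a Markovian state the only choice is $\bot$: the sojourn time is exponential with rate $E(s)=\sum_{s'}R(s,s')$, where $R(s,s')=\sum\{\lambda : (s,\lambda,s')\text{ is a transition}\}$, and the successor is $s'$ with probability $\mathbf P(s,\bot,s')=R(s,s')/E(s)$. A policy $D$ maps every finite timed path, measurably, to a probability distribution on the choices enabled in its last state; $\Pr_{s,D}$ is the induced measure on infinite paths from $s$. For $G\subseteq S$ let $$\textit{LRA}^{\min}(s,G)=\inf_D \mathbb E_{s,D}\Big[\lim_{t\to\infty}\frac1t\int_0^t \mathbf 1_G(\pi@u)\,du\Big],$$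 where $\mathbf 1_G(\pi@u)=1$ if the path $\pi$ occupies a state of $G$ at time $u$, and $0$ otherwise. As the limit need not exist under every policy, it is read throughout as $\liminf$, or throughout as $\limsup$; the theorem is claimed for each of the two readings. An *end component* is a pair $(T,K)$ with $\emptyset\ne T\subseteq S$ and $K$ assigning to each $s\in T$ a nonempty set of choices enabled in $s$, such that all these choices lead into $T$ with probability 1 and the graph they induce on $T$ is strongly connected; it is *maximal* (a MEC) if it is not properly contained in another one. The MA is assumed to be *non-Zeno*: no end component all of whose states are probabilistic is reachable from $s_0$. Let $\mathcal M_1,\dots,\mathcal M_k$ be the MECs, with (pairwise disjoint) state sets $S_1,\dots,S_k$, each regarded as an MA of its own, with the probabilistic transitions in $K$ and the Markovian transitions between its states. Let $\textit{LRA}^{\min}_j(G)$ be the minimal long-run average of $G\cap S_j$ in $\mathcal M_j$, i.e. the infimum of $\textit{LRA}^{\min}(s,G\cap S_j)$ in $\mathcal M_j$ over $s\in S_j$ (all these values coincide if $\mathcal M_j$ is reachable). **The SSP.** The stochastic shortest path problem $\mathsf{ssp}_{lra}(\mathcal M)$ has the states $S'\cup U\cup Q$, where $S'=S\setminus\bigcup_j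 S_j$, and $U=\{u_1,\dots,u_k\}$, $Q=\{q_1,\dots,q_k\}$ are fresh. Let $[s]=u_j$ if $s\in S_j$ and $[s]=s$ if $s\in S'$. The initial state is $[s_0]$. - A state $s\in S'$ has the same choices as in $\mathcal M$; the choice $\sigma$ leads to $x\in S'\cup U$ with probability $\sum_{s':[s']=x}\mathbf P(s,\sigma,s')$. - The choices of $u_j$ are $\bot$, which leads to $q_j$ with probability 1, and every probabilistic transition $(s,\alpha,\mu)$ with $s\in S_j$ and $\mu(S\setminus S_j)>0$, which leads to $x\in S'\cup U$ with probability $\sum_{s':[s']=x}\mu(s')$. - The only choice of $q_j$ is $\bot$, which leads to $q_j$. All step costs are $0$, the goal set is $Q$, and the terminal cost of $q_j$ is $\textit{LRA}^{\min}_j(G)$. Let $\textit{cR}^{\min}(x,\Diamond Q)$ be the infimum, over all (history-dependent, randomized) policies of the SSP, of the expected cost of a path from $x$, which is the terminal cost of the first state of $Q$ on the path, or $\infty$ if there is none. **Theorem.** For every non-Zeno Markov automaton $\mathcal M$, every $G\subseteq S$ and every state $s$ reachable from $s_0$ (in particular $s=s_0$), $\textit{LRA}^{\min}(s,G)$ in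 $\mathcal M$ equals $\textit{cR}^{\min}([s],\Diamond Q)$ in $\mathsf{ssp}_{lra}(\mathcal M)$. -/

import Mathlib

open MeasureTheory ProbabilityTheory Filter
open scoped ENNReal NNReal

noncomputable section

/-! ### Discrete-step controlled processes: histories, policies, path measures -/

/-- A finite history: the records with indices `0, …, n`. -/
abbrev History (X : Type*) (n : ℕ) := Finset.Iic n → X

/-- The last record of a history. -/
def History.last {X : Type*} {n : ℕ} (h : History X n) : X := h ⟨n, Finset.mem_Iic.2 le_rfl⟩

lemma History.measurable_last {X : Type*} [MeasurableSpace X] {n : ℕ} :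
    Measurable (History.last : History X n → X) := measurable_pi_apply _

/-- A general measurable policy: it assigns to every finite history, measurably, a probability
distribution on the choices that are enabled in the state in which the history ends. Here `X` is
the type of the records of which a history consists, `C` the type of choices, `state` gives the
state contained in a record, and `enabled x` is the set of choices enabled in the state `x`. -/
structure Policy {X C S : Type*} [MeasurableSpace X] [MeasurableSpace C]
    (state : X → S) (enabled : S → Set C) where
  choose : (n : ℕ) → Kernel (History X n) C
  isMarkov : ∀ n, IsMarkovKernel (choose n)
  mem_enabled : ∀ n (h : History X n), ∀ᵐ c ∂(choose n h), c ∈ enabled (state h.last)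

namespace Policy

variable {X C S : Type*} [MeasurableSpace X] [MeasurableSpace C] [MeasurableSpace S]
  {state : X → S} {enabled : S → Set C}

/-- The transition kernel from histories to the next record: draw a choice according to the policy,
then draw the next record according to `law`, given the current state and the choice. -/
def stepKernel (D : Policy state enabled) (hstate : Measurable state) (law : Kernel (S × C) X)
    (n : ℕ) : Kernel (History X n) X :=
  ((D.choose n).compProd
    (law.comap (fun p : History X n × C => (state p.1.last, p.2))
      ((hstate.comp (History.measurable_last.comp measurable_fst)).prodMk measurable_snd))).snd

instance (D : Policy state enabled) (hstate : Measurable state) (law : Kernel (S × C) X)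
    [IsMarkovKernel law] (n : ℕ) : IsMarkovKernel (D.stepKernel hstate law n) := by
  have := D.isMarkov n
  unfold stepKernel
  infer_instance

/-- The probability measure on infinite paths induced by a policy, for the initial record `x₀`. -/
def pathMeasure (D : Policy state enabled) (hstate : Measurable state) (law : Kernel (S × C) X)
    [IsMarkovKernel law] (x₀ : X) : Measure (ℕ → X) :=
  Kernel.traj (X := fun _ => X) (fun n => D.stepKernel hstate law n) 0 (fun _ => x₀)

end Policy

/-! ### Stochastic shortest path problems -/

/-- A non-negative SSP problem: an MDP with state space `X` and choices in `C`, together with goal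
states, a cost function and a terminal cost function. (`trans x c` matters only for enabled `c`,
`cost` only outside `goal`, `terminal` only on `goal`.) -/
structure SSP (X C : Type*) where
  enabled : X → Set C
  enabled_nonempty : ∀ x, (enabled x).Nonempty
  trans : X → C → PMF X
  init : X
  goal : Set X
  cost : X → C → ℝ≥0∞
  terminal : X → ℝ≥0∞

namespace SSP

variable {X C : Type*} [Countable X] [MeasurableSpace X] [DiscreteMeasurableSpace X]
  [Countable C] [MeasurableSpace C] [DiscreteMeasurableSpace C]

/-- Policies of the MDP; a path is a sequence of records `(choice by which the state was entered,
state)`, where the choice in record `0` is a dummy. -/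
abbrev MDPPolicy (N : SSP X C) := Policy (X := C × X) (fun r => r.2) N.enabled

/-- The law of the next record, given the current state and the choice. -/
def law (N : SSP X C) : Kernel (X × C) (C × X) :=
  Kernel.ofFunOfCountable fun p => (Measure.dirac p.2).prod (N.trans p.1 p.2).toMeasure

instance (N : SSP X C) : IsMarkovKernel N.law := by
  refine ⟨fun p => ?_⟩
  change IsProbabilityMeasure ((Measure.dirac p.2).prod (N.trans p.1 p.2).toMeasure)
  infer_instance

open Classical in
/-- Accumulated cost along a path before reaching the goal, plus terminal cost; `∞` if the goal is
never reached. -/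
def pathCost (N : SSP X C) (ρ : ℕ → C × X) : ℝ≥0∞ :=
  if h : ∃ k, (ρ k).2 ∈ N.goal then
    (∑ j ∈ Finset.range (Nat.find h), N.cost (ρ j).2 (ρ (j + 1)).1)
      + N.terminal (ρ (Nat.find h)).2
  else ∞

/-- The probability measure on paths from `x` under the policy `D`. -/
def pr (N : SSP X C) (D : N.MDPPolicy) (x : X) : Measure (ℕ → C × X) :=
  D.pathMeasure measurable_snd N.law ((N.enabled_nonempty x).some, x)

/-- The minimum expected cost reachability of the goal set from `x`. -/
def minCost (N : SSP X C) (x : X) : ℝ≥0∞ :=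
  ⨅ D : N.MDPPolicy, ∫⁻ ρ, N.pathCost ρ ∂(N.pr D x)

end SSP

/-! ### Markov automata -/

/-- A Markov automaton with (finite) state space `S` and action labels in `A`. All actions are
internal. Every state has an outgoing transition, so that maximal paths are infinite. -/
structure MarkovAutomaton (S A : Type*) where
  /-- probabilistic transitions `(s, α, μ)` -/
  prob : Finset (S × A × PMF S)
  /-- Markovian transitions `(s, r, s')` with rate `r` -/
  mark : Finset (S × ℝ≥0 × S)
  rate_pos : ∀ x ∈ mark, 0 < x.2.1
  init : S
  exists_transition : ∀ s, (∃ x ∈ prob, x.1 = s) ∨ (∃ x ∈ mark, x.1 = s)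

namespace MarkovAutomaton

variable {S A : Type*}

/-- The choices: a probabilistic transition, or `none` (written `⊥` in mathematics), which stands
for letting a Markovian transition happen. -/
def Choice (M : MarkovAutomaton S A) := Option {x // x ∈ M.prob}

namespace Choice

variable {M : MarkovAutomaton S A}

/-- The choice `⊥`. -/
def bot : M.Choice := (none : Option {x // x ∈ M.prob})

/-- The choice of the probabilistic transition `x`. -/
def act (x : {x // x ∈ M.prob}) : M.Choice := some x

instance : Finite M.Choice := inferInstanceAs (Finite (Option {x // x ∈ M.prob}))
instance : MeasurableSpace M.Choice := ⊤
instance : DiscreteMeasurableSpace M.Choice := ⟨fun _ => trivial⟩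

end Choice

/-- `s` is probabilistic: it has an outgoing probabilistic transition. -/
def IsProbabilistic (M : MarkovAutomaton S A) (s : S) : Prop := ∃ x ∈ M.prob, x.1 = s

/-- `s` is Markovian: by maximal progress, Markovian transitions are taken exactly in the states
without probabilistic transitions. -/
def IsMarkovian (M : MarkovAutomaton S A) (s : S) : Prop := ¬ M.IsProbabilistic s

/-- The choices enabled in `s`. -/
def enabled (M : MarkovAutomaton S A) (s : S) : Set M.Choice :=
  {c | (∃ x, c = Choice.act x ∧ x.1.1 = s) ∨ (c = Choice.bot ∧ M.IsMarkovian s)}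

lemma enabled_nonempty (M : MarkovAutomaton S A) (s : S) : (M.enabled s).Nonempty := by
  by_cases h : M.IsProbabilistic s
  · obtain ⟨x, hx, rfl⟩ := h
    exact ⟨Choice.act ⟨x, hx⟩, Or.inl ⟨_, rfl, rfl⟩⟩
  · exact ⟨Choice.bot, Or.inr ⟨rfl, h⟩⟩

open Classical in
/-- `R(s, s')`, the total rate from `s` to `s'`. -/
def rate (M : MarkovAutomaton S A) (s s' : S) : ℝ≥0 :=
  ∑ x ∈ M.mark with x.1 = s ∧ x.2.2 = s', x.2.1

open Classical in
/-- `E(s)`, the total outgoing rate of `s`. -/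
def exitRate (M : MarkovAutomaton S A) (s : S) : ℝ≥0 :=
  ∑ x ∈ M.mark with x.1 = s, x.2.1

lemma tsum_rate [Finite S] (M : MarkovAutomaton S A) (s : S) :
    ∑' s', (M.rate s s' : ℝ≥0∞) = M.exitRate s := by
  classical
  have := Fintype.ofFinite S
  rw [tsum_fintype, ← ENNReal.ofNNReal_finsetSum]
  congr 1
  unfold rate exitRate
  rw [← Finset.sum_fiberwise (s := M.mark.filter fun x => x.1 = s) (g := fun x => x.2.2)]
  refine Finset.sum_congr rfl fun s' _ => ?_
  rw [Finset.filter_filter]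

open Classical in
/-- `P(s, ·)`: the branching distribution `R(s, s') / E(s)` of a Markovian state (with an arbitrary
value where `E(s) = 0`). -/
def branch [Finite S] (M : MarkovAutomaton S A) (s : S) : PMF S :=
  if h : M.exitRate s = 0 then PMF.pure s
  else PMF.normalize (fun s' => (M.rate s s' : ℝ≥0∞))
    (by rw [tsum_rate]; exact_mod_cast h) (by rw [tsum_rate]; exact ENNReal.coe_ne_top)

/-- The distribution of the next state, given the current state and the choice. -/
def jump [Finite S] (M : MarkovAutomaton S A) (s : S) : M.Choice → PMF S
  | none => M.branch s
  | some x => x.1.2.2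

/-- The distribution of the sojourn time: exponential with rate `E(s)` for the choice `⊥`, and zero
for probabilistic transitions (with an arbitrary value for `⊥` where `E(s) = 0`). -/
def delay (M : MarkovAutomaton S A) (s : S) : M.Choice → Measure ℝ≥0
  | none => if M.exitRate s = 0 then Measure.dirac 0
      else (expMeasure (M.exitRate s : ℝ)).map Real.toNNReal
  | some _ => Measure.dirac 0

instance (M : MarkovAutomaton S A) (s : S) (c : M.Choice) :
    IsProbabilityMeasure (M.delay s c) := by
  rcases c with _ | x
  · change IsProbabilityMeasure (if M.exitRate s = 0 then Measure.dirac 0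
      else (expMeasure (M.exitRate s : ℝ)).map Real.toNNReal)
    split_ifs with h
    · infer_instance
    · have := isProbabilityMeasure_expMeasure
        (r := (M.exitRate s : ℝ)) (NNReal.coe_pos.2 (pos_iff_ne_zero.2 h))
      exact Measure.isProbabilityMeasure_map measurable_real_toNNReal.aemeasurable
  · change IsProbabilityMeasure (Measure.dirac (0 : ℝ≥0))
    infer_instance

/-- A record of a path: the choice and the sojourn time of the preceding state, and the state that
is entered. In record `0` of a path, choice and time are dummies. So the path
`s₀ -(c₀, t₀)→ s₁ -(c₁, t₁)→ …` is the sequence `(_, _, s₀), (c₀, t₀, s₁), (c₁, t₁, s₂), …`. -/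
abbrev Record (M : MarkovAutomaton S A) := M.Choice × ℝ≥0 × S

/-! #### Time averages along a path -/

/-- The state with index `n` of a path. -/
def stateAt (M : MarkovAutomaton S A) (π : ℕ → M.Record) (n : ℕ) : S := (π n).2.2

/-- The time at which the state with index `n` is entered. -/
def entryTime (M : MarkovAutomaton S A) (π : ℕ → M.Record) (n : ℕ) : ℝ :=
  ∑ i ∈ Finset.range n, ((π (i + 1)).2.1 : ℝ)

/-- `π@u`: the set of the states that the path occupies at time `u` (there may be several, as
probabilistic transitions are instantaneous). -/
def occupied (M : MarkovAutomaton S A) (π : ℕ → M.Record) (u : ℝ) : Set S :=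
  {s | ∃ n, M.stateAt π n = s ∧ M.entryTime π n ≤ u ∧
    (u < M.entryTime π (n + 1) ∨ u = M.entryTime π n)}

/-- The fraction of time spent in `G` up to time `t`. -/
def timeFraction (M : MarkovAutomaton S A) (G : Set S) (π : ℕ → M.Record) (t : ℝ) : ℝ≥0∞ :=
  (∫⁻ u in Set.Icc 0 t, Set.indicator {u : ℝ | (M.occupied π u ∩ G).Nonempty} 1 u)
    / ENNReal.ofReal t

end MarkovAutomaton

/-- How `lim_{t → ∞}` is read for a bounded function of `t` that need not converge: as the lower or
as the upper limit. -/
inductive LimitReading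
  | lower
  | upper

/-- The limit at infinity of `f`, in the given reading. -/
def LimitReading.lim (ℓ : LimitReading) (f : ℝ → ℝ≥0∞) : ℝ≥0∞ :=
  match ℓ with
  | .lower => liminf f atTop
  | .upper => limsup f atTop

namespace MarkovAutomaton

variable {S A : Type*}

/-- The long-run average fraction of time spent in `G` along a path. -/
def longRunFraction (M : MarkovAutomaton S A) (ℓ : LimitReading) (G : Set S)
    (π : ℕ → M.Record) : ℝ≥0∞ :=
  ℓ.lim (M.timeFraction G π)

section measure

variable [Finite S] [MeasurableSpace S] [DiscreteMeasurableSpace S]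

/-- General measurable policies of a Markov automaton. -/
abbrev MAPolicy (M : MarkovAutomaton S A) :=
  Policy (X := M.Record) (fun r => r.2.2) M.enabled

/-- The law of the next record, given the current state and the choice. -/
def law (M : MarkovAutomaton S A) : Kernel (S × M.Choice) M.Record :=
  Kernel.ofFunOfCountable fun p =>
    (Measure.dirac p.2).prod ((M.delay p.1 p.2).prod (M.jump p.1 p.2).toMeasure)

instance (M : MarkovAutomaton S A) : IsMarkovKernel M.law := by
  refine ⟨fun p => ?_⟩
  change IsProbabilityMeasure
    ((Measure.dirac p.2).prod ((M.delay p.1 p.2).prod (M.jump p.1 p.2).toMeasure))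
  infer_instance

/-- The probability measure on infinite paths from `s` under the policy `D`. -/
def pr (M : MarkovAutomaton S A) (D : M.MAPolicy) (s : S) : Measure (ℕ → M.Record) :=
  D.pathMeasure (measurable_snd.comp measurable_snd) M.law (Choice.bot, 0, s)

/-- The expected long-run average time spent in `G` from `s` under the policy `D`. -/
def lra (M : MarkovAutomaton S A) (ℓ : LimitReading) (D : M.MAPolicy) (s : S) (G : Set S) :
    ℝ≥0∞ :=
  ∫⁻ π, M.longRunFraction ℓ G π ∂(M.pr D s)

/-- The minimal long-run average time spent in `G` from `s`. -/
def lraMin (M : MarkovAutomaton S A) (ℓ : LimitReading) (s : S) (G : Set S) : ℝ≥0∞ :=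
  ⨅ D : M.MAPolicy, M.lra ℓ D s G

end measure

/-! #### Reachability, end components, Zeno freedom -/

/-- A probabilistic transition between states in `T` as one of the whole automaton. -/
def liftTransition {T : Set S} (y : T × A × PMF T) : S × A × PMF S :=
  (y.1, y.2.1, y.2.2.map Subtype.val)

lemma liftTransition_injective {T : Set S} :
    Function.Injective (liftTransition : T × A × PMF T → S × A × PMF S) := by
  rintro ⟨s, a, μ⟩ ⟨s', a', μ'⟩ h
  simp only [liftTransition, Prod.mk.injEq] at h
  obtain ⟨h1, h2, h3⟩ := h
  have key : ∀ (ν : PMF T) (t : T), ν.map Subtype.val (t : S) = ν t := by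
    intro ν t
    rw [PMF.map_apply, tsum_eq_single t]
    · simp
    · intro b hb
      rw [if_neg]
      exact fun e => hb (Subtype.ext e.symm)
  have h4 : μ = μ' := by
    ext t
    rw [← key μ t, ← key μ' t, h3]
  simp [Subtype.ext h1, h2, h4]

/-- A Markovian transition between states in `T` as one of the whole automaton. -/
def liftMark {T : Set S} (y : T × ℝ≥0 × T) : S × ℝ≥0 × S := (y.1, y.2.1, y.2.2)

lemma liftMark_injective {T : Set S} :
    Function.Injective (liftMark : T × ℝ≥0 × T → S × ℝ≥0 × S) := by
  rintro ⟨s, a, μ⟩ ⟨s', a', μ'⟩ h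
  simp only [liftMark, Prod.mk.injEq] at h
  obtain ⟨h1, h2, h3⟩ := h
  simp [Subtype.ext h1, h2, Subtype.ext h3]

lemma exists_pmf_subtype {T : Set S} (μ : PMF S) (h : ∀ s, μ s ≠ 0 → s ∈ T) :
    ∃ ν : PMF T, ν.map Subtype.val = μ := by
  refine ⟨⟨fun t => μ t, (hasSum_subtype_iff_of_support_subset (show Function.support (μ : S → ℝ≥0∞) ⊆ T from h)).2 μ.2⟩, ?_⟩
  ext s
  refine (PMF.map_apply _ _ _).trans ?_
  by_cases hs : s ∈ T
  · rw [tsum_eq_single ⟨s, hs⟩]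
    · rw [if_pos rfl]
      rfl
    · intro b hb
      rw [if_neg]
      exact fun e => hb (Subtype.ext e.symm)
  · have h0 : μ s = 0 := by
      by_contra h1
      exact hs (h s h1)
    rw [h0, ENNReal.tsum_eq_zero]
    intro b
    rw [if_neg]
    rintro rfl
    exact hs b.2

section graph

variable [Finite S]

/-- `s'` is reachable from `s` (with positive probability under some policy). -/
def Reachable (M : MarkovAutomaton S A) : S → S → Prop :=
  Relation.ReflTransGen fun s s' => ∃ c ∈ M.enabled s, M.jump s c s' ≠ 0

/-- An end component `(S', K)`: a sub-automaton, closed under the choices in `K`, whose underlying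
graph is strongly connected. -/
structure EndComponent (M : MarkovAutomaton S A) where
  states : Set S
  acts : S → Set M.Choice
  states_nonempty : states.Nonempty
  acts_nonempty : ∀ s ∈ states, (acts s).Nonempty
  acts_enabled : ∀ s ∈ states, acts s ⊆ M.enabled s
  /-- `K` has the domain `S'` -/
  acts_eq_empty : ∀ s ∉ states, acts s = ∅
  closed : ∀ s ∈ states, ∀ c ∈ acts s, ∀ s', M.jump s c s' ≠ 0 → s' ∈ states
  connected : ∀ s ∈ states, ∀ s' ∈ states,
    Relation.ReflTransGen (fun a b => ∃ c ∈ acts a, M.jump a c b ≠ 0) s s'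

/-- No end component that consists of probabilistic states only is reachable. -/
def NonZeno (M : MarkovAutomaton S A) : Prop :=
  ∀ E : M.EndComponent, (∃ s ∈ E.states, M.Reachable M.init s) → ∃ s ∈ E.states, M.IsMarkovian s

/-- An end component is maximal if it is not properly contained in another one. -/
def EndComponent.IsMaximal {M : MarkovAutomaton S A} (E : M.EndComponent) : Prop :=
  ∀ E' : M.EndComponent, E.states ⊆ E'.states → (∀ s, E.acts s ⊆ E'.acts s) → E' = E

/-- The maximal end components of `M`. -/
def MEC (M : MarkovAutomaton S A) := {E : M.EndComponent // E.IsMaximal}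

instance (M : MarkovAutomaton S A) : Finite M.EndComponent :=
  Finite.of_injective (fun F => (F.states, F.acts)) (by
    rintro ⟨T, K, _, _, _, _, _, _⟩ ⟨T', K', _, _, _, _, _, _⟩ h
    simp only [Prod.mk.injEq] at h
    obtain ⟨rfl, rfl⟩ := h
    rfl)

instance (M : MarkovAutomaton S A) : Finite M.MEC := inferInstanceAs (Finite {E : M.EndComponent // E.IsMaximal})

open Classical in
/-- An end component, with a state `s₀` in it, as a Markov automaton: its probabilistic transitions
are those in `K`, and its Markovian transitions are those between its states. -/
def EndComponent.toMA {M : MarkovAutomaton S A} (E : M.EndComponent) (s₀ : E.states) :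
    MarkovAutomaton E.states A where
  prob := (M.prob.filter fun x => ∃ hx : x ∈ M.prob, Choice.act ⟨x, hx⟩ ∈ E.acts x.1).preimage
    liftTransition liftTransition_injective.injOn
  mark := M.mark.preimage liftMark liftMark_injective.injOn
  rate_pos := fun y hy => M.rate_pos (liftMark y) (Finset.mem_preimage.1 hy)
  init := s₀
  exists_transition := by
    rintro ⟨s, hs⟩
    obtain ⟨c, hc⟩ := E.acts_nonempty s hs
    have hcl := E.closed s hs c hc
    rcases E.acts_enabled s hs hc with ⟨⟨⟨s1, a, μ⟩, hx⟩, rfl, h1⟩ | ⟨rfl, hM⟩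
    · left
      have h1' : s1 = s := h1
      subst h1'
      obtain ⟨ν, hν⟩ := exists_pmf_subtype (T := E.states) μ hcl
      refine ⟨(⟨s1, hs⟩, a, ν), ?_, rfl⟩
      have e : liftTransition ((⟨s1, hs⟩, a, ν) : E.states × A × PMF E.states) = (s1, a, μ) := by
        simp [liftTransition, hν]
      rw [Finset.mem_preimage, e, Finset.mem_filter]
      exact ⟨hx, hx, hc⟩
    · right
      rcases M.exists_transition s with h | ⟨⟨s1, r, s2⟩, hx, h1⟩
      · exact absurd h hM
      have h1' : s1 = s := h1
      subst h1'
      have hr : 0 < r := M.rate_pos _ hx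
      have hrate : M.rate s1 s2 ≠ 0 := by
        refine (lt_of_lt_of_le hr ?_).ne'
        exact Finset.single_le_sum (f := fun x : S × ℝ≥0 × S => x.2.1) (fun _ _ => zero_le)
          (Finset.mem_filter.2 ⟨hx, rfl, rfl⟩)
      have hexit : M.exitRate s1 ≠ 0 := by
        refine (lt_of_lt_of_le hr ?_).ne'
        have hmem : (s1, r, s2) ∈ M.mark.filter (fun x => x.1 = s1) :=
          Finset.mem_filter.2 ⟨hx, rfl⟩
        exact Finset.single_le_sum (f := fun x : S × ℝ≥0 × S => x.2.1) (fun _ _ => zero_le) hmem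
      have hs2 : s2 ∈ E.states := by
        refine hcl s2 ?_
        change M.branch s1 s2 ≠ 0
        rw [branch, dif_neg hexit, PMF.normalize_apply, tsum_rate]
        exact mul_ne_zero (by exact_mod_cast hrate) (ENNReal.inv_ne_zero.2 ENNReal.coe_ne_top)
      exact ⟨(⟨s1, hs⟩, r, ⟨s2, hs2⟩), Finset.mem_preimage.2 hx, rfl⟩

/-- The states of the SSP for the long-run average: the states outside all maximal end components,
and two fresh states `u E`, `q E` for each maximal end component `E`. -/
inductive SSPState (M : MarkovAutomaton S A)
  | old (s : S) (h : ∀ E : M.MEC, s ∉ E.1.states)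
  | u (E : M.MEC)
  | q (E : M.MEC)

namespace SSPState

variable {M : MarkovAutomaton S A}

instance : MeasurableSpace M.SSPState := ⊤
instance : DiscreteMeasurableSpace M.SSPState := ⟨fun _ => trivial⟩

instance : Finite M.SSPState :=
  Finite.of_surjective
    (fun x : {s : S // ∀ E : M.MEC, s ∉ E.1.states} ⊕ M.MEC ⊕ M.MEC =>
      match x with
      | .inl s => old s.1 s.2
      | .inr (.inl E) => u E
      | .inr (.inr E) => q E)
    (by
      rintro (⟨s, h⟩ | E | E)
      · exact ⟨.inl ⟨s, h⟩, rfl⟩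
      · exact ⟨.inr (.inl E), rfl⟩
      · exact ⟨.inr (.inr E), rfl⟩)

end SSPState

open Classical in
/-- The collapse of `S`: a state in a maximal end component `E` goes to `u E`, the other states
stay. (Maximal end components are pairwise disjoint, so there is at most one such `E`.) -/
def collapse (M : MarkovAutomaton S A) (s : S) : M.SSPState :=
  if h : ∃ E : M.MEC, s ∈ E.1.states then .u h.choose else .old s (fun E hE => h ⟨E, hE⟩)

/-- The minimal long-run average of an end component, as a Markov automaton of its own. For a
maximal end component of a non-Zeno automaton the value does not depend on the state in which one
starts; here it is the infimum over the states of the component. -/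
def EndComponent.lraMin {M : MarkovAutomaton S A} [MeasurableSpace S] [DiscreteMeasurableSpace S]
    (ℓ : LimitReading) (E : M.EndComponent) (G : Set S) : ℝ≥0∞ :=
  ⨅ s : E.states, (E.toMA s).lraMin ℓ s (Subtype.val ⁻¹' G)

/-- The choices enabled in the SSP: those of `M` in the old states; in `u E`, the choice `⊥` and all
probabilistic transitions from a state of `E` that leave `E` with positive probability; in `q E`,
the choice `⊥` only. -/
def sspEnabled (M : MarkovAutomaton S A) : M.SSPState → Set M.Choice
  | .old s _ => M.enabled s
  | .u E => {c | c = Choice.bot ∨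
      ∃ x, c = Choice.act x ∧ x.1.1 ∈ E.1.states ∧ ∃ s' ∉ E.1.states, x.1.2.2 s' ≠ 0}
  | .q _ => {Choice.bot}

/-- The transition probabilities of the SSP: the distributions of `M`, collapsed, and a step from
`u E` to the absorbing state `q E`. -/
def sspTrans (M : MarkovAutomaton S A) : M.SSPState → M.Choice → PMF M.SSPState
  | .old s _, c => (M.jump s c).map M.collapse
  | .u _, some x => x.1.2.2.map M.collapse
  | .u E, none => PMF.pure (.q E)
  | .q E, _ => PMF.pure (.q E)

/-- The SSP of `M` for the long-run average in `G`. -/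
def sspLRA (M : MarkovAutomaton S A) [MeasurableSpace S] [DiscreteMeasurableSpace S]
    (ℓ : LimitReading) (G : Set S) : SSP M.SSPState M.Choice where
  enabled := M.sspEnabled
  enabled_nonempty
    | .old s _ => M.enabled_nonempty s
    | .u _ => ⟨Choice.bot, Or.inl rfl⟩
    | .q _ => ⟨Choice.bot, rfl⟩
  trans := M.sspTrans
  init := M.collapse M.init
  goal := Set.range .q
  cost := fun _ _ => 0
  terminal
    | .q E => E.1.lraMin ℓ G
    | _ => 0

end graph

end MarkovAutomaton

end

noncomputable section

namespace PathLaw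
open Preorder

section Compare

variable {X : Type*} [MeasurableSpace X]

/-- Finite measures on a sequence space are compared by their finite-dimensional marginals. -/
lemma measure_le_of_map_frestrictLe_le {μ ν : Measure (ℕ → X)} [IsFiniteMeasure μ]
    [IsFiniteMeasure ν]
    (h : ∀ n, μ.map (frestrictLe (π := fun _ => X) n) ≤ ν.map (frestrictLe (π := fun _ => X) n)) :
    μ ≤ ν := by
  refine Measure.le_iff.2 fun s hs => ?_
  refine ENNReal.le_of_forall_pos_le_add fun ε hε _ => ?_
  have hd := Measure.MeasureDense.of_generateFrom_isSetAlgebra_finite (μ := μ + ν)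
    (isSetAlgebra_measurableCylinders (α := fun _ : ℕ => X))
    generateFrom_measurableCylinders.symm
  obtain ⟨t, ht, hst⟩ := hd.approx s hs (measure_ne_top _ _) ε (by exact_mod_cast hε)
  have hμν : μ t ≤ ν t := by
    obtain ⟨I, A, hA, rfl⟩ := (mem_measurableCylinders t).1 ht
    have hI : I ⊆ Finset.Iic (I.sup id) := I.subset_Iic_sup_id
    have e : cylinder I A = frestrictLe (π := fun _ => X) (I.sup id) ⁻¹'
        ((Finset.restrict₂ (π := fun _ => X) hI) ⁻¹' A) := rfl
    have hm : MeasurableSet ((Finset.restrict₂ (π := fun _ => X) hI) ⁻¹' A) :=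
      Finset.measurable_restrict₂ _ hA
    have := h (I.sup id) ((Finset.restrict₂ (π := fun _ => X) hI) ⁻¹' A)
    rwa [Measure.map_apply (measurable_frestrictLe _) hm,
      Measure.map_apply (measurable_frestrictLe _) hm, ← e] at this
  have h1 : μ s ≤ μ t + μ (s \ t) := by
    refine (measure_mono ?_).trans (measure_union_le _ _)
    intro x hx
    by_cases hxt : x ∈ t
    · exact Or.inl hxt
    · exact Or.inr ⟨hx, hxt⟩
  have h2 : ν t ≤ ν s + ν (t \ s) := by
    refine (measure_mono ?_).trans (measure_union_le _ _)
    intro x hx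
    by_cases hxt : x ∈ s
    · exact Or.inl hxt
    · exact Or.inr ⟨hx, hxt⟩
  have h3 : μ (s \ t) + ν (t \ s) ≤ (μ + ν) (symmDiff s t) := by
    rw [Measure.add_apply]
    exact add_le_add (measure_mono fun x hx => Or.inl hx) (measure_mono fun x hx => Or.inr hx)
  have h4 : (μ + ν) (symmDiff s t) ≤ ε := by
    refine hst.le.trans ?_
    rw [ENNReal.ofReal_coe_nnreal]
  calc μ s ≤ μ t + μ (s \ t) := h1
    _ ≤ (ν s + ν (t \ s)) + μ (s \ t) := by gcongr; exact hμν.trans h2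
    _ = ν s + (μ (s \ t) + ν (t \ s)) := by ring
    _ ≤ ν s + ε := by gcongr; exact h3.trans h4

end Compare

end PathLaw

namespace History

variable {X : Type*}

/-- Append a record to a history. -/
def snoc {n : ℕ} (h : History X n) (x : X) : History X (n + 1) :=
  fun i => if hi : (i : ℕ) ≤ n then h ⟨i, Finset.mem_Iic.2 hi⟩ else x

/-- Prepend a record to a history. -/
def cons {n : ℕ} (x : X) (h : History X n) : History X (n + 1) :=
  fun i => if (i : ℕ) = 0 then x else
    h ⟨(i : ℕ) - 1, Finset.mem_Iic.2 (by have := Finset.mem_Iic.1 i.2; omega)⟩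

/-- The first record of a history. -/
def first {n : ℕ} (h : History X n) : X := h ⟨0, Finset.mem_Iic.2 (Nat.zero_le n)⟩

@[simp] lemma last_cons {n : ℕ} (x : X) (h : History X n) : (cons x h).last = h.last := by
  simp [cons, last]

@[simp] lemma last_frestrictLe (n : ℕ) (π : ℕ → X) :
    History.last (Preorder.frestrictLe (π := fun _ => X) n π) = π n := rfl

lemma snoc_frestrictLe (n : ℕ) (π : ℕ → X) :
    snoc (Preorder.frestrictLe (π := fun _ => X) n π) (π (n + 1))
      = Preorder.frestrictLe (π := fun _ => X) (n + 1) π := by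
  funext i
  have := Finset.mem_Iic.1 i.2
  by_cases hi : (i : ℕ) ≤ n
  · simp [snoc, hi]
  · have h1 : (i : ℕ) = n + 1 := by omega
    simp [snoc, h1]

variable [MeasurableSpace X]

lemma measurable_snoc {n : ℕ} :
    Measurable (fun p : History X n × X => snoc p.1 p.2) := by
  refine measurable_pi_lambda _ fun i => ?_
  by_cases hi : (i : ℕ) ≤ n
  · simp only [snoc, hi, dite_true]
    exact (measurable_pi_apply _).comp measurable_fst
  · simpa [snoc, hi] using measurable_snd

lemma _root_.Measurable.historySnoc {α : Type*} [MeasurableSpace α] {n : ℕ} {f : α → History X n}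
    {g : α → X} (hf : Measurable f) (hg : Measurable g) : Measurable fun a => snoc (f a) (g a) :=
  measurable_snoc.comp (hf.prodMk hg)

lemma measurable_cons {n : ℕ} (x : X) : Measurable (cons x : History X n → _) := by
  refine measurable_pi_lambda _ fun i => ?_
  by_cases hi : (i : ℕ) = 0
  · simp [cons, hi]
  · simpa [cons, hi] using measurable_pi_apply _

lemma measurable_first {n : ℕ} : Measurable (first : History X n → X) := measurable_pi_apply _

end History

namespace PathLaw
open Preorder

/-- Prepend a record to a path. -/
def pathCons {X : Type*} (x : X) (π : ℕ → X) : ℕ → X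
  | 0 => x
  | n + 1 => π n

section
variable {X : Type*}

@[simp] lemma pathCons_zero (x : X) (π : ℕ → X) : pathCons x π 0 = x := rfl
@[simp] lemma pathCons_succ (x : X) (π : ℕ → X) (n : ℕ) : pathCons x π (n + 1) = π n := rfl

lemma frestrictLe_pathCons (x : X) (π : ℕ → X) (n : ℕ) :
    frestrictLe (π := fun _ => X) (n + 1) (pathCons x π)
      = History.cons x (frestrictLe (π := fun _ => X) n π) := by
  funext i
  obtain ⟨i, hi⟩ := i
  cases i <;> simp [History.cons]

lemma frestrictLe_zero_pathCons (x : X) (π : ℕ → X) :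
    frestrictLe (π := fun _ => X) 0 (pathCons x π) = fun _ => x := by
  funext i
  obtain ⟨i, hi⟩ := i
  have : i = 0 := by simpa using hi
  subst this
  simp

lemma measurable_pathCons [MeasurableSpace X] (x : X) : Measurable (pathCons x) := by
  refine measurable_pi_lambda _ fun i => ?_
  cases i
  · exact measurable_const
  · exact measurable_pi_apply _
end

variable {X : Type*} [MeasurableSpace X]

/-- The law `P` of a process has the transition kernels `κ`. -/
def Follows (κ : (n : ℕ) → Kernel (History X n) X) (P : Measure (ℕ → X)) : Prop :=
  ∀ (n : ℕ) (φ : History X n × X → ℝ≥0∞), Measurable φ →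
    ∫⁻ π, φ (frestrictLe (π := fun _ => X) n π, π (n + 1)) ∂P
      = ∫⁻ π, ∫⁻ x, φ (frestrictLe (π := fun _ => X) n π, x)
          ∂(κ n (frestrictLe (π := fun _ => X) n π)) ∂P

/-- The histories all of whose consecutive records are in `K`. -/
def stepSet (K : Set (X × X)) (n : ℕ) : Set (History X n) :=
  {h | ∀ k (hk : k < n), (h ⟨k, Finset.mem_Iic.2 hk.le⟩, h ⟨k + 1, Finset.mem_Iic.2 hk⟩) ∈ K}

/-- The paths all of whose consecutive records are in `K`. -/
def alwaysStep (K : Set (X × X)) : Set (ℕ → X) := {π | ∀ n, (π n, π (n + 1)) ∈ K}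

lemma measurableSet_stepSet {K : Set (X × X)} (hK : MeasurableSet K) (n : ℕ) :
    MeasurableSet (stepSet K n) := by
  simp only [stepSet, Set.ofPred_forall]
  refine MeasurableSet.iInter fun k => MeasurableSet.iInter fun hk => ?_
  exact ((measurable_pi_apply _).prodMk (measurable_pi_apply _)) hK

lemma measurableSet_alwaysStep {K : Set (X × X)} (hK : MeasurableSet K) :
    MeasurableSet (alwaysStep K) := by
  simp only [alwaysStep, Set.ofPred_forall]
  refine MeasurableSet.iInter fun k => ?_
  exact ((measurable_pi_apply _).prodMk (measurable_pi_apply _)) hK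

lemma snoc_mem_stepSet {X : Type*} {K : Set (X × X)} {n : ℕ} {h : History X n} {x : X} :
    h.snoc x ∈ stepSet K (n + 1) ↔ h ∈ stepSet K n ∧ (h.last, x) ∈ K := by
  constructor
  · intro H
    refine ⟨fun k hk => ?_, ?_⟩
    · have := H k (by omega)
      have h1 : k ≤ n := by omega
      have h2 : k + 1 ≤ n := by omega
      simpa [History.snoc, h1, h2] using this
    · have := H n (by omega)
      simpa [History.snoc, History.last] using this
  · rintro ⟨H, H'⟩ k hk
    have h1 : k ≤ n := by omega
    by_cases h2 : k + 1 ≤ n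
    · simpa [History.snoc, h1, h2] using H k (by omega)
    · have : k = n := by omega
      subst this
      simpa [History.snoc, History.last] using H'

/-- Comparison of two processes along a map `ι` of their records, on the event that the consecutive
records of the second process stay in `K`. -/
theorem Follows.restrict_le_map {X' : Type*} [MeasurableSpace X']
    {κ : (n : ℕ) → Kernel (History X n) X} {κ' : (n : ℕ) → Kernel (History X' n) X'}
    [∀ n, IsMarkovKernel (κ n)] [∀ n, IsMarkovKernel (κ' n)]
    {P : Measure (ℕ → X)} {P' : Measure (ℕ → X')} [IsFiniteMeasure P] [IsFiniteMeasure P']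
    (hP : Follows κ P) (hP' : Follows κ' P') {ι : X → X'} (hι : Measurable ι)
    {K : Set (X' × X')} (hK : MeasurableSet K)
    (h0 : P'.map (fun π => π 0) ≤ P.map (fun π => ι (π 0)))
    (hstep : ∀ n, ∀ᵐ π ∂P,
      (κ' n (fun i => ι (π i))).restrict {x | (ι (π n), x) ∈ K}
        ≤ (κ n (frestrictLe (π := fun _ => X) n π)).map ι) :
    P'.restrict (alwaysStep K) ≤ P.map (fun π n => ι (π n)) := by
  have hιp : Measurable (fun (π : ℕ → X) n => ι (π n)) :=
    measurable_pi_lambda _ fun n => hι.comp (measurable_pi_apply n)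
  have key : ∀ n (φ : History X' n → ℝ≥0∞), Measurable φ →
      ∫⁻ π, (stepSet K n).indicator φ (frestrictLe (π := fun _ => X') n π) ∂P'
        ≤ ∫⁻ π, φ (fun i => ι (π i)) ∂P := by
    intro n
    induction n with
    | zero =>
      intro φ hφ
      have hc : Measurable (fun x : X' => (fun _ => x : History X' 0)) :=
        measurable_pi_lambda _ fun _ => measurable_id
      have e1 : ∀ π : ℕ → X', frestrictLe (π := fun _ => X') 0 π = fun _ => π 0 := by
        intro π; funext ⟨i, hi⟩
        have : i = 0 := by simpa using hi
        subst this; rfl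
      have e2 : ∀ π : ℕ → X, (fun i => ι (π i) : History X' 0) = fun _ => ι (π 0) := by
        intro π; funext ⟨i, hi⟩
        have : i = 0 := by simpa using hi
        subst this; rfl
      calc _ ≤ ∫⁻ π, φ (fun _ => π 0) ∂P' := by
            refine lintegral_mono fun π => ?_
            rw [← e1 π]
            exact Set.indicator_le_self _ _ _
        _ = ∫⁻ x, φ (fun _ => x) ∂(P'.map (fun π => π 0)) := by
            exact (lintegral_map (hφ.comp hc) (measurable_pi_apply 0)).symm
        _ ≤ ∫⁻ x, φ (fun _ => x) ∂(P.map (fun π => ι (π 0))) := lintegral_mono' h0 le_rfl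
        _ = ∫⁻ π, φ (fun _ => ι (π 0)) ∂P := by
            exact lintegral_map (hφ.comp hc) (hι.comp (measurable_pi_apply 0))
        _ = _ := by simp_rw [e2]
    | succ n ih =>
      intro φ hφ
      set ψ : History X' n × X' → ℝ≥0∞ :=
        {p : History X' n × X' | (p.1.last, p.2) ∈ K}.indicator (fun p => φ (p.1.snoc p.2)) with hψ
      have hψm : Measurable ψ := (hφ.comp History.measurable_snoc).indicator
        (((History.measurable_last.comp measurable_fst).prodMk measurable_snd) hK)
      have hψ'm : Measurable fun h : History X' n => ∫⁻ x, ψ (h, x) ∂(κ' n h) :=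
        hψm.lintegral_kernel_prod_right'
      calc ∫⁻ π, (stepSet K (n + 1)).indicator φ (frestrictLe (π := fun _ => X') (n + 1) π) ∂P'
          = ∫⁻ π, (fun p : History X' n × X' => (Prod.fst ⁻¹' stepSet K n).indicator ψ p)
              (frestrictLe (π := fun _ => X') n π, π (n + 1)) ∂P' := by
            refine lintegral_congr fun π => ?_
            rw [← History.snoc_frestrictLe]
            by_cases h1 : frestrictLe (π := fun _ => X') n π ∈ stepSet K n <;>
            by_cases h2 : (π n, π (n + 1)) ∈ K <;>
            simp [Set.indicator, snoc_mem_stepSet, h1, h2, hψ]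
        _ = ∫⁻ π, ∫⁻ x, (Prod.fst ⁻¹' stepSet K n).indicator ψ
              (frestrictLe (π := fun _ => X') n π, x)
              ∂(κ' n (frestrictLe (π := fun _ => X') n π)) ∂P' :=
            hP' n _ (hψm.indicator (measurable_fst (measurableSet_stepSet hK n)))
        _ = ∫⁻ π, (stepSet K n).indicator (fun h => ∫⁻ x, ψ (h, x) ∂(κ' n h))
              (frestrictLe (π := fun _ => X') n π) ∂P' := by
            refine lintegral_congr fun π => ?_
            by_cases h1 : frestrictLe (π := fun _ => X') n π ∈ stepSet K n <;>
            simp [Set.indicator, h1]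
        _ ≤ ∫⁻ π, ∫⁻ x, ψ ((fun i => ι (π i)), x) ∂(κ' n (fun i => ι (π i))) ∂P :=
            ih _ hψ'm
        _ ≤ ∫⁻ π, ∫⁻ x, φ (History.snoc (fun i => ι (π i)) (ι x))
              ∂(κ n (frestrictLe (π := fun _ => X) n π)) ∂P := by
            refine lintegral_mono_ae ?_
            filter_upwards [hstep n] with π hπ
            have hm : MeasurableSet {x | (ι (π n), x) ∈ K} := measurable_prodMk_left hK
            calc _ = ∫⁻ x in {x | (ι (π n), x) ∈ K}, φ (History.snoc (fun i => ι (π i)) x)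
                    ∂(κ' n (fun i => ι (π i))) := by
                  rw [← lintegral_indicator hm]
                  rfl
              _ ≤ ∫⁻ x, φ (History.snoc (fun i => ι (π i)) x)
                    ∂((κ n (frestrictLe (π := fun _ => X) n π)).map ι) := lintegral_mono' hπ le_rfl
              _ = _ := lintegral_map
                  (hφ.comp (measurable_const.historySnoc measurable_id)) hι
        _ = ∫⁻ π, φ (History.snoc (fun i => ι (π i)) (ι (π (n + 1)))) ∂P := by
            refine (hP n (fun p => φ (History.snoc (fun i => ι (p.1 i)) (ι p.2))) ?_).symm
            refine hφ.comp (Measurable.historySnoc ?_ (hι.comp measurable_snd))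
            exact measurable_pi_lambda _ fun i =>
              hι.comp ((measurable_pi_apply _).comp measurable_fst)
        _ = _ := by
            refine lintegral_congr fun π => ?_
            congr 1
            exact History.snoc_frestrictLe n (fun i => ι (π i))
  have : IsFiniteMeasure (P.map (fun π n => ι (π n))) := Measure.isFiniteMeasure_map _ _
  refine measure_le_of_map_frestrictLe_le fun n => Measure.le_iff.2 fun s hs => ?_
  have hsm := (measurable_frestrictLe (X := fun _ : ℕ => X') n) hs
  rw [Measure.map_apply (measurable_frestrictLe n) hs,
    Measure.map_apply (measurable_frestrictLe n) hs, Measure.map_apply hιp hsm,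
    Measure.restrict_apply hsm]
  have := key n (s.indicator 1) (measurable_one.indicator hs)
  calc _ ≤ ∫⁻ π, (frestrictLe (π := fun _ => X') n ⁻¹' s ∩ alwaysStep K).indicator 1 π ∂P' := by
        rw [lintegral_indicator_one (hsm.inter (measurableSet_alwaysStep hK))]
    _ ≤ _ := by
        refine lintegral_mono fun π => ?_
        refine Set.indicator_apply_le' (fun hπ => ?_) (fun _ => zero_le)
        have h1 : frestrictLe (π := fun _ => X') n π ∈ stepSet K n := fun k hk => hπ.2 k
        have h2 : frestrictLe (π := fun _ => X') n π ∈ s := hπ.1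
        simp [Set.indicator, h1, h2]
    _ ≤ _ := this
    _ = ∫⁻ π, ((fun (π : ℕ → X) n => ι (π n)) ⁻¹' (frestrictLe (π := fun _ => X') n ⁻¹' s)).indicator
          1 π ∂P := rfl
    _ = _ := lintegral_indicator_one (hιp hsm)

/-- A process is determined by its initial law and its transition kernels. -/
theorem Follows.unique {κ : (n : ℕ) → Kernel (History X n) X} [∀ n, IsMarkovKernel (κ n)]
    {P P' : Measure (ℕ → X)} [IsFiniteMeasure P] [IsFiniteMeasure P']
    (hP : Follows κ P) (hP' : Follows κ P')
    (h0 : P.map (fun π => π 0) = P'.map (fun π => π 0)) : P = P' := by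
  have aux : ∀ {Q Q' : Measure (ℕ → X)} [IsFiniteMeasure Q] [IsFiniteMeasure Q'],
      Follows κ Q → Follows κ Q' → Q'.map (fun π => π 0) ≤ Q.map (fun π => π 0) → Q' ≤ Q := by
    intro Q Q' _ _ hQ hQ' h
    have := hQ.restrict_le_map hQ' (ι := id) measurable_id (K := Set.univ) MeasurableSet.univ h
      (fun n => Eventually.of_forall fun π => by
        simp only [Set.mem_univ, Set.ofPred_true, Measure.restrict_univ, Measure.map_id]
        exact le_rfl)
    simpa [alwaysStep] using this
  exact le_antisymm (aux hP' hP h0.le) (aux hP hP' h0.ge)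

section law

variable (κ : (n : ℕ) → Kernel (History X n) X) [∀ n, IsMarkovKernel (κ n)]

/-- The law of the process with transition kernels `κ`, started in `x₀`. -/
def pathLaw (x₀ : X) : Measure (ℕ → X) := Kernel.traj (X := fun _ => X) κ 0 (fun _ => x₀)

instance (x₀ : X) : IsProbabilityMeasure (pathLaw κ x₀) := by
  unfold pathLaw; infer_instance

omit [∀ n, IsMarkovKernel (κ n)] in
lemma pathLaw_congr {κ κ' : (n : ℕ) → Kernel (History X n) X} [∀ n, IsMarkovKernel (κ n)]
    [∀ n, IsMarkovKernel (κ' n)] (h : κ = κ') : pathLaw κ = pathLaw κ' := by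
  subst h; rfl

lemma measurable_pathLaw : Measurable (pathLaw κ) :=
  (Kernel.measurable _).comp (measurable_pi_lambda _ fun _ => measurable_id)

lemma follows_pathLaw (x₀ : X) : Follows κ (pathLaw κ x₀) := by
  intro n φ hφ
  have h := Kernel.partialTraj_compProd_eq_map_traj (X := fun _ => X) (κ := κ) (Nat.zero_le n)
    (x₀ := fun _ => x₀)
  have h1 := lintegral_map (μ := pathLaw κ x₀) hφ
    (g := fun π => (frestrictLe (π := fun _ => X) n π, π (n + 1))) (by fun_prop)
  rw [← h1, pathLaw, ← h, Measure.lintegral_compProd hφ, ← Kernel.traj_map_frestrictLe_apply,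
    lintegral_map _ (measurable_frestrictLe n)]
  exact hφ.lintegral_kernel_prod_right'

lemma pathLaw_map_zero (x₀ : X) : (pathLaw κ x₀).map (fun π => π 0) = Measure.dirac x₀ := by
  have h := Kernel.traj_map_frestrictLe_apply (X := fun _ => X) (κ := κ) 0 0 (fun _ => x₀)
  have e : (fun π : ℕ → X => π 0) = (fun h : History X 0 => h.first) ∘ frestrictLe 0 := rfl
  rw [e, ← Measure.map_map History.measurable_first (measurable_frestrictLe 0), pathLaw, h]
  simp only [Kernel.partialTraj_self, Kernel.id_apply]
  rw [Measure.map_dirac' History.measurable_first]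
  rfl

lemma ae_pathLaw_zero {x₀ : X} {p : X → Prop} (hp : MeasurableSet {x | p x}) (h : p x₀) :
    ∀ᵐ π ∂(pathLaw κ x₀), p (π 0) := by
  have : ∀ᵐ x ∂((pathLaw κ x₀).map (fun π => π 0)), p x := by
    rw [pathLaw_map_zero, ae_dirac_iff hp]
    exact h
  exact ae_of_ae_map (measurable_pi_apply 0).aemeasurable this

lemma lintegral_pathLaw_zero (x₀ : X) {φ : X → ℝ≥0∞} (hφ : Measurable φ) :
    ∫⁻ π, φ (π 0) ∂(pathLaw κ x₀) = φ x₀ := by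
  rw [← lintegral_map (f := φ) hφ (measurable_pi_apply 0), pathLaw_map_zero, lintegral_dirac' _ hφ]

/-- The transition kernels after a first record `x`. -/
def shift (x : X) (n : ℕ) : Kernel (History X n) X :=
  (κ (n + 1)).comap (History.cons x) (History.measurable_cons x)

instance (x : X) (n : ℕ) : IsMarkovKernel (shift κ x n) := by
  unfold shift; infer_instance

/-- First step decomposition of the law of a process. -/
theorem pathLaw_eq_bind (x₀ : X) :
    pathLaw κ x₀ = (κ 0 (fun _ => x₀)).bind
      (fun x => (pathLaw (shift κ x₀) x).map (pathCons x₀)) := by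
  have hm : Measurable (fun x => (pathLaw (shift κ x₀) x).map (pathCons x₀)) :=
    (Measure.measurable_map _ (measurable_pathCons x₀)).comp (measurable_pathLaw _)
  have : ∀ x, IsProbabilityMeasure ((pathLaw (shift κ x₀) x).map (pathCons x₀)) := fun x =>
    Measure.isProbabilityMeasure_map (measurable_pathCons x₀).aemeasurable
  have hprob : IsProbabilityMeasure ((κ 0 (fun _ => x₀)).bind
      (fun x => (pathLaw (shift κ x₀) x).map (pathCons x₀))) := by
    refine ⟨?_⟩
    rw [Measure.bind_apply MeasurableSet.univ hm.aemeasurable]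
    simp
  have hl : ∀ F : (ℕ → X) → ℝ≥0∞, Measurable F →
      ∫⁻ π, F π ∂((κ 0 (fun _ => x₀)).bind
        (fun x => (pathLaw (shift κ x₀) x).map (pathCons x₀)))
      = ∫⁻ x, ∫⁻ π, F (pathCons x₀ π) ∂(pathLaw (shift κ x₀) x) ∂(κ 0 (fun _ => x₀)) := by
    intro F hF
    rw [Measure.lintegral_bind hm.aemeasurable hF.aemeasurable]
    refine lintegral_congr fun x => ?_
    rw [lintegral_map hF (measurable_pathCons x₀)]
  refine (follows_pathLaw κ x₀).unique ?_ ?_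
  · intro n φ hφ
    have hφ' : Measurable fun h => ∫⁻ x, φ (h, x) ∂(κ n h) := hφ.lintegral_kernel_prod_right'
    rw [hl (fun π => φ (frestrictLe (π := fun _ => X) n π, π (n + 1))) (hφ.comp (by fun_prop)),
      hl (fun π => ∫⁻ x, φ (frestrictLe (π := fun _ => X) n π, x) ∂(κ n (frestrictLe n π)))
        (hφ'.comp (measurable_frestrictLe n))]
    cases n with
    | zero =>
      simp only [pathCons_succ, frestrictLe_zero_pathCons]
      simp only [lintegral_const, measure_univ, mul_one]
      refine lintegral_congr fun x => ?_
      exact lintegral_pathLaw_zero _ x (hφ.comp measurable_prodMk_left)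
    | succ n =>
      refine lintegral_congr fun x => ?_
      simp only [frestrictLe_pathCons, pathCons_succ]
      exact follows_pathLaw (shift κ x₀) x n (fun p => φ (History.cons x₀ p.1, p.2))
        (hφ.comp (((History.measurable_cons x₀).comp measurable_fst).prodMk measurable_snd))
  · rw [pathLaw_map_zero]
    ext s hs
    rw [Measure.map_apply (measurable_pi_apply 0) hs,
      ← lintegral_indicator_one ((measurable_pi_apply 0) hs),
      hl _ (measurable_one.indicator ((measurable_pi_apply 0) hs))]
    have : ∀ π, ((fun a : ℕ → X => a 0) ⁻¹' s).indicator (1 : (ℕ → X) → ℝ≥0∞) (pathCons x₀ π)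
        = s.indicator 1 x₀ := fun π => rfl
    simp only [this]
    simp [Measure.dirac_apply' _ hs]

lemma lintegral_pathLaw (x₀ : X) {F : (ℕ → X) → ℝ≥0∞} (hF : Measurable F) :
    ∫⁻ π, F π ∂(pathLaw κ x₀)
      = ∫⁻ x, ∫⁻ π, F (pathCons x₀ π) ∂(pathLaw (shift κ x₀) x) ∂(κ 0 (fun _ => x₀)) := by
  have hm : Measurable (fun x => (pathLaw (shift κ x₀) x).map (pathCons x₀)) :=
    (Measure.measurable_map _ (measurable_pathCons x₀)).comp (measurable_pathLaw _)
  rw [pathLaw_eq_bind κ x₀, Measure.lintegral_bind hm.aemeasurable hF.aemeasurable]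
  refine lintegral_congr fun x => ?_
  rw [lintegral_map hF (measurable_pathCons x₀)]

end law

end PathLaw

namespace History

variable {X : Type*}

/-- Remove the first record of a history. -/
def tail {n : ℕ} (h : History X (n + 1)) : History X n :=
  fun i => h ⟨(i : ℕ) + 1, Finset.mem_Iic.2 (by have := Finset.mem_Iic.1 i.2; omega)⟩

/-- Apply a map to the first record of a history. -/
def mapFirst (r : X → X) {n : ℕ} (h : History X n) : History X n :=
  fun i => if (i : ℕ) = 0 then r (h i) else h i

@[simp] lemma tail_cons {n : ℕ} (x : X) (h : History X n) : (cons x h).tail = h := by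
  funext i; simp [tail, cons]

@[simp] lemma mapFirst_cons {n : ℕ} (r : X → X) (x : X) (h : History X n) :
    (cons x h).mapFirst r = cons (r x) h := by
  funext i
  by_cases hi : (i : ℕ) = 0 <;> simp [mapFirst, cons, hi]

lemma mapFirst_const (r : X → X) (x : X) :
    mapFirst r (fun _ => x : History X 0) = fun _ => r x := by
  funext ⟨i, hi⟩
  have : i = 0 := by simpa using hi
  simp [mapFirst, this]

lemma map_last_mapFirst {S : Type*} {state : X → S} {r : X → X}
    (hr : ∀ x, state (r x) = state x) {n : ℕ} (h : History X n) :
    state (h.mapFirst r).last = state h.last := by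
  by_cases hn : n = 0
  · subst hn; simp [mapFirst, last, hr]
  · simp [mapFirst, last, hn]

variable [MeasurableSpace X]

lemma measurable_tail {n : ℕ} : Measurable (tail : History X (n + 1) → _) :=
  measurable_pi_lambda _ fun _ => measurable_pi_apply _

lemma measurable_mapFirst {r : X → X} (hr : Measurable r) {n : ℕ} :
    Measurable (mapFirst r : History X n → _) := by
  refine measurable_pi_lambda _ fun i => ?_
  by_cases hi : (i : ℕ) = 0
  · simp only [mapFirst, hi, if_true]; exact hr.comp (measurable_pi_apply _)
  · simp only [mapFirst, hi, if_false]; exact measurable_pi_apply _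

end History

namespace Policy
open PathLaw Preorder

variable {X C S : Type*} [MeasurableSpace X] [MeasurableSpace C] [MeasurableSpace S]
  {state : X → S} {enabled : S → Set C}

omit [MeasurableSpace S] in
@[ext] lemma ext {D D' : Policy state enabled} (h : ∀ n h, D.choose n h = D'.choose n h) :
    D = D' := by
  obtain ⟨c, _, _⟩ := D
  obtain ⟨c', _, _⟩ := D'
  have : c = c' := funext fun n => Kernel.ext (h n)
  subst this
  rfl

instance (D : Policy state enabled) (n : ℕ) : IsMarkovKernel (D.choose n) := D.isMarkov n

/-- The policy that remains after a first record `x`. -/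
def next (D : Policy state enabled) (x : X) : Policy state enabled where
  choose n := (D.choose (n + 1)).comap (History.cons x) (History.measurable_cons x)
  isMarkov _ := inferInstance
  mem_enabled n h := by
    simpa using D.mem_enabled (n + 1) (History.cons x h)

/-- The policy that reads the first record through a map `r` that does not change the state. -/
def comapFirst (D : Policy state enabled) (r : X → X) (hr : Measurable r)
    (hs : ∀ x, state (r x) = state x) : Policy state enabled where
  choose n := (D.choose n).comap (History.mapFirst r) (History.measurable_mapFirst hr)
  isMarkov _ := inferInstance
  mem_enabled n h := by
    have := D.mem_enabled n (h.mapFirst r)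
    rwa [History.map_last_mapFirst hs] at this

omit [MeasurableSpace S] in
lemma next_comapFirst (D : Policy state enabled) (r : X → X) (hr : Measurable r)
    (hs : ∀ x, state (r x) = state x) (x : X) :
    (D.comapFirst r hr hs).next x = D.next (r x) := by
  ext n h : 2
  simp [next, comapFirst]

variable [DiscreteMeasurableSpace C]

/-- The stationary deterministic policy given by a selection of enabled choices. -/
def stationary (hstate : Measurable state) {c : S → C} (hc : Measurable c)
    (hce : ∀ s, c s ∈ enabled s) : Policy state enabled where
  choose n := Kernel.deterministic (fun h : History X n => c (state h.last))
    (hc.comp (hstate.comp History.measurable_last))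
  isMarkov _ := inferInstance
  mem_enabled n h := by
    rw [Kernel.deterministic_apply]
    exact (ae_dirac_iff (MeasurableSet.of_discrete (s := {c' | c' ∈ enabled (state h.last)}))).2
      (hce _)

/-- The policy that starts with the choice `c s` in the state `s` and goes on with `D`. -/
def startWith (D : Policy state enabled) (hstate : Measurable state) {c : S → C}
    (hc : Measurable c) (hce : ∀ s, c s ∈ enabled s) : Policy state enabled where
  choose
    | 0 => (stationary hstate hc hce).choose 0
    | n + 1 => (D.choose n).comap History.tail History.measurable_tail
  isMarkov
    | 0 => inferInstance
    | n + 1 => inferInstanceAs (IsMarkovKernel ((D.choose n).comap _ _))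
  mem_enabled
    | 0, h => (stationary hstate hc hce).mem_enabled 0 h
    | n + 1, h => D.mem_enabled n h.tail

lemma next_startWith (D : Policy state enabled) (hstate : Measurable state) {c : S → C}
    (hc : Measurable c) (hce : ∀ s, c s ∈ enabled s) (x : X) :
    (D.startWith hstate hc hce).next x = D := by
  ext n h : 2
  simp [next, startWith]

omit [DiscreteMeasurableSpace C]

/-- The policy that follows `D s` if the initial state is `s`. -/
def join [Countable S] [DiscreteMeasurableSpace S] (hstate : Measurable state)
    (D : S → Policy state enabled) : Policy state enabled where
  choose n :=
    { toFun h := (D (state h.first)).choose n h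
      measurable' := by
        have : Measurable (fun p : S × History X n => (D p.1).choose n p.2) :=
          measurable_from_prod_countable_right fun s => ((D s).choose n).measurable
        exact this.comp ((hstate.comp History.measurable_first).prodMk measurable_id) }
  isMarkov n := ⟨fun h => by
    change IsProbabilityMeasure ((D (state h.first)).choose n h)
    infer_instance⟩
  mem_enabled n h := (D (state h.first)).mem_enabled n h

section law

variable (hstate : Measurable state) (law : Kernel (S × C) X) [IsMarkovKernel law]

lemma lintegral_stepKernel (D : Policy state enabled) (n : ℕ) (h : History X n)
    {φ : X → ℝ≥0∞} (hφ : Measurable φ) :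
    ∫⁻ x, φ x ∂(D.stepKernel hstate law n h)
      = ∫⁻ c, ∫⁻ x, φ x ∂(law (state h.last, c)) ∂(D.choose n h) := by
  unfold stepKernel
  rw [Kernel.lintegral_snd _ _ hφ, Kernel.lintegral_compProd _ _ _ (f := fun p => φ p.2)
    (hφ.comp measurable_snd)]
  rfl

lemma stepKernel_congr {D D' : Policy state enabled} {n m : ℕ} {h : History X n}
    {h' : History X m} (hc : D.choose n h = D'.choose m h') (hl : state h.last = state h'.last) :
    D.stepKernel hstate law n h = D'.stepKernel hstate law m h' := by
  refine Measure.ext_of_lintegral _ fun φ hφ => ?_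
  rw [lintegral_stepKernel _ _ _ _ _ hφ, lintegral_stepKernel _ _ _ _ _ hφ, hc, hl]

lemma ae_stepKernel (D : Policy state enabled) (n : ℕ) (h : History X n) {p : X → Prop}
    (hp : MeasurableSet {x | p x})
    (H : ∀ᵐ c ∂(D.choose n h), ∀ᵐ x ∂(law (state h.last, c)), p x) :
    ∀ᵐ x ∂(D.stepKernel hstate law n h), p x := by
  rw [ae_iff, show {a | ¬ p a} = {a | p a}ᶜ from rfl, ← lintegral_indicator_one hp.compl,
    lintegral_stepKernel _ _ _ _ _ (measurable_one.indicator hp.compl)]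
  refine lintegral_eq_zero_of_ae_eq_zero ?_
  filter_upwards [H] with c hc
  rw [lintegral_indicator_one hp.compl]
  exact ae_iff.1 hc

lemma shift_stepKernel (D : Policy state enabled) (x : X) :
    shift (D.stepKernel hstate law) x = (D.next x).stepKernel hstate law := by
  funext n
  ext h : 1
  simp only [shift, Kernel.comap_apply]
  exact stepKernel_congr hstate law rfl (by simp)

lemma follows_pathMeasure (D : Policy state enabled) (x : X) :
    Follows (D.stepKernel hstate law) (D.pathMeasure hstate law x) := follows_pathLaw _ x

instance (D : Policy state enabled) (x : X) :
    IsProbabilityMeasure (D.pathMeasure hstate law x) :=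
  inferInstanceAs (IsProbabilityMeasure (pathLaw _ x))

/-- First step decomposition of expectations. -/
lemma lintegral_pathMeasure (D : Policy state enabled) (x₀ : X) {F : (ℕ → X) → ℝ≥0∞}
    (hF : Measurable F) :
    ∫⁻ π, F π ∂(D.pathMeasure hstate law x₀)
      = ∫⁻ x, ∫⁻ π, F (pathCons x₀ π) ∂((D.next x₀).pathMeasure hstate law x)
          ∂(D.stepKernel hstate law 0 (fun _ => x₀)) := by
  refine (lintegral_pathLaw (D.stepKernel hstate law) x₀ hF).trans ?_
  rw [pathLaw_congr (shift_stepKernel hstate law D x₀)]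
  rfl

lemma lintegral_comapFirst (D : Policy state enabled) (r : X → X) (hr : Measurable r)
    (hs : ∀ x, state (r x) = state x) {F : (ℕ → X) → ℝ≥0∞} (hF : Measurable F)
    (hFr : ∀ x π, F (pathCons (r x) π) = F (pathCons x π)) (x : X) :
    ∫⁻ π, F π ∂((D.comapFirst r hr hs).pathMeasure hstate law x)
      = ∫⁻ π, F π ∂(D.pathMeasure hstate law (r x)) := by
  rw [lintegral_pathMeasure _ _ _ _ hF, lintegral_pathMeasure _ _ _ _ hF, next_comapFirst]
  have e : (D.comapFirst r hr hs).stepKernel hstate law 0 (fun _ => x)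
      = D.stepKernel hstate law 0 (fun _ => r x) := by
    refine stepKernel_congr hstate law ?_ (hs x).symm
    simp [comapFirst, History.mapFirst_const]
  rw [e]
  simp_rw [hFr]

lemma pathMeasure_join [Countable S] [DiscreteMeasurableSpace S] (D : S → Policy state enabled)
    (x : X) :
    (join hstate D).pathMeasure hstate law x = (D (state x)).pathMeasure hstate law x := by
  refine Follows.unique (κ := (D (state x)).stepKernel hstate law) ?_
    (follows_pathMeasure hstate law _ x) ?_
  · intro n φ hφ
    rw [follows_pathMeasure hstate law (join hstate D) x n φ hφ]
    refine lintegral_congr_ae ?_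
    have h0 : ∀ᵐ π ∂((join hstate D).pathMeasure hstate law x), state (π 0) = state x :=
      ae_pathLaw_zero _ (p := fun y => state y = state x)
        (hstate (MeasurableSet.of_discrete (s := {state x}))) rfl
    filter_upwards [h0] with π hπ
    have : (join hstate D).stepKernel hstate law n (frestrictLe (π := fun _ => X) n π)
        = (D (state x)).stepKernel hstate law n (frestrictLe (π := fun _ => X) n π) := by
      refine stepKernel_congr hstate law ?_ rfl
      change (D (state (π 0))).choose n _ = _
      rw [hπ]
    rw [this]
  · exact (pathLaw_map_zero _ x).trans (pathLaw_map_zero _ x).symm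

/-- Almost surely all steps of a path have a property that the transition kernels guarantee. -/
lemma ae_alwaysStep (D : Policy state enabled) (x₀ : X) {K : Set (X × X)} (hK : MeasurableSet K)
    (H : ∀ n (h : History X n), ∀ᵐ c ∂(D.choose n h), ∀ᵐ x ∂(law (state h.last, c)),
      (h.last, x) ∈ K) :
    ∀ᵐ π ∂(D.pathMeasure hstate law x₀), π ∈ alwaysStep K := by
  refine ae_all_iff.2 fun n => ?_
  have hm : MeasurableSet {p : History X n × X | (p.1.last, p.2) ∈ K}ᶜ :=
    (((History.measurable_last.comp measurable_fst).prodMk measurable_snd) hK).compl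
  have h1 := follows_pathMeasure hstate law D x₀ n
    ({p : History X n × X | (p.1.last, p.2) ∈ K}ᶜ.indicator 1) (measurable_one.indicator hm)
  have h2 : ∀ π : ℕ → X, ∫⁻ x, ({p : History X n × X | (p.1.last, p.2) ∈ K}ᶜ.indicator 1
      (frestrictLe (π := fun _ => X) n π, x) : ℝ≥0∞)
      ∂(D.stepKernel hstate law n (frestrictLe (π := fun _ => X) n π)) = 0 := by
    intro π
    refine lintegral_eq_zero_of_ae_eq_zero ?_
    have := ae_stepKernel hstate law D n (frestrictLe (π := fun _ => X) n π)
      (p := fun x => (π n, x) ∈ K) (measurable_prodMk_left hK) (H n _)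
    filter_upwards [this] with x hx
    simp [hx]
  simp only [h2, lintegral_zero] at h1
  have hg : Measurable fun π : ℕ → X => (frestrictLe (π := fun _ => X) n π, π (n + 1)) := by
    fun_prop
  have h1 := (lintegral_eq_zero_iff ((measurable_one.indicator hm).comp hg)).1 h1
  filter_upwards [h1] with π hπ
  by_contra hc
  simp [Set.indicator, hc] at hπ

/-- A function of the state that does not decrease in expectation by any choice does not decrease
in expectation along a path. -/
lemma le_lintegral_of_subharmonic (D : Policy state enabled) (x₀ : X) {φ : S → ℝ≥0∞}
    (hφ : Measurable φ) (H : ∀ s, ∀ c ∈ enabled s, φ s ≤ ∫⁻ x, φ (state x) ∂(law (s, c))) (n : ℕ) :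
    φ (state x₀) ≤ ∫⁻ π, φ (state (π n)) ∂(D.pathMeasure hstate law x₀) := by
  induction n with
  | zero => exact (lintegral_pathLaw_zero _ x₀ (hφ.comp hstate)).ge
  | succ n ih =>
    refine ih.trans ?_
    rw [follows_pathMeasure hstate law D x₀ n (fun p => φ (state p.2))
      (hφ.comp (hstate.comp measurable_snd))]
    refine lintegral_mono fun π => ?_
    rw [lintegral_stepKernel _ _ _ _ _ (φ := fun x => φ (state x)) (hφ.comp hstate)]
    calc φ (state (π n)) = ∫⁻ _, φ (state (π n))
          ∂(D.choose n (frestrictLe (π := fun _ => X) n π)) := by simp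
      _ ≤ _ := by
        refine lintegral_mono_ae ?_
        filter_upwards [D.mem_enabled n (frestrictLe (π := fun _ => X) n π)] with c hc
        exact H _ c hc

/-- The optimal value of a payoff that does not depend on finite prefixes does not decrease in
expectation by any choice. -/
theorem iInf_lintegral_subharmonic [Countable S] [DiscreteMeasurableSpace S]
    [DiscreteMeasurableSpace C] (hne : ∀ s, (enabled s).Nonempty) {dummy : S → X}
    (hdummy : Measurable dummy) (hsd : ∀ s, state (dummy s) = s) {F : (ℕ → X) → ℝ≥0∞}
    (hF : Measurable F) (hFr : ∀ x π, F (pathCons (dummy (state x)) π) = F (pathCons x π))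
    {s : S} (hFs : ∀ π, F (pathCons (dummy s) π) = F π) {c : C} (hc : c ∈ enabled s) :
    ⨅ D : Policy state enabled, ∫⁻ π, F π ∂(D.pathMeasure hstate law (dummy s))
      ≤ ∫⁻ x, (⨅ D : Policy state enabled,
          ∫⁻ π, F π ∂(D.pathMeasure hstate law (dummy (state x)))) ∂(law (s, c)) := by
  classical
  set V : S → ℝ≥0∞ := fun s => ⨅ D : Policy state enabled,
    ∫⁻ π, F π ∂(D.pathMeasure hstate law (dummy s)) with hV
  have hVm : Measurable V := measurable_of_countable V
  refine ENNReal.le_of_forall_pos_le_add fun ε hε _ => ?_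
  have hex : ∀ s', ∃ D : Policy state enabled,
      ∫⁻ π, F π ∂(D.pathMeasure hstate law (dummy s')) ≤ V s' + ε := by
    intro s'
    by_cases hs' : V s' = ∞
    · exact ⟨stationary hstate (c := fun s => (hne s).some) (measurable_of_countable _)
        (fun s => (hne s).some_mem), by simp [hs']⟩
    · have : V s' < V s' + ε := ENNReal.lt_add_right hs' (by exact_mod_cast hε.ne')
      obtain ⟨D, hD⟩ := iInf_lt_iff.1 this
      exact ⟨D, hD.le⟩
  choose D hD using hex
  let r : X → X := fun x => dummy (state x)
  have hr : Measurable r := hdummy.comp hstate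
  have hs : ∀ x, state (r x) = state x := fun x => hsd _
  let c' : S → C := fun s' => if s' = s then c else (hne s').some
  have hce : ∀ s', c' s' ∈ enabled s' := by
    intro s'
    by_cases h : s' = s
    · subst h; simpa [c'] using hc
    · simpa [c', h] using (hne s').some_mem
  let D' := (join hstate (fun s' => (D s').comapFirst r hr hs)).startWith hstate
    (measurable_of_countable c') hce
  calc V s ≤ ∫⁻ π, F π ∂(D'.pathMeasure hstate law (dummy s)) := iInf_le _ D'
    _ = ∫⁻ x, ∫⁻ π, F π ∂((D (state x)).pathMeasure hstate law (dummy (state x)))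
          ∂(D'.stepKernel hstate law 0 (fun _ => dummy s)) := by
        rw [lintegral_pathMeasure _ _ _ _ hF]
        refine lintegral_congr fun x => ?_
        simp_rw [hFs]
        rw [next_startWith, pathMeasure_join, lintegral_comapFirst _ _ _ _ _ _ hF hFr]
    _ ≤ ∫⁻ x, (V (state x) + ε) ∂(D'.stepKernel hstate law 0 (fun _ => dummy s)) :=
        lintegral_mono fun x => hD (state x)
    _ = ∫⁻ x, V (state x) ∂(law (s, c)) + ε := by
        rw [lintegral_stepKernel _ _ _ _ _ (φ := fun x => V (state x) + ε)
          ((hVm.comp hstate).add_const _)]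
        have e : D'.choose 0 (fun _ => dummy s) = Measure.dirac c := by
          change Measure.dirac (c' (state (dummy s))) = _
          simp [c', hsd]
        rw [e, lintegral_dirac]
        change ∫⁻ x, (V (state x) + ε) ∂(law (state (dummy s), c)) = _
        rw [hsd, lintegral_add_right _ measurable_const]
        simp

/-- If the expectation of a payoff that does not depend on finite prefixes is at least `v` under
all policies from all records, then the payoff is almost surely at least `v`. -/
theorem ae_le_of_forall_le_lintegral {F : (ℕ → X) → ℝ≥0∞} (hF : Measurable F)
    (hF1 : ∀ π, F π ≤ 1) (hFc : ∀ x π, F (pathCons x π) = F π) {v : ℝ≥0∞}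
    (hv : ∀ (D : Policy state enabled) x, v ≤ ∫⁻ π, F π ∂(D.pathMeasure hstate law x))
    (D : Policy state enabled) (x : X) :
    ∀ᵐ π ∂(D.pathMeasure hstate law x), v ≤ F π := by
  have hint : ∀ (D : Policy state enabled) x, ∫⁻ π, F π ∂(D.pathMeasure hstate law x) ≤ 1 := by
    intro D x
    calc _ ≤ ∫⁻ _, 1 ∂(D.pathMeasure hstate law x) := lintegral_mono hF1
      _ = 1 := by simp
  have hvt : v ≠ ∞ := (((hv D x).trans (hint D x)).trans_lt ENNReal.one_lt_top).ne
  have key : ∀ n (D : Policy state enabled) x (φ : History X n → ℝ≥0∞), Measurable φ →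
      ∫⁻ π, φ (frestrictLe (π := fun _ => X) n π) * v ∂(D.pathMeasure hstate law x)
        ≤ ∫⁻ π, φ (frestrictLe (π := fun _ => X) n π) * F π ∂(D.pathMeasure hstate law x) := by
    intro n
    induction n with
    | zero =>
      intro D x φ hφ
      have hc : Measurable fun y : X => φ (fun _ => y) :=
        hφ.comp (measurable_pi_lambda _ fun _ => measurable_id)
      have h0 : ∀ᵐ π ∂(D.pathMeasure hstate law x),
          φ (frestrictLe (π := fun _ => X) 0 π) = φ (fun _ => x) := by
        have := ae_pathLaw_zero (D.stepKernel hstate law) (x₀ := x)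
          (p := fun y => φ (fun _ => y) = φ (fun _ => x))
          (hc (measurableSet_singleton _)) rfl
        filter_upwards [this] with π hπ
        rw [← hπ]
        congr 1
        funext ⟨i, hi⟩
        have : i = 0 := by simpa using hi
        subst this
        rfl
      have e : ∀ G : (ℕ → X) → ℝ≥0∞, Measurable G →
          ∫⁻ π, φ (frestrictLe (π := fun _ => X) 0 π) * G π ∂(D.pathMeasure hstate law x)
            = φ (fun _ => x) * ∫⁻ π, G π ∂(D.pathMeasure hstate law x) := by
        intro G hG
        rw [← lintegral_const_mul _ hG]
        refine lintegral_congr_ae ?_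
        filter_upwards [h0] with π hπ
        rw [hπ]
      rw [e _ measurable_const, e _ hF]
      exact mul_le_mul' le_rfl (by simpa using hv D x)
    | succ n ih =>
      intro D x φ hφ
      have hm : ∀ {G : (ℕ → X) → ℝ≥0∞}, Measurable G →
          Measurable fun π => φ (frestrictLe (π := fun _ => X) (n + 1) π) * G π :=
        fun hG => (hφ.comp (measurable_frestrictLe (n + 1))).mul hG
      rw [lintegral_pathMeasure _ _ _ _ (hm measurable_const),
        lintegral_pathMeasure _ _ _ _ (hm hF)]
      refine lintegral_mono fun y => ?_
      simp only [frestrictLe_pathCons, hFc]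
      exact ih _ y (fun h => φ (History.cons x h)) (hφ.comp (History.measurable_cons x))
  have hle : v • D.pathMeasure hstate law x ≤ (D.pathMeasure hstate law x).withDensity F := by
    have : IsFiniteMeasure ((D.pathMeasure hstate law x).withDensity F) :=
      isFiniteMeasure_withDensity (((hint D x).trans_lt ENNReal.one_lt_top).ne)
    have : IsFiniteMeasure (v • D.pathMeasure hstate law x) :=
      ⟨by simpa using hvt.lt_top⟩
    refine measure_le_of_map_frestrictLe_le fun n => Measure.le_iff.2 fun s hs => ?_
    have hsm := (measurable_frestrictLe (X := fun _ : ℕ => X) n) hs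
    rw [Measure.map_apply (measurable_frestrictLe n) hs,
      Measure.map_apply (measurable_frestrictLe n) hs, withDensity_apply _ hsm,
      Measure.smul_apply, smul_eq_mul, ← lintegral_indicator_one hsm,
      ← lintegral_const_mul _ (measurable_one.indicator hsm), ← lintegral_indicator hsm]
    have := key n D x (s.indicator 1) (measurable_one.indicator hs)
    convert! this using 2
    · funext π
      rw [mul_comm]; rfl
    · funext π
      by_cases h : frestrictLe (π := fun _ => X) n π ∈ s <;> simp [Set.indicator, h]
  refine ae_le_of_forall_setLIntegral_le_of_sigmaFinite measurable_const fun s hs _ => ?_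
  have := hle s
  rw [withDensity_apply _ hs] at this
  simpa using this

end law

end Policy

namespace Policy
open PathLaw Preorder

variable {X C S : Type*} [MeasurableSpace X] [MeasurableSpace C] [MeasurableSpace S]
  {state : X → S} {enabled : S → Set C}

section law

variable (hstate : Measurable state) (law : Kernel (S × C) X) [IsMarkovKernel law]

/-- If the choice `c` is taken infinitely often in the state `s`, then almost surely every event of
positive probability under `law (s, c)` happens infinitely often after `c` is taken in `s`. -/
lemma ae_frequently_of_frequently [DiscreteMeasurableSpace S] [DiscreteMeasurableSpace C]
    (D : Policy state enabled) (x₀ : X) {choice : X → C} (hchoice : Measurable choice)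
    (hlaw : ∀ p, ∀ᵐ x ∂(law p), choice x = p.2) (s : S) (c : C) {B : Set X} (hB : MeasurableSet B)
    (hp : law (s, c) B ≠ 0) :
    ∀ᵐ π ∂(D.pathMeasure hstate law x₀),
      (∃ᶠ n in atTop, state (π n) = s ∧ choice (π (n + 1)) = c) →
      ∃ᶠ n in atTop, (state (π n) = s ∧ choice (π (n + 1)) = c) ∧ π (n + 1) ∈ B := by
  set μ := D.pathMeasure hstate law x₀ with hμ
  set p := law (s, c) B with hpdef
  have hpt : p ≠ ∞ := measure_ne_top _ _
  let ℱ := Filtration.piLE (X := fun _ : ℕ => X)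
  -- `T B k` is the event that `(s, c)` is followed by a record in `B` at time `k`
  let T : Set X → ℕ → Set (ℕ → X) := fun B k =>
    {π | (state (π k) = s ∧ choice (π (k + 1)) = c) ∧ π (k + 1) ∈ B}
  have hTH : ∀ {B : Set X}, MeasurableSet B →
      MeasurableSet {q : X × X | (state q.1 = s ∧ choice q.2 = c) ∧ q.2 ∈ B} := by
    intro B hB
    exact (((hstate.comp measurable_fst) (MeasurableSet.of_discrete (s := {s}))).inter
      ((hchoice.comp measurable_snd) (MeasurableSet.of_discrete (s := {c})))).inter
      (measurable_snd hB)
  have hTm : ∀ {B : Set X}, MeasurableSet B → ∀ k, MeasurableSet[ℱ (k + 1)] (T B k) := by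
    intro B hB k
    change MeasurableSet[Filtration.piLE (X := fun _ : ℕ => X) (k + 1)] (T B k)
    rw [Filtration.piLE_eq_comap_frestrictLe]
    refine ⟨{h : History X (k + 1) | (h ⟨k, Finset.mem_Iic.2 (Nat.le_succ k)⟩, h.last) ∈
      {q : X × X | (state q.1 = s ∧ choice q.2 = c) ∧ q.2 ∈ B}}, ?_, rfl⟩
    exact ((measurable_pi_apply _).prodMk History.measurable_last) (hTH hB)
  have hT : ∀ {B : Set X}, MeasurableSet B → ∀ k, MeasurableSet (T B k) :=
    fun hB k => ℱ.le _ _ (hTm hB k)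
  -- the probability of `T B k` on an event of the first records
  have hprob : ∀ {B : Set X}, MeasurableSet B → ∀ k (A : Set (History X k)), MeasurableSet A →
      μ (frestrictLe (π := fun _ => X) k ⁻¹' A ∩ T B k)
        = law (s, c) B * ∫⁻ π, (A ∩ {h : History X k | state h.last = s}).indicator
            (fun h : History X k => D.choose k h {c}) (frestrictLe (π := fun _ => X) k π) ∂μ := by
    intro B hB k A hA
    have hAm := (measurable_frestrictLe (X := fun _ : ℕ => X) k) hA
    rw [← lintegral_indicator_one (hAm.inter (hT hB k))]
    have hφm : MeasurableSet {q : History X k × X | q.1 ∈ A ∧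
        (state q.1.last = s ∧ choice q.2 = c) ∧ q.2 ∈ B} :=
      (measurable_fst hA).inter
        (((History.measurable_last.comp measurable_fst).prodMk measurable_snd) (hTH hB))
    have := follows_pathMeasure hstate law D x₀ k _ (measurable_one.indicator hφm)
    refine this.trans ?_
    rw [← lintegral_const_mul' _ _ (measure_ne_top _ _)]
    refine lintegral_congr fun π => ?_
    set h : History X k := frestrictLe (π := fun _ => X) k π with hh
    by_cases h1 : h ∈ A ∧ state h.last = s
    · rw [Set.indicator_of_mem (show h ∈ A ∩ {h : History X k | state h.last = s} from h1)]
      have e1 : ∀ x, ({q : History X k × X | q.1 ∈ A ∧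
          (state q.1.last = s ∧ choice q.2 = c) ∧ q.2 ∈ B}.indicator 1 (h, x) : ℝ≥0∞)
          = ({x | choice x = c} ∩ B).indicator 1 x := by
        intro x
        by_cases hx : choice x = c ∧ x ∈ B
        · rw [Set.indicator_of_mem (by exact ⟨h1.1, ⟨h1.2, hx.1⟩, hx.2⟩),
            Set.indicator_of_mem (by exact hx)]
          rfl
        · rw [Set.indicator_of_notMem (by exact fun h => hx ⟨h.2.1.2, h.2.2⟩),
            Set.indicator_of_notMem (by exact hx)]
      have hcB : MeasurableSet ({x | choice x = c} ∩ B) :=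
        (hchoice (MeasurableSet.of_discrete (s := {c}))).inter hB
      simp_rw [e1]
      rw [lintegral_stepKernel _ _ _ _ _ (measurable_one.indicator hcB)]
      have e2 : ∀ c', ∫⁻ x, ({x | choice x = c} ∩ B).indicator 1 x ∂(law (state h.last, c'))
          = ({c} : Set C).indicator (fun _ => law (s, c) B) c' := by
        intro c'
        rw [lintegral_indicator_one hcB, h1.2]
        by_cases hc : c' = c
        · subst hc
          rw [Set.indicator_of_mem (Set.mem_singleton _)]
          refine measure_congr ?_
          filter_upwards [hlaw (s, c')] with x hx
          exact propext ⟨fun h => h.2, fun h => ⟨hx, h⟩⟩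
        · rw [Set.indicator_of_notMem (by simpa using hc)]
          refine measure_mono_null Set.inter_subset_left ?_
          refine measure_eq_zero_iff_ae_notMem.2 ?_
          filter_upwards [hlaw (s, c')] with x hx hx'
          exact hc (hx.symm.trans hx')
      simp_rw [e2]
      rw [lintegral_indicator MeasurableSet.of_discrete, setLIntegral_const]
    · rw [Set.indicator_of_notMem (show h ∉ A ∩ {h : History X k | state h.last = s} from h1),
        mul_zero]
      refine lintegral_eq_zero_of_ae_eq_zero (Eventually.of_forall fun x => ?_)
      refine Set.indicator_of_notMem ?_ _
      rintro ⟨h2, ⟨h3, -⟩, -⟩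
      exact h1 ⟨h2, h3⟩
  have hrel : ∀ k (A : Set (History X k)), MeasurableSet A →
      μ (frestrictLe (π := fun _ => X) k ⁻¹' A ∩ T B k)
        = p * μ (frestrictLe (π := fun _ => X) k ⁻¹' A ∩ T Set.univ k) := by
    intro k A hA
    rw [hprob hB k A hA, hprob MeasurableSet.univ k A hA, measure_univ, one_mul]
  have hcond : ∀ k, (fun π => p.toReal * (μ[(T Set.univ k).indicator (1 : (ℕ → X) → ℝ) | ℱ k]) π)
      =ᵐ[μ] μ[(T B k).indicator (1 : (ℕ → X) → ℝ) | ℱ k] := by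
    intro k
    have hi : ∀ {B : Set X}, MeasurableSet B →
        Integrable ((T B k).indicator (1 : (ℕ → X) → ℝ)) μ := fun hB =>
      (integrable_const (1 : ℝ)).indicator (hT hB k)
    refine ae_eq_condExp_of_forall_setIntegral_eq (ℱ.le k) (hi hB) ?_ ?_ ?_
    · exact fun A _ _ => (integrable_condExp.const_mul _).integrableOn
    · intro A hA _
      have hA0 := ℱ.le k _ hA
      rw [integral_const_mul, setIntegral_condExp (ℱ.le k) (hi MeasurableSet.univ) hA,
        integral_indicator_one (hT MeasurableSet.univ k), integral_indicator_one (hT hB k)]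
      change MeasurableSet[Filtration.piLE (X := fun _ : ℕ => X) k] A at hA
      rw [Filtration.piLE_eq_comap_frestrictLe] at hA
      obtain ⟨A', hA', rfl⟩ := hA
      rw [measureReal_def, measureReal_def, Measure.restrict_apply (hT MeasurableSet.univ k),
        Measure.restrict_apply (hT hB k), Set.inter_comm (T B k), hrel k A' hA', ENNReal.toReal_mul,
        Set.inter_comm]
    · exact (stronglyMeasurable_condExp.const_mul _).aestronglyMeasurable
  let E : Set X → ℕ → Set (ℕ → X) := fun B n => Nat.casesOn n ∅ (T B)
  have hE : ∀ {B : Set X}, MeasurableSet B → ∀ n, MeasurableSet[ℱ n] (E B n) := by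
    intro B hB n
    cases n with
    | zero => exact @MeasurableSet.empty _ (ℱ 0)
    | succ n => exact hTm hB n
  have hlim : ∀ (B : Set X) π, π ∈ limsup (E B) atTop ↔ ∃ᶠ n in atTop, π ∈ T B n := by
    intro B π
    rw [mem_limsup_iff_frequently_mem]
    nth_rw 1 [← map_add_atTop_eq_nat 1]
    rw [frequently_map]
  have h1 := ae_mem_limsup_atTop_iff μ (hE hB)
  have h2 := ae_mem_limsup_atTop_iff μ (hE MeasurableSet.univ)
  filter_upwards [h1, h2, ae_all_iff.2 hcond] with π h1 h2 h3 h4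
  rw [hlim] at h1 h2
  refine h1.2 ?_
  have h5 := h2.1 (h4.mono fun n hn => ⟨hn, trivial⟩)
  have hp0 : 0 < p.toReal := ENNReal.toReal_pos hp hpt
  refine (h5.const_mul_atTop hp0).congr fun n => ?_
  rw [Finset.mul_sum]
  exact Finset.sum_congr rfl fun k _ => h3 k

end law

end Policy

namespace LimitReading

lemma lim_mono (ℓ : LimitReading) {a b : ℝ → ℝ≥0∞} (h : ∀ᶠ t in atTop, a t ≤ b t) :
    ℓ.lim a ≤ ℓ.lim b := by
  cases ℓ
  · exact liminf_le_liminf h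
  · exact limsup_le_limsup h

lemma lim_const (ℓ : LimitReading) (c : ℝ≥0∞) : ℓ.lim (fun _ => c) = c := by
  cases ℓ
  · exact liminf_const c
  · exact limsup_const c

lemma lim_add_const (ℓ : LimitReading) (a : ℝ → ℝ≥0∞) (c : ℝ≥0∞) :
    ℓ.lim (fun t => a t + c) = ℓ.lim a + c := by
  cases ℓ
  · exact liminf_add_const atTop a c (by isBoundedDefault) (by isBoundedDefault)
  · exact limsup_add_const atTop a c (by isBoundedDefault) (by isBoundedDefault)

lemma lim_le_lim_of_forall_le_add (ℓ : LimitReading) {a b : ℝ → ℝ≥0∞}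
    (h : ∀ ε : ℝ≥0, 0 < ε → ∀ᶠ t in atTop, a t ≤ b t + ε) : ℓ.lim a ≤ ℓ.lim b := by
  refine ENNReal.le_of_forall_pos_le_add fun ε hε _ => ?_
  rw [← lim_add_const]
  exact ℓ.lim_mono (h ε hε)

end LimitReading

lemma eventually_const_div_ofReal_le (c : ℝ≥0∞) (hc : c ≠ ∞) {ε : ℝ≥0} (hε : 0 < ε) :
    ∀ᶠ t : ℝ in atTop, c / ENNReal.ofReal t ≤ ε := by
  have h : Tendsto (fun t : ℝ => c / ENNReal.ofReal t) atTop (nhds 0) := by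
    have := ENNReal.Tendsto.const_div (a := c) ENNReal.tendsto_ofReal_atTop (Or.inr hc)
    simpa using this
  exact (h.eventually_lt_const (by exact_mod_cast hε)).mono fun t ht => ht.le

namespace MarkovAutomaton
open PathLaw

variable {S A : Type*} (M : MarkovAutomaton S A)

/-- The times at which a path occupies a state of `G`. -/
def occupation (G : Set S) (π : ℕ → M.Record) : Set ℝ := {u | (M.occupied π u ∩ G).Nonempty}

lemma mem_occupation {G : Set S} {π : ℕ → M.Record} {u : ℝ} :
    u ∈ M.occupation G π ↔ ∃ n, M.stateAt π n ∈ G ∧ M.entryTime π n ≤ u ∧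
      (u < M.entryTime π (n + 1) ∨ u = M.entryTime π n) := by
  constructor
  · rintro ⟨s, ⟨n, rfl, h⟩, hG⟩
    exact ⟨n, hG, h⟩
  · rintro ⟨n, hG, h⟩
    exact ⟨_, ⟨n, rfl, h⟩, hG⟩

section measurable

variable [MeasurableSpace S] [DiscreteMeasurableSpace S]

omit [DiscreteMeasurableSpace S] in
lemma measurable_entryTime (n : ℕ) : Measurable fun π : ℕ → M.Record => M.entryTime π n := by
  unfold entryTime
  fun_prop

lemma measurableSet_occupation_prod (G : Set S) :
    MeasurableSet {p : (ℕ → M.Record) × ℝ | p.2 ∈ M.occupation G p.1} := by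
  simp only [mem_occupation, Set.ofPred_exists]
  refine MeasurableSet.iUnion fun n => ?_
  have h1 : ∀ n, Measurable fun p : (ℕ → M.Record) × ℝ => M.entryTime p.1 n := fun n =>
    (M.measurable_entryTime n).comp measurable_fst
  have h2 : Measurable fun p : (ℕ → M.Record) × ℝ => M.stateAt p.1 n := by
    unfold stateAt; fun_prop
  exact (h2 (MeasurableSet.of_discrete (s := G))).inter
    ((measurableSet_le (h1 n) measurable_snd).inter
      ((measurableSet_lt measurable_snd (h1 (n + 1))).union
        (measurableSet_eq_fun measurable_snd (h1 n))))

end measurable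

lemma measurableSet_occupation (G : Set S) (π : ℕ → M.Record) :
    MeasurableSet (M.occupation G π) := by
  have : M.occupation G π = ⋃ n, {u | M.stateAt π n ∈ G ∧ M.entryTime π n ≤ u ∧
      (u < M.entryTime π (n + 1) ∨ u = M.entryTime π n)} := by
    ext u
    rw [Set.mem_iUnion]
    exact M.mem_occupation
  rw [this]
  refine MeasurableSet.iUnion fun n => ?_
  exact (MeasurableSet.const _).inter (measurableSet_Ici.inter
    (measurableSet_Iio.union (measurableSet_singleton _)))

/-- The time spent in `G` up to time `t`. -/
def timeIn (G : Set S) (π : ℕ → M.Record) (t : ℝ) : ℝ≥0∞ :=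
  volume (M.occupation G π ∩ Set.Icc 0 t)

lemma timeFraction_eq (G : Set S) (π : ℕ → M.Record) (t : ℝ) :
    M.timeFraction G π t = M.timeIn G π t / ENNReal.ofReal t := by
  unfold timeFraction timeIn
  have := lintegral_indicator_one (μ := volume.restrict (Set.Icc 0 t))
    (M.measurableSet_occupation G π)
  rw [Measure.restrict_apply (M.measurableSet_occupation G π)] at this
  rw [← this]
  rfl

lemma timeIn_le (G : Set S) (π : ℕ → M.Record) (t : ℝ) : M.timeIn G π t ≤ ENNReal.ofReal t := by
  refine (measure_mono Set.inter_subset_right).trans ?_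
  simp

lemma timeIn_mono (G : Set S) (π : ℕ → M.Record) : Monotone (M.timeIn G π) := fun _ _ h =>
  measure_mono (Set.inter_subset_inter_right _ (Set.Icc_subset_Icc_right h))

lemma timeIn_le_add (G : Set S) (π : ℕ → M.Record) (s t : ℝ) :
    M.timeIn G π t ≤ M.timeIn G π s + ENNReal.ofReal (t - s) := by
  have h : M.occupation G π ∩ Set.Icc 0 t ⊆ (M.occupation G π ∩ Set.Icc 0 s) ∪ Set.Icc s t := by
    rintro u ⟨hu, h0, ht⟩
    rcases le_total u s with h | h
    · exact Or.inl ⟨hu, h0, h⟩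
    · exact Or.inr ⟨h, ht⟩
  refine (measure_mono h).trans ((measure_union_le _ _).trans ?_)
  simp [timeIn]

lemma timeFraction_le_one (G : Set S) (π : ℕ → M.Record) (t : ℝ) : M.timeFraction G π t ≤ 1 := by
  rw [timeFraction_eq]
  exact ENNReal.div_le_of_le_mul (by simpa using M.timeIn_le G π t)

lemma longRunFraction_le_one (ℓ : LimitReading) (G : Set S) (π : ℕ → M.Record) :
    M.longRunFraction ℓ G π ≤ 1 := by
  rw [← ℓ.lim_const 1]
  exact ℓ.lim_mono (Eventually.of_forall fun t => M.timeFraction_le_one G π t)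

lemma longRunFraction_le_of_timeIn_le (ℓ : LimitReading) {G : Set S} {π π' : ℕ → M.Record}
    (c : ℝ≥0) (h : ∀ t, M.timeIn G π t ≤ M.timeIn G π' t + c) :
    M.longRunFraction ℓ G π ≤ M.longRunFraction ℓ G π' := by
  refine ℓ.lim_le_lim_of_forall_le_add fun ε hε => ?_
  filter_upwards [eventually_const_div_ofReal_le c ENNReal.coe_ne_top hε] with t ht
  rw [timeFraction_eq, timeFraction_eq]
  calc _ ≤ (M.timeIn G π' t + c) / ENNReal.ofReal t := ENNReal.div_le_div_right (h t) _
    _ = M.timeIn G π' t / ENNReal.ofReal t + c / ENNReal.ofReal t := ENNReal.add_div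
    _ ≤ _ := by gcongr

lemma entryTime_pathCons (x : M.Record) (π : ℕ → M.Record) (n : ℕ) :
    M.entryTime (pathCons x π) (n + 1) = M.entryTime π n + (π 0).2.1 := by
  unfold entryTime
  rw [Finset.sum_range_succ']
  rfl

/-- The long-run average does not depend on finite prefixes. -/
lemma longRunFraction_pathCons (ℓ : LimitReading) (G : Set S) (x : M.Record) (π : ℕ → M.Record) :
    M.longRunFraction ℓ G (pathCons x π) = M.longRunFraction ℓ G π := by
  set T : ℝ≥0 := (π 0).2.1 with hT
  have hocc : ∀ u : ℝ, T < u → u ∈ M.occupation G (pathCons x π) → u - T ∈ M.occupation G π := by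
    intro u hu h
    rw [mem_occupation] at h ⊢
    obtain ⟨n, h1, h2, h3⟩ := h
    cases n with
    | zero =>
      exfalso
      rw [entryTime_pathCons] at h3
      simp only [entryTime, Finset.range_zero, Finset.sum_empty, zero_add] at h3
      have := NNReal.coe_nonneg T
      rcases h3 with h3 | h3 <;> linarith
    | succ n =>
      refine ⟨n, h1, ?_⟩
      rw [entryTime_pathCons] at h2 h3
      rw [entryTime_pathCons] at h3
      refine ⟨by linarith, ?_⟩
      rcases h3 with h3 | h3
      · left; linarith
      · right; linarith
  have hocc' : ∀ u : ℝ, u ∈ M.occupation G π → u + T ∈ M.occupation G (pathCons x π) := by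
    intro u h
    rw [mem_occupation] at h ⊢
    obtain ⟨n, h1, h2, h3⟩ := h
    refine ⟨n + 1, h1, ?_⟩
    rw [entryTime_pathCons, entryTime_pathCons]
    refine ⟨by linarith, ?_⟩
    rcases h3 with h3 | h3
    · left; linarith
    · right; linarith
  refine le_antisymm (M.longRunFraction_le_of_timeIn_le ℓ T fun t => ?_)
    (M.longRunFraction_le_of_timeIn_le ℓ T fun t => ?_)
  · have h : M.occupation G (pathCons x π) ∩ Set.Icc 0 t ⊆
        ((fun u : ℝ => u + (-(T : ℝ))) ⁻¹' (M.occupation G π ∩ Set.Icc 0 t)) ∪ Set.Icc 0 (T : ℝ) := by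
      rintro u ⟨hu, h0, ht⟩
      rcases le_or_gt u T with h | h
      · exact Or.inr ⟨h0, h⟩
      · refine Or.inl ⟨hocc u h hu, ?_, ?_⟩
        · simp only; linarith
        · have := NNReal.coe_nonneg T
          simp only; linarith
    refine (measure_mono h).trans ((measure_union_le _ _).trans ?_)
    rw [measure_preimage_add_right]
    simp [timeIn]
  · have h : M.occupation G π ∩ Set.Icc 0 t ⊆
        ((fun u : ℝ => u + T) ⁻¹' (M.occupation G (pathCons x π) ∩ Set.Icc 0 t)) ∪
          Set.Icc (t - T) t := by
      rintro u ⟨hu, h0, ht⟩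
      rcases le_or_gt u (t - T) with h | h
      · refine Or.inl ⟨hocc' u hu, ?_, ?_⟩
        · exact add_nonneg h0 (NNReal.coe_nonneg T)
        · simp only; linarith
      · exact Or.inr ⟨h.le, ht⟩
    refine (measure_mono h).trans ((measure_union_le _ _).trans ?_)
    rw [measure_preimage_add_right]
    simp [timeIn]

lemma timeFraction_natFloor (G : Set S) (π : ℕ → M.Record) {t : ℝ} (ht : 1 ≤ t) :
    M.timeFraction G π t ≤ M.timeFraction G π ⌊t⌋₊ + 1 / ENNReal.ofReal ⌊t⌋₊ ∧
    M.timeFraction G π ⌊t⌋₊ ≤ M.timeFraction G π t + 1 / ENNReal.ofReal ⌊t⌋₊ := by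
  have hn : (⌊t⌋₊ : ℝ) ≤ t := Nat.floor_le (by linarith)
  have hn' : t ≤ ⌊t⌋₊ + 1 := (Nat.lt_floor_add_one t).le
  have hn1 : 1 ≤ ⌊t⌋₊ := (Nat.one_le_floor_iff t).2 ht
  set n := ⌊t⌋₊
  simp only [timeFraction_eq]
  have hnpos : (0 : ℝ) < n := by exact_mod_cast hn1
  have htpos : (0 : ℝ) < t := by linarith
  constructor
  · calc M.timeIn G π t / ENNReal.ofReal t ≤ (M.timeIn G π n + 1) / ENNReal.ofReal n := by
          refine ENNReal.div_le_div ?_ (ENNReal.ofReal_le_ofReal hn)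
          refine (M.timeIn_le_add G π n t).trans ?_
          gcongr
          rw [← ENNReal.ofReal_one]
          exact ENNReal.ofReal_le_ofReal (by linarith)
      _ = _ := ENNReal.add_div
  · have hfin : M.timeIn G π t ≠ ∞ := ((M.timeIn_le G π t).trans_lt ENNReal.ofReal_lt_top).ne
    have hle := M.timeIn_le G π t
    have hmono := M.timeIn_mono G π hn
    generalize M.timeIn G π t = a at *
    lift a to ℝ≥0 using hfin
    refine (ENNReal.div_le_div_right hmono _).trans ?_
    have ha : (a : ℝ) ≤ t := by
      rw [ENNReal.ofReal, ENNReal.coe_le_coe, ← NNReal.coe_le_coe,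
        Real.coe_toNNReal _ htpos.le] at hle
      exact hle
    have e : (a : ℝ≥0∞) = ENNReal.ofReal a := by simp
    rw [e, ← ENNReal.ofReal_one, ← ENNReal.ofReal_div_of_pos hnpos,
      ← ENNReal.ofReal_div_of_pos hnpos, ← ENNReal.ofReal_div_of_pos htpos,
      ← ENNReal.ofReal_add (by positivity) (by positivity)]
    refine ENNReal.ofReal_le_ofReal ?_
    rw [div_add_div _ _ htpos.ne' hnpos.ne', div_le_div_iff₀ hnpos (by positivity)]
    have h0 : (0 : ℝ) ≤ a := NNReal.coe_nonneg a
    nlinarith [mul_le_mul_of_nonneg_left hn' h0, mul_le_mul_of_nonneg_right ha hnpos.le]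

section measurable

variable [MeasurableSpace S] [DiscreteMeasurableSpace S]

lemma measurable_timeIn (G : Set S) (t : ℝ) : Measurable fun π => M.timeIn G π t := by
  have := measurable_measure_prodMk_left (ν := volume.restrict (Set.Icc 0 t))
    (M.measurableSet_occupation_prod G)
  convert this using 2 with π
  rw [timeIn, ← Measure.restrict_apply (M.measurableSet_occupation G π)]
  rfl

lemma measurable_longRunFraction (ℓ : LimitReading) (G : Set S) :
    Measurable (M.longRunFraction ℓ G) := by
  have hfl : ∀ ε : ℝ≥0, 0 < ε → ∀ᶠ t : ℝ in atTop, 1 / ENNReal.ofReal ⌊t⌋₊ ≤ ε := by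
    intro ε hε
    have := (tendsto_natCast_atTop_atTop (R := ℝ)).comp (tendsto_nat_floor_atTop (α := ℝ))
    exact this.eventually (eventually_const_div_ofReal_le 1 ENNReal.one_ne_top hε)
  have h1 : ∀ π, M.longRunFraction ℓ G π = ℓ.lim (fun t => M.timeFraction G π ⌊t⌋₊) := by
    intro π
    refine le_antisymm (ℓ.lim_le_lim_of_forall_le_add fun ε hε => ?_)
      (ℓ.lim_le_lim_of_forall_le_add fun ε hε => ?_)
    · filter_upwards [hfl ε hε, eventually_ge_atTop 1] with t h1 h2
      exact (M.timeFraction_natFloor G π h2).1.trans (by gcongr)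
    · filter_upwards [hfl ε hε, eventually_ge_atTop 1] with t h1 h2
      exact (M.timeFraction_natFloor G π h2).2.trans (by gcongr)
  have hle : Filter.map (fun t : ℝ => ⌊t⌋₊) atTop ≤ atTop := tendsto_nat_floor_atTop
  have hle' : Filter.map (fun n : ℕ => (n : ℝ)) atTop ≤ atTop := tendsto_natCast_atTop_atTop
  have hm : ∀ n : ℕ, Measurable fun π => M.timeFraction G π n := by
    intro n
    simp only [timeFraction_eq]
    exact (M.measurable_timeIn G n).div_const _
  cases ℓ with
  | lower =>
    have : M.longRunFraction .lower G = fun π => liminf (fun n : ℕ => M.timeFraction G π n) atTop := by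
      funext π
      refine le_antisymm ?_ ?_
      · exact liminf_le_liminf_of_le hle'
      · rw [h1]
        exact liminf_le_liminf_of_le (u := fun n : ℕ => M.timeFraction G π n) hle
    rw [this]
    exact Measurable.liminf hm
  | upper =>
    have : M.longRunFraction .upper G = fun π => limsup (fun n : ℕ => M.timeFraction G π n) atTop := by
      funext π
      refine le_antisymm ?_ ?_
      · rw [h1]
        exact limsup_le_limsup_of_le (u := fun n : ℕ => M.timeFraction G π n) hle
      · exact limsup_le_limsup_of_le hle'
    rw [this]
    exact Measurable.limsup hm

end measurable

end MarkovAutomaton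

namespace MarkovAutomaton
open PathLaw

variable {S A : Type*} [Finite S] {M : MarkovAutomaton S A}

namespace EndComponent

/-- An end component is determined by its states and choices. -/
lemma ext' {E F : M.EndComponent} (h1 : E.states = F.states) (h2 : E.acts = F.acts) : E = F := by
  obtain ⟨T, K, _, _, _, _, _, _⟩ := E
  obtain ⟨T', K', _, _, _, _, _, _⟩ := F
  simp only at h1 h2
  subst h1 h2
  rfl

/-- The union of two end components with a common state. -/
def union (E F : M.EndComponent) {r : S} (hE : r ∈ E.states) (hF : r ∈ F.states) :
    M.EndComponent where
  states := E.states ∪ F.states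
  acts s := E.acts s ∪ F.acts s
  states_nonempty := ⟨r, Or.inl hE⟩
  acts_nonempty s hs := by
    rcases hs with hs | hs
    · exact (E.acts_nonempty s hs).mono Set.subset_union_left
    · exact (F.acts_nonempty s hs).mono Set.subset_union_right
  acts_enabled s _ := by
    rintro c (hc | hc)
    · by_cases hs : s ∈ E.states
      · exact E.acts_enabled s hs hc
      · simp [E.acts_eq_empty s hs] at hc
    · by_cases hs : s ∈ F.states
      · exact F.acts_enabled s hs hc
      · simp [F.acts_eq_empty s hs] at hc
  acts_eq_empty s hs := by
    rw [E.acts_eq_empty s fun h => hs (Or.inl h), F.acts_eq_empty s fun h => hs (Or.inr h),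
      Set.union_self]
  closed s _ := by
    rintro c (hc | hc) s' hs'
    · by_cases hs : s ∈ E.states
      · exact Or.inl (E.closed s hs c hc s' hs')
      · simp [E.acts_eq_empty s hs] at hc
    · by_cases hs : s ∈ F.states
      · exact Or.inr (F.closed s hs c hc s' hs')
      · simp [F.acts_eq_empty s hs] at hc
  connected := by
    have h1 : ∀ s ∈ E.states, ∀ s' ∈ E.states, Relation.ReflTransGen
        (fun a b => ∃ c ∈ E.acts a ∪ F.acts a, M.jump a c b ≠ 0) s s' := fun s hs s' hs' =>
      Relation.ReflTransGen.mono (fun a b ⟨c, hc, h⟩ => ⟨c, Or.inl hc, h⟩) _ _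
        (E.connected s hs s' hs')
    have h2 : ∀ s ∈ F.states, ∀ s' ∈ F.states, Relation.ReflTransGen
        (fun a b => ∃ c ∈ E.acts a ∪ F.acts a, M.jump a c b ≠ 0) s s' := fun s hs s' hs' =>
      Relation.ReflTransGen.mono (fun a b ⟨c, hc, h⟩ => ⟨c, Or.inr hc, h⟩) _ _
        (F.connected s hs s' hs')
    rintro s (hs | hs) s' (hs' | hs')
    · exact h1 s hs s' hs'
    · exact (h1 s hs r hE).trans (h2 r hF s' hs')
    · exact (h2 s hs r hF).trans (h1 r hE s' hs')
    · exact h2 s hs s' hs'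

/-- Maximal end components with a common state are equal. -/
lemma IsMaximal.eq_of_mem {E F : M.EndComponent} (hE : E.IsMaximal) (hF : F.IsMaximal) {r : S}
    (h1 : r ∈ E.states) (h2 : r ∈ F.states) : E = F :=
  (hE (E.union F h1 h2) Set.subset_union_left fun _ => Set.subset_union_left).symm.trans
    (hF (E.union F h1 h2) Set.subset_union_right fun _ => Set.subset_union_right)

/-- Every end component is contained in a maximal one. -/
lemma exists_isMaximal (E : M.EndComponent) :
    ∃ F : M.EndComponent, F.IsMaximal ∧ E.states ⊆ F.states ∧ ∀ s, E.acts s ⊆ F.acts s := by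
  let f : M.EndComponent → Set S × (S → Set M.Choice) := fun F => (F.states, F.acts)
  obtain ⟨F, hF⟩ := (Set.toFinite {F | f E ≤ f F}).exists_maximalFor f _ ⟨E, le_refl (f E)⟩
  have hEF : f E ≤ f F := hF.1
  refine ⟨F, fun F' h1 h2 => ?_, hEF.1, hEF.2⟩
  have hFF' : f F ≤ f F' := ⟨h1, h2⟩
  have := hF.2 (show f E ≤ f F' from hEF.trans hFF') hFF'
  exact ext' (le_antisymm this.1 h1) (le_antisymm this.2 h2)

end EndComponent

lemma collapse_of_mem (E : M.MEC) {s : S} (hs : s ∈ E.1.states) : M.collapse s = .u E := by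
  have h : ∃ E : M.MEC, s ∈ E.1.states := ⟨E, hs⟩
  rw [collapse, dif_pos h]
  congr 1
  exact Subtype.ext (EndComponent.IsMaximal.eq_of_mem h.choose.2 E.2 h.choose_spec hs)

lemma exists_frequently_eq {α : Type*} [Finite α] (f : ℕ → α) {p : ℕ → Prop}
    (hp : ∃ᶠ n in atTop, p n) : ∃ a, ∃ᶠ n in atTop, p n ∧ f n = a := by
  by_contra! h
  have h' : ∀ᶠ n in atTop, ∀ a, ¬(p n ∧ f n = a) :=
    eventually_all.2 fun a => (h a).mono fun n hn hn' => hn hn'.1 hn'.2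
  obtain ⟨n, hn, hn'⟩ := (hp.and_eventually h').exists
  exact hn' _ ⟨hn, rfl⟩

/-- The states and choices that occur infinitely often on a path form an end component, if the path
makes enabled choices and all successors of these choices occur. -/
theorem exists_endComponent_of_frequently {σ : ℕ → S} {γ : ℕ → M.Choice}
    (henabled : ∀ n, γ n ∈ M.enabled (σ n)) (hjump : ∀ n, M.jump (σ n) (γ n) (σ (n + 1)) ≠ 0)
    (hsucc : ∀ s c s', M.jump s c s' ≠ 0 → (∃ᶠ n in atTop, σ n = s ∧ γ n = c) →
      ∃ᶠ n in atTop, (σ n = s ∧ γ n = c) ∧ σ (n + 1) = s') :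
    ∃ E : M.EndComponent, ∀ᶠ n in atTop, σ n ∈ E.states ∧ γ n ∈ E.acts (σ n) := by
  have hev : ∀ᶠ n in atTop, ∃ᶠ k in atTop, σ k = σ n ∧ γ k = γ n := by
    have : ∀ᶠ n in atTop, ∀ p : S × M.Choice, (¬∃ᶠ k in atTop, σ k = p.1 ∧ γ k = p.2) →
        ¬(σ n = p.1 ∧ γ n = p.2) := by
      refine eventually_all.2 fun p => ?_
      by_cases h : ∃ᶠ k in atTop, σ k = p.1 ∧ γ k = p.2
      · exact Eventually.of_forall fun n hn => absurd h hn
      · exact (not_frequently.1 h).mono fun n hn _ => hn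
    filter_upwards [this] with n hn
    by_contra h
    exact hn (σ n, γ n) h ⟨rfl, rfl⟩
  refine ⟨{ states := {s | ∃ᶠ n in atTop, σ n = s}
            acts := fun s => {c | ∃ᶠ n in atTop, σ n = s ∧ γ n = c}
            states_nonempty := ?_
            acts_nonempty := fun s hs => exists_frequently_eq γ hs
            acts_enabled := ?_
            acts_eq_empty := ?_
            closed := ?_
            connected := ?_ }, ?_⟩
  · obtain ⟨s, hs⟩ := exists_frequently_eq σ (p := fun _ => True) (Eventually.frequently (by simp))
    exact ⟨s, hs.mono fun n hn => hn.2⟩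
  · intro s _ c hc
    obtain ⟨n, rfl, rfl⟩ := hc.exists
    exact henabled n
  · intro s hs
    ext c
    simp only [Set.mem_ofPred_eq, Set.mem_empty_iff_false, iff_false]
    exact fun hc => hs (hc.mono fun n hn => hn.1)
  · intro s _ c hc s' hs'
    have := (hsucc s c s' hs' hc).mono fun n hn => hn.2
    exact (tendsto_add_atTop_nat 1).frequently this
  · intro s hs s' hs'
    obtain ⟨N, hN⟩ := eventually_atTop.1 hev
    obtain ⟨n, hn, rfl⟩ := frequently_atTop.1 hs N
    obtain ⟨m, hm, rfl⟩ := frequently_atTop.1 hs' n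
    have hn' : N ≤ n := hn
    have hm' : n ≤ m := hm
    clear hm
    induction m, hm' using Nat.le_induction with
    | base => exact Relation.ReflTransGen.refl
    | succ m hm ih =>
      refine (ih ?_).tail ⟨γ m, hN m (hn'.trans hm), hjump m⟩
      exact (hN m (hn'.trans hm)).mono fun k hk => hk.1
  · filter_upwards [hev] with n hn
    exact ⟨hn.mono fun k hk => hk.1, hn⟩

section measure

variable (M) [MeasurableSpace S] [DiscreteMeasurableSpace S]

lemma law_apply (p : S × M.Choice) : M.law p
    = (Measure.dirac p.2).prod ((M.delay p.1 p.2).prod (M.jump p.1 p.2).toMeasure) := rfl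

lemma ae_law_choice (p : S × M.Choice) : ∀ᵐ x ∂(M.law p), x.1 = p.2 := by
  have h : ∀ᵐ c ∂((M.law p).map Prod.fst), c = p.2 := by
    rw [law_apply, Measure.map_fst_prod, measure_univ, one_smul]
    exact (ae_dirac_iff (MeasurableSet.of_discrete (s := {c | c = p.2}))).2 rfl
  exact ae_of_ae_map measurable_fst.aemeasurable h

lemma map_state_law (p : S × M.Choice) :
    (M.law p).map (fun x => x.2.2) = (M.jump p.1 p.2).toMeasure := by
  have e : (fun x : M.Record => x.2.2) = Prod.snd ∘ Prod.snd := rfl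
  rw [e, ← Measure.map_map measurable_snd measurable_snd, law_apply, Measure.map_snd_prod,
    measure_univ, one_smul, Measure.map_snd_prod, measure_univ, one_smul]

lemma ae_law_jump (p : S × M.Choice) : ∀ᵐ x ∂(M.law p), M.jump p.1 p.2 x.2.2 ≠ 0 := by
  have h : ∀ᵐ s ∂((M.law p).map (fun x => x.2.2)), M.jump p.1 p.2 s ≠ 0 := by
    rw [map_state_law, ae_iff, PMF.toMeasure_apply_eq_zero_iff _ MeasurableSet.of_discrete]
    rw [Set.disjoint_left]
    intro s hs hs'
    exact hs' ((PMF.mem_support_iff _ _).1 hs)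
  exact ae_of_ae_map (measurable_snd.comp measurable_snd).aemeasurable h

lemma lintegral_law (p : S × M.Choice) (φ : S → ℝ≥0∞) :
    ∫⁻ x, φ x.2.2 ∂(M.law p) = ∑' s, M.jump p.1 p.2 s * φ s := by
  rw [← lintegral_map (f := φ) (g := fun x : M.Record => x.2.2) (measurable_of_countable φ)
    (measurable_snd.comp measurable_snd), map_state_law, lintegral_countable']
  refine tsum_congr fun s => ?_
  rw [PMF.toMeasure_apply_singleton _ _ (MeasurableSet.singleton s), mul_comm]

lemma law_state (p : S × M.Choice) (s : S) : M.law p {x | x.2.2 = s} = M.jump p.1 p.2 s := by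
  have : (M.law p).map (fun x => x.2.2) {s} = M.jump p.1 p.2 s := by
    rw [map_state_law, PMF.toMeasure_apply_singleton _ _ (MeasurableSet.singleton s)]
  rw [← this, Measure.map_apply (by fun_prop) (MeasurableSet.singleton s)]
  rfl

omit [Finite S] [DiscreteMeasurableSpace S] in
lemma measurable_recordState : Measurable fun x : M.Record => x.2.2 :=
  measurable_snd.comp measurable_snd

/-- The path measure for an arbitrary initial record. -/
abbrev prFrom (D : M.MAPolicy) (x : M.Record) : Measure (ℕ → M.Record) :=
  D.pathMeasure M.measurable_recordState M.law x

lemma ae_step (D : M.MAPolicy) (x : M.Record) :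
    ∀ᵐ π ∂(M.prFrom D x), ∀ n, (π (n + 1)).1 ∈ M.enabled (M.stateAt π n) ∧
      M.jump (M.stateAt π n) (π (n + 1)).1 (M.stateAt π (n + 1)) ≠ 0 := by
  let K : Set (M.Record × M.Record) :=
    {q | q.2.1 ∈ M.enabled q.1.2.2 ∧ M.jump q.1.2.2 q.2.1 q.2.2.2 ≠ 0}
  have hK : MeasurableSet K := by
    have : Measurable fun q : M.Record × M.Record => (q.1.2.2, q.2.1, q.2.2.2) := by fun_prop
    exact this (MeasurableSet.of_discrete
      (s := {q : S × M.Choice × S | q.2.1 ∈ M.enabled q.1 ∧ M.jump q.1 q.2.1 q.2.2 ≠ 0}))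
  refine D.ae_alwaysStep M.measurable_recordState M.law x hK fun n h => ?_
  filter_upwards [D.mem_enabled n h] with c hc
  filter_upwards [M.ae_law_choice (h.last.2.2, c), M.ae_law_jump (h.last.2.2, c)] with y h1 h2
  exact ⟨by rw [h1]; exact hc, by rw [h1]; exact h2⟩

/-- Almost surely, a path eventually stays in a maximal end component. -/
theorem ae_eventually_mem_mec (D : M.MAPolicy) (x : M.Record) :
    ∀ᵐ π ∂(M.prFrom D x), ∃ E : M.MEC, ∀ᶠ n in atTop,
      M.stateAt π n ∈ E.1.states ∧ (π (n + 1)).1 ∈ E.1.acts (M.stateAt π n) := by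
  have h1 : ∀ᵐ π ∂(M.prFrom D x), ∀ s c s', M.jump s c s' ≠ 0 →
      (∃ᶠ n in atTop, M.stateAt π n = s ∧ (π (n + 1)).1 = c) →
      ∃ᶠ n in atTop, (M.stateAt π n = s ∧ (π (n + 1)).1 = c) ∧ M.stateAt π (n + 1) = s' := by
    refine ae_all_iff.2 fun s => ae_all_iff.2 fun c => ae_all_iff.2 fun s' => ?_
    by_cases hs : M.jump s c s' = 0
    · exact Eventually.of_forall fun π h => absurd hs h
    have := D.ae_frequently_of_frequently M.measurable_recordState M.law x
      (choice := Prod.fst) measurable_fst M.ae_law_choice s c (B := {x | x.2.2 = s'})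
      (M.measurable_recordState (MeasurableSet.singleton s')) (by rw [law_state]; exact hs)
    filter_upwards [this] with π hπ _
    exact hπ
  filter_upwards [h1, M.ae_step D x] with π h1 h2
  obtain ⟨E, hE⟩ := exists_endComponent_of_frequently (σ := M.stateAt π)
    (γ := fun n => (π (n + 1)).1) (fun n => (h2 n).1) (fun n => (h2 n).2) h1
  obtain ⟨F, hF, hs, ha⟩ := E.exists_isMaximal
  exact ⟨⟨F, hF⟩, hE.mono fun n hn => ⟨hs hn.1, ha _ hn.2⟩⟩

end measure

end MarkovAutomaton

lemma PMF.map_subtype_val_apply {S : Type*} {T : Set S} (ν : PMF T) (t : T) :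
    ν.map Subtype.val (t : S) = ν t := by
  rw [PMF.map_apply, tsum_eq_single t]
  · simp
  · intro b hb
    rw [if_neg]
    exact fun e => hb (Subtype.ext e.symm)

lemma PMF.map_subtype_val_apply_of_notMem {S : Type*} {T : Set S} (ν : PMF T) {s : S}
    (hs : s ∉ T) : ν.map Subtype.val s = 0 := by
  rw [PMF.map_apply, ENNReal.tsum_eq_zero]
  intro b
  rw [if_neg]
  rintro rfl
  exact hs b.2

namespace MarkovAutomaton
open PathLaw

variable {S A : Type*} [Finite S] {M : MarkovAutomaton S A}

lemma branch_apply {s s' : S} (h : M.exitRate s ≠ 0) :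
    M.branch s s' = M.rate s s' * (M.exitRate s : ℝ≥0∞)⁻¹ := by
  rw [branch, dif_neg h, PMF.normalize_apply, tsum_rate]

lemma branch_eq_pure {s : S} (h : M.exitRate s = 0) : M.branch s = PMF.pure s := by
  rw [branch, dif_pos h]

namespace EndComponent

variable (E : M.EndComponent) (s₀ : E.states)

lemma mem_prob_toMA {y : E.states × A × PMF E.states} : y ∈ (E.toMA s₀).prob ↔
    ∃ hx : liftTransition y ∈ M.prob, Choice.act ⟨liftTransition y, hx⟩ ∈ E.acts y.1 := by
  classical
  unfold toMA
  simp only [Finset.mem_preimage, Finset.mem_filter]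
  exact ⟨fun h => h.2, fun h => ⟨h.1, h⟩⟩

/-- A choice of an end component, as one of the whole automaton. -/
def liftChoice : (E.toMA s₀).Choice → M.Choice
  | none => Choice.bot
  | some y => Choice.act ⟨liftTransition y.1, ((E.mem_prob_toMA s₀).1 y.2).1⟩

lemma liftChoice_injective : Function.Injective (E.liftChoice s₀) := by
  intro c c' h
  match c, c' with
  | none, none => rfl
  | none, some y => exact absurd h (by simp [liftChoice, Choice.bot, Choice.act])
  | some y, none => exact absurd h (by simp [liftChoice, Choice.bot, Choice.act])
  | some y, some y' =>
    have h1 := Option.some.inj h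
    have h2 : liftTransition y.1 = liftTransition y'.1 := congrArg Subtype.val h1
    exact congrArg some (Subtype.ext (liftTransition_injective h2))

lemma liftChoice_mem_acts {s : E.states} {c : (E.toMA s₀).Choice}
    (hc : c ∈ (E.toMA s₀).enabled s) : E.liftChoice s₀ c ∈ E.acts s := by
  rcases hc with ⟨y, rfl, rfl⟩ | ⟨rfl, hM⟩
  · exact ((E.mem_prob_toMA s₀).1 y.2).2
  · obtain ⟨c, hc⟩ := E.acts_nonempty s s.2
    have hcl := E.closed s s.2 c hc
    rcases E.acts_enabled s s.2 hc with ⟨⟨⟨s1, a, μ⟩, hx⟩, rfl, h1⟩ | ⟨rfl, _⟩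
    · exfalso
      obtain ⟨s, hs⟩ := s
      have h1' : s1 = s := h1
      subst h1'
      obtain ⟨ν, hν⟩ := exists_pmf_subtype (T := E.states) μ hcl
      refine hM ⟨(⟨s1, hs⟩, a, ν), ?_, rfl⟩
      have e : liftTransition ((⟨s1, hs⟩, a, ν) : E.states × A × PMF E.states) = (s1, a, μ) := by
        simp [liftTransition, hν]
      rw [mem_prob_toMA]
      exact ⟨by rw [e]; exact hx, by simp only [e]; exact hc⟩
    · exact hc

lemma exists_liftChoice_eq {s : E.states} {c : M.Choice} (hc : c ∈ E.acts s) :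
    ∃ c' ∈ (E.toMA s₀).enabled s, E.liftChoice s₀ c' = c := by
  have hcl := E.closed s s.2 c hc
  rcases E.acts_enabled s s.2 hc with ⟨⟨⟨s1, a, μ⟩, hx⟩, rfl, h1⟩ | ⟨rfl, hM⟩
  · obtain ⟨s, hs⟩ := s
    have h1' : s1 = s := h1
    subst h1'
    obtain ⟨ν, hν⟩ := exists_pmf_subtype (T := E.states) μ hcl
    have e : liftTransition ((⟨s1, hs⟩, a, ν) : E.states × A × PMF E.states) = (s1, a, μ) := by
      simp [liftTransition, hν]
    have hmem : ((⟨s1, hs⟩, a, ν) : E.states × A × PMF E.states) ∈ (E.toMA s₀).prob := by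
      rw [mem_prob_toMA]
      exact ⟨by rw [e]; exact hx, by simp only [e]; exact hc⟩
    refine ⟨Choice.act ⟨_, hmem⟩, Or.inl ⟨_, rfl, rfl⟩, ?_⟩
    exact congrArg some (Subtype.ext e)
  · refine ⟨Choice.bot, Or.inr ⟨rfl, ?_⟩, rfl⟩
    rintro ⟨y, hy, rfl⟩
    exact hM ⟨liftTransition y, ((E.mem_prob_toMA s₀).1 hy).1, rfl⟩

lemma rate_toMA (s s' : E.states) : (E.toMA s₀).rate s s' = M.rate s s' := by
  classical
  unfold rate
  refine Finset.sum_nbij liftMark ?_ liftMark_injective.injOn ?_ fun _ _ => rfl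
  · intro y hy
    simp only [Finset.mem_filter] at hy ⊢
    obtain ⟨hy, h1, h2⟩ := hy
    exact ⟨(Finset.mem_preimage (hf := liftMark_injective.injOn)).1 hy,
      congrArg Subtype.val h1, congrArg Subtype.val h2⟩
  · rintro ⟨s1, r, s2⟩ hx
    simp only [Finset.coe_filter, Set.mem_ofPred_eq] at hx
    obtain ⟨hx, rfl, rfl⟩ := hx
    refine ⟨(s, r, s'), ?_, rfl⟩
    simp only [Finset.coe_filter, Set.mem_ofPred_eq]
    exact ⟨(Finset.mem_preimage (hf := liftMark_injective.injOn)).2 hx, by simp, by simp⟩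

lemma exitRate_toMA {s : E.states} (h : Choice.bot ∈ E.acts s) :
    (E.toMA s₀).exitRate s = M.exitRate s := by
  have h0 : ∀ s' ∉ E.states, M.rate s s' = 0 := by
    intro s' hs'
    by_contra hr
    have hexit : M.exitRate s ≠ 0 := by
      intro h0
      have := tsum_rate M (s : S)
      rw [h0, ENNReal.coe_zero, ENNReal.tsum_eq_zero] at this
      exact hr (by exact_mod_cast this s')
    refine hs' (E.closed s s.2 _ h s' ?_)
    change M.branch s s' ≠ 0
    rw [branch_apply hexit]
    exact mul_ne_zero (by exact_mod_cast hr) (ENNReal.inv_ne_zero.2 ENNReal.coe_ne_top)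
  have h1 := tsum_rate (E.toMA s₀) s
  have h2 := tsum_rate M (s : S)
  simp only [rate_toMA] at h1
  have h3 : ∑' s' : E.states, (M.rate s s' : ℝ≥0∞) = ∑' s', (M.rate s s' : ℝ≥0∞) :=
    tsum_subtype_eq_of_support_subset (f := fun s' => (M.rate s s' : ℝ≥0∞)) (by
      intro s' hs'
      by_contra hn
      exact hs' (by simp [h0 s' hn]))
  rw [h1, h2] at h3
  exact_mod_cast h3

lemma map_branch_toMA {s : E.states} (h : Choice.bot ∈ E.acts s) :
    ((E.toMA s₀).branch s).map Subtype.val = M.branch s := by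
  have he := E.exitRate_toMA s₀ h
  by_cases h0 : M.exitRate s = 0
  · rw [branch_eq_pure h0, branch_eq_pure (he.trans h0), PMF.pure_map]
  · ext s'
    by_cases hs' : s' ∈ E.states
    · have := PMF.map_subtype_val_apply ((E.toMA s₀).branch s) ⟨s', hs'⟩
      rw [this, branch_apply h0, branch_apply (by rw [he]; exact h0), he, rate_toMA]
    · rw [PMF.map_subtype_val_apply_of_notMem _ hs']
      by_contra hn
      exact hs' (E.closed s s.2 _ h s' (Ne.symm hn))

lemma map_jump_toMA {s : E.states} {c : (E.toMA s₀).Choice} (hc : c ∈ (E.toMA s₀).enabled s) :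
    ((E.toMA s₀).jump s c).map Subtype.val = M.jump s (E.liftChoice s₀ c) := by
  match c with
  | none => exact E.map_branch_toMA s₀ (E.liftChoice_mem_acts s₀ hc)
  | some y => rfl

lemma delay_toMA {s : E.states} {c : (E.toMA s₀).Choice} (hc : c ∈ (E.toMA s₀).enabled s) :
    (E.toMA s₀).delay s c = M.delay s (E.liftChoice s₀ c) := by
  match c with
  | none =>
    have := E.exitRate_toMA s₀ (E.liftChoice_mem_acts s₀ hc)
    simp only [delay, liftChoice, Choice.bot, this]
  | some y => rfl

/-- A record of an end component, as one of the whole automaton. -/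
def liftRecord (x : (E.toMA s₀).Record) : M.Record := (E.liftChoice s₀ x.1, x.2.1, x.2.2)

lemma longRunFraction_liftRecord (ℓ : LimitReading) (G : Set S) (π : ℕ → (E.toMA s₀).Record) :
    M.longRunFraction ℓ G (fun n => E.liftRecord s₀ (π n))
      = (E.toMA s₀).longRunFraction ℓ (Subtype.val ⁻¹' G) π := by
  have h : M.occupation G (fun n => E.liftRecord s₀ (π n))
      = (E.toMA s₀).occupation (Subtype.val ⁻¹' G) π := by
    ext u
    rw [mem_occupation, mem_occupation]
    rfl
  unfold longRunFraction
  congr 1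
  funext t
  rw [timeFraction_eq, timeFraction_eq, timeIn, timeIn, h]

variable [MeasurableSpace S]

lemma measurable_liftRecord : Measurable (E.liftRecord s₀) := by
  change Measurable fun x : (E.toMA s₀).Record => (E.liftChoice s₀ x.1, x.2.1, (x.2.2 : S))
  exact ((Measurable.of_discrete (f := E.liftChoice s₀)).comp measurable_fst).prodMk
    ((measurable_fst.comp measurable_snd).prodMk
    (measurable_subtype_coe.comp (measurable_snd.comp measurable_snd)))

variable [DiscreteMeasurableSpace S]

lemma map_law_toMA {s : E.states} {c : (E.toMA s₀).Choice} (hc : c ∈ (E.toMA s₀).enabled s) :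
    ((E.toMA s₀).law (s, c)).map (E.liftRecord s₀) = M.law (s, E.liftChoice s₀ c) := by
  have e : E.liftRecord s₀ = Prod.map (E.liftChoice s₀) (Prod.map id Subtype.val) := rfl
  rw [e, law_apply, law_apply, ← Measure.map_prod_map _ _ Measurable.of_discrete
    (measurable_id.prodMap measurable_subtype_coe), ← Measure.map_prod_map _ _ measurable_id
    measurable_subtype_coe, Measure.map_id, PMF.toMeasure_map _ _ measurable_subtype_coe,
    E.map_jump_toMA s₀ hc, E.delay_toMA s₀ hc, Measure.map_dirac' Measurable.of_discrete]

end EndComponent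

end MarkovAutomaton

namespace MarkovAutomaton
open PathLaw

variable {S A : Type*} [Finite S] [MeasurableSpace S] [DiscreteMeasurableSpace S]

section value

variable (M : MarkovAutomaton S A)

/-- A stationary policy that takes an arbitrary enabled choice. -/
def defaultPolicy : M.MAPolicy :=
  Policy.stationary M.measurable_recordState (c := fun s => (M.enabled_nonempty s).some)
    (measurable_of_countable _) (fun s => (M.enabled_nonempty s).some_mem)

lemma lraMin_le_lintegral (ℓ : LimitReading) (G : Set S) (D : M.MAPolicy) (x : M.Record) :
    M.lraMin ℓ x.2.2 G ≤ ∫⁻ π, M.longRunFraction ℓ G π ∂(M.prFrom D x) := by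
  classical
  let r : M.Record → M.Record := fun y => if y.2.2 = x.2.2 then x else y
  have hr : Measurable r := Measurable.ite
    (M.measurable_recordState (MeasurableSet.singleton x.2.2)) measurable_const measurable_id
  have hs : ∀ y, (r y).2.2 = y.2.2 := by
    intro y
    by_cases h : y.2.2 = x.2.2 <;> simp [r, h]
  have := D.lintegral_comapFirst M.measurable_recordState M.law r hr hs
    (M.measurable_longRunFraction ℓ G)
    (fun y π => by rw [longRunFraction_pathCons, longRunFraction_pathCons])
    (Choice.bot, 0, x.2.2)
  have hx : r (Choice.bot, 0, x.2.2) = x := by simp [r]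
  rw [hx] at this
  rw [prFrom, ← this]
  exact iInf_le _ _

lemma lraMin_le_one (ℓ : LimitReading) (s : S) (G : Set S) : M.lraMin ℓ s G ≤ 1 := by
  refine (M.lraMin_le_lintegral ℓ G M.defaultPolicy (Choice.bot, 0, s)).trans ?_
  calc _ ≤ ∫⁻ _, 1 ∂(M.prFrom M.defaultPolicy (Choice.bot, 0, s)) :=
        lintegral_mono fun π => M.longRunFraction_le_one ℓ G π
    _ = 1 := by simp

/-- The minimal long-run average does not decrease in expectation by any choice. -/
theorem lraMin_le_tsum (ℓ : LimitReading) (G : Set S) {s : S} {c : M.Choice}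
    (hc : c ∈ M.enabled s) : M.lraMin ℓ s G ≤ ∑' s', M.jump s c s' * M.lraMin ℓ s' G := by
  have := Policy.iInf_lintegral_subharmonic M.measurable_recordState M.law M.enabled_nonempty
    (dummy := fun s => (Choice.bot, 0, s)) (by fun_prop) (fun _ => rfl)
    (M.measurable_longRunFraction ℓ G)
    (fun y π => by rw [longRunFraction_pathCons, longRunFraction_pathCons])
    (s := s) (fun π => M.longRunFraction_pathCons ℓ G _ π) hc
  exact this.trans_eq (M.lintegral_law (s, c) fun s' => M.lraMin ℓ s' G)

/-- The minimal long-run average is constant on end components. -/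
theorem lraMin_eq_of_mem (ℓ : LimitReading) (G : Set S) (E : M.EndComponent) {s s' : S}
    (hs : s ∈ E.states) (hs' : s' ∈ E.states) : M.lraMin ℓ s G = M.lraMin ℓ s' G := by
  obtain ⟨m, hm, hmax⟩ := Set.exists_max_image E.states (fun s => M.lraMin ℓ s G)
    (Set.toFinite _) E.states_nonempty
  have key : ∀ t, Relation.ReflTransGen (fun a b => ∃ c ∈ E.acts a, M.jump a c b ≠ 0) m t →
      t ∈ E.states ∧ M.lraMin ℓ t G = M.lraMin ℓ m G := by
    intro t ht
    induction ht with
    | refl => exact ⟨hm, rfl⟩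
    | @tail a b _ hab ih =>
      obtain ⟨c, hc, hab⟩ := hab
      obtain ⟨ha, hva⟩ := ih
      have hb := E.closed a ha c hc b hab
      refine ⟨hb, le_antisymm (hmax b hb) ?_⟩
      by_contra! hlt
      have h1 := M.lraMin_le_tsum ℓ G (E.acts_enabled a ha hc)
      have h2 : ∑' t, M.jump a c t * M.lraMin ℓ m G = M.lraMin ℓ m G := by
        rw [ENNReal.tsum_mul_right, PMF.tsum_coe, one_mul]
      have hjt : M.jump a c b ≠ ∞ := PMF.apply_ne_top _ _
      have h3 : ∑' t, M.jump a c t * M.lraMin ℓ t G < ∑' t, M.jump a c t * M.lraMin ℓ m G := by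
        refine ENNReal.tsum_lt_tsum (i := b) ?_ ?_ ?_
        · have h4 : ∑' t, M.jump a c t * M.lraMin ℓ t G ≤ ∑' t, M.jump a c t * 1 :=
            ENNReal.tsum_le_tsum fun t => mul_le_mul_right (M.lraMin_le_one ℓ t G) _
          simp only [mul_one, PMF.tsum_coe] at h4
          exact (h4.trans_lt ENNReal.one_lt_top).ne
        · intro t
          by_cases ht : M.jump a c t = 0
          · simp [ht]
          · exact mul_le_mul_right (hmax t (E.closed a ha c hc t ht)) _
        · exact (ENNReal.mul_lt_mul_iff_right hab hjt).2 hlt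
      rw [h2, ← hva] at h3
      exact absurd h1 (not_le.2 h3)
  rw [(key s (E.connected m hm s hs)).2, (key s' (E.connected m hm s' hs')).2]

end value

namespace EndComponent

variable {M : MarkovAutomaton S A} (E : M.EndComponent) (s₀ : E.states)

open Classical in
/-- A left inverse of `liftRecord`. -/
def lowerRecord (x : M.Record) : (E.toMA s₀).Record :=
  (have : Nonempty (E.toMA s₀).Choice := ⟨Choice.bot⟩; Function.invFun (E.liftChoice s₀) x.1, x.2.1,
    if h : x.2.2 ∈ E.states then ⟨x.2.2, h⟩ else s₀)

omit [MeasurableSpace S] [DiscreteMeasurableSpace S] in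
lemma lowerRecord_liftRecord (x : (E.toMA s₀).Record) :
    E.lowerRecord s₀ (E.liftRecord s₀ x) = x := by
  have : Nonempty (E.toMA s₀).Choice := ⟨Choice.bot⟩
  obtain ⟨c, t, s⟩ := x
  simp only [lowerRecord, liftRecord]
  rw [Function.leftInverse_invFun (E.liftChoice_injective s₀) c]
  simp

omit [MeasurableSpace S] [DiscreteMeasurableSpace S] in
lemma state_lowerRecord {x : M.Record} (h : x.2.2 ∈ E.states) :
    ((E.lowerRecord s₀ x).2.2 : S) = x.2.2 := by
  simp [lowerRecord, h]

lemma measurable_lowerRecord : Measurable (E.lowerRecord s₀) := by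
  classical
  have : Nonempty (E.toMA s₀).Choice := ⟨Choice.bot⟩
  unfold lowerRecord
  exact ((Measurable.of_discrete (f := Function.invFun (E.liftChoice s₀))).comp
    measurable_fst).prodMk ((measurable_fst.comp measurable_snd).prodMk
    ((Measurable.of_discrete
      (f := fun s : S => if h : s ∈ E.states then (⟨s, h⟩ : E.states) else s₀)).comp
      M.measurable_recordState))

open Classical in
/-- A policy for an end component, as a policy for the whole automaton. -/
def liftPolicy (D : (E.toMA s₀).MAPolicy) : M.MAPolicy where
  choose n := Kernel.piecewise (s := {h : History M.Record n | h.last.2.2 ∈ E.states})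
    ((M.measurable_recordState.comp History.measurable_last)
      (MeasurableSet.of_discrete (s := E.states)))
    (((D.choose n).comap (fun (h : History M.Record n) i => E.lowerRecord s₀ (h i))
      (measurable_pi_lambda _ fun i =>
      (E.measurable_lowerRecord s₀).comp (measurable_pi_apply i))).map (E.liftChoice s₀))
    (M.defaultPolicy.choose n)
  isMarkov n := by
    have := Kernel.IsMarkovKernel.map ((D.choose n).comap
      (fun (h : History M.Record n) i => E.lowerRecord s₀ (h i))
      (measurable_pi_lambda _ fun i => (E.measurable_lowerRecord s₀).comp (measurable_pi_apply i)))
      (Measurable.of_discrete (f := E.liftChoice s₀))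
    infer_instance
  mem_enabled n h := by
    rw [Kernel.piecewise_apply]
    by_cases hl : h.last.2.2 ∈ E.states
    · rw [if_pos (show h ∈ {h : History M.Record n | h.last.2.2 ∈ E.states} from hl),
        Kernel.map_apply _ Measurable.of_discrete,
        ae_map_iff Measurable.of_discrete.aemeasurable MeasurableSet.of_discrete,
        Kernel.comap_apply]
      filter_upwards [D.mem_enabled n fun i => E.lowerRecord s₀ (h i)] with c hc
      have h1 := E.liftChoice_mem_acts s₀ hc
      have h2 : (((History.last fun i => E.lowerRecord s₀ (h i)).2.2 : E.states) : S)
          = h.last.2.2 := E.state_lowerRecord s₀ hl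
      rw [h2] at h1
      exact E.acts_enabled _ hl h1
    · rw [if_neg (show h ∉ {h : History M.Record n | h.last.2.2 ∈ E.states} from hl)]
      exact M.defaultPolicy.mem_enabled n h

lemma choose_liftPolicy (D : (E.toMA s₀).MAPolicy) (n : ℕ) (h : History (E.toMA s₀).Record n) :
    (E.liftPolicy s₀ D).choose n (fun i => E.liftRecord s₀ (h i))
      = (D.choose n h).map (E.liftChoice s₀) := by
  classical
  unfold liftPolicy
  simp only
  rw [Kernel.piecewise_apply, if_pos, Kernel.map_apply _ Measurable.of_discrete,
    Kernel.comap_apply]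
  · simp_rw [lowerRecord_liftRecord]
  · exact h.last.2.2.2

lemma stepKernel_liftPolicy (D : (E.toMA s₀).MAPolicy) (n : ℕ)
    (h : History (E.toMA s₀).Record n) :
    (E.liftPolicy s₀ D).stepKernel M.measurable_recordState M.law n
        (fun i => E.liftRecord s₀ (h i))
      = (D.stepKernel (E.toMA s₀).measurable_recordState (E.toMA s₀).law n h).map
          (E.liftRecord s₀) := by
  refine Measure.ext_of_lintegral _ fun φ hφ => ?_
  rw [Policy.lintegral_stepKernel _ _ _ _ _ hφ, lintegral_map hφ (E.measurable_liftRecord s₀),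
    Policy.lintegral_stepKernel _ _ _ _ _ (φ := fun x => φ (E.liftRecord s₀ x))
      (hφ.comp (E.measurable_liftRecord s₀)), choose_liftPolicy,
    lintegral_map Measurable.of_discrete Measurable.of_discrete]
  refine lintegral_congr_ae ?_
  filter_upwards [D.mem_enabled n h] with c hc
  rw [← lintegral_map hφ (E.measurable_liftRecord s₀), E.map_law_toMA s₀ hc]
  rfl

/-- The minimal long-run average of an automaton is at most that of an end component. -/
theorem lraMin_le_lraMin_toMA (ℓ : LimitReading) (G : Set S) (s : E.states) :
    M.lraMin ℓ s G ≤ (E.toMA s₀).lraMin ℓ s (Subtype.val ⁻¹' G) := by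
  refine le_iInf fun D => ?_
  set x₀ : (E.toMA s₀).Record := (Choice.bot, 0, s)
  refine (M.lraMin_le_lintegral ℓ G (E.liftPolicy s₀ D) (E.liftRecord s₀ x₀)).trans ?_
  have hι := E.measurable_liftRecord s₀
  have h := Follows.restrict_le_map
    (Policy.follows_pathMeasure (E.toMA s₀).measurable_recordState (E.toMA s₀).law D x₀)
    (Policy.follows_pathMeasure M.measurable_recordState M.law (E.liftPolicy s₀ D)
      (E.liftRecord s₀ x₀)) hι (K := Set.univ) MeasurableSet.univ (by
        have h1 := pathLaw_map_zero ((E.liftPolicy s₀ D).stepKernel M.measurable_recordState M.law)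
          (E.liftRecord s₀ x₀)
        have h2 := pathLaw_map_zero (D.stepKernel (E.toMA s₀).measurable_recordState
          (E.toMA s₀).law) x₀
        have h3 := congrArg (Measure.map (E.liftRecord s₀)) h2
        rw [Measure.map_map hι (measurable_pi_apply 0), Measure.map_dirac' hι] at h3
        exact (h1.trans h3.symm).le)
    (fun n => Eventually.of_forall fun π => by
      simp only [Set.mem_univ, Set.ofPred_true, Measure.restrict_univ]
      exact (E.stepKernel_liftPolicy s₀ D n _).le)
  have huniv : alwaysStep (Set.univ : Set (M.Record × M.Record)) = Set.univ := by
    simp [alwaysStep]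
  rw [huniv, Measure.restrict_univ] at h
  have hιp : Measurable (fun (π : ℕ → (E.toMA s₀).Record) n => E.liftRecord s₀ (π n)) :=
    measurable_pi_lambda _ fun n => hι.comp (measurable_pi_apply n)
  refine (lintegral_mono' h le_rfl).trans ?_
  rw [lintegral_map (M.measurable_longRunFraction ℓ G) hιp]
  simp_rw [longRunFraction_liftRecord]
  exact le_rfl

open Classical in
/-- The choice of an end component for a choice of the whole automaton: the same one, if the end
component has it. -/
def lowerChoice (s : E.states) (c : M.Choice) : (E.toMA s₀).Choice :=
  if h : c ∈ E.acts s then (E.exists_liftChoice_eq s₀ h).choose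
  else ((E.toMA s₀).enabled_nonempty s).some

omit [MeasurableSpace S] [DiscreteMeasurableSpace S] in
lemma lowerChoice_mem_enabled (s : E.states) (c : M.Choice) :
    E.lowerChoice s₀ s c ∈ (E.toMA s₀).enabled s := by
  unfold lowerChoice
  split_ifs with h
  · exact (E.exists_liftChoice_eq s₀ h).choose_spec.1
  · exact Set.Nonempty.some_mem _

omit [MeasurableSpace S] [DiscreteMeasurableSpace S] in
lemma liftChoice_lowerChoice {s : E.states} {c : M.Choice} (h : c ∈ E.acts s) :
    E.liftChoice s₀ (E.lowerChoice s₀ s c) = c := by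
  rw [lowerChoice, dif_pos h]
  exact (E.exists_liftChoice_eq s₀ h).choose_spec.2

/-- The policy for an end component that imitates a policy for the whole automaton. -/
def restrictPolicy (D : M.MAPolicy) : (E.toMA s₀).MAPolicy where
  choose n :=
    { toFun (h : History (E.toMA s₀).Record n) :=
        (D.choose n fun i => E.liftRecord s₀ (h i)).map (E.lowerChoice s₀ h.last.2.2)
      measurable' := by
        have : Measurable (fun p : E.states × History (E.toMA s₀).Record n =>
            (D.choose n fun i => E.liftRecord s₀ (p.2 i)).map (E.lowerChoice s₀ p.1)) := by
          refine measurable_from_prod_countable_right fun s => ?_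
          refine (Measure.measurable_map (E.lowerChoice s₀ s) Measurable.of_discrete).comp
            ((D.choose n).measurable.comp ?_)
          exact measurable_pi_lambda _ fun i =>
            (E.measurable_liftRecord s₀).comp (measurable_pi_apply i)
        exact this.comp (((E.toMA s₀).measurable_recordState.comp
          History.measurable_last).prodMk measurable_id) }
  isMarkov n := ⟨fun h => by
    change IsProbabilityMeasure
      ((D.choose n fun i => E.liftRecord s₀ (h i)).map (E.lowerChoice s₀ h.last.2.2))
    exact Measure.isProbabilityMeasure_map Measurable.of_discrete.aemeasurable⟩
  mem_enabled n h := by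
    change ∀ᵐ c ∂((D.choose n fun i => E.liftRecord s₀ (h i)).map (E.lowerChoice s₀ h.last.2.2)), _
    rw [ae_map_iff Measurable.of_discrete.aemeasurable MeasurableSet.of_discrete]
    exact Eventually.of_forall fun c => E.lowerChoice_mem_enabled s₀ _ c

/-- The pairs of consecutive records that conform to an end component. -/
def steps : Set (M.Record × M.Record) := {q | q.2.1 ∈ E.acts q.1.2.2}

lemma measurableSet_steps : MeasurableSet E.steps := by
  have : Measurable fun q : M.Record × M.Record => (q.1.2.2, q.2.1) := by fun_prop
  exact this (MeasurableSet.of_discrete (s := {q : S × M.Choice | q.2 ∈ E.acts q.1}))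

lemma stepKernel_restrict_le (D : M.MAPolicy) (n : ℕ) (h : History (E.toMA s₀).Record n) :
    (D.stepKernel M.measurable_recordState M.law n (fun i => E.liftRecord s₀ (h i))).restrict
        {x | (E.liftRecord s₀ h.last, x) ∈ E.steps}
      ≤ ((E.restrictPolicy s₀ D).stepKernel (E.toMA s₀).measurable_recordState
          (E.toMA s₀).law n h).map (E.liftRecord s₀) := by
  have hι := E.measurable_liftRecord s₀
  have hK : MeasurableSet {x | (E.liftRecord s₀ h.last, x) ∈ E.steps} :=
    measurable_prodMk_left E.measurableSet_steps
  refine Measure.le_iff.2 fun B hB => ?_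
  rw [Measure.restrict_apply hB, Measure.map_apply hι hB,
    ← lintegral_indicator_one (hB.inter hK), ← lintegral_indicator_one (hι hB),
    Policy.lintegral_stepKernel _ _ _ _ _ (measurable_one.indicator (hB.inter hK)),
    Policy.lintegral_stepKernel _ _ _ _ _ (measurable_one.indicator (hι hB))]
  change _ ≤ ∫⁻ c, _ ∂((D.choose n fun i => E.liftRecord s₀ (h i)).map
    (E.lowerChoice s₀ h.last.2.2))
  rw [lintegral_map Measurable.of_discrete Measurable.of_discrete]
  refine lintegral_mono fun c => ?_
  rw [lintegral_indicator_one (hB.inter hK), lintegral_indicator_one (hι hB)]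
  by_cases hc : c ∈ E.acts h.last.2.2
  · rw [← Measure.map_apply hι hB, E.map_law_toMA s₀ (E.lowerChoice_mem_enabled s₀ _ _),
      E.liftChoice_lowerChoice s₀ hc]
    exact measure_mono Set.inter_subset_left
  · refine (le_of_eq ?_).trans zero_le
    refine measure_mono_null Set.inter_subset_right (measure_eq_zero_iff_ae_notMem.2 ?_)
    filter_upwards [M.ae_law_choice ((E.liftRecord s₀ h.last).2.2, c)] with x hx hx'
    exact hc (hx ▸ hx')

/-- An end component, as an end component of itself. -/
def self : (E.toMA s₀).EndComponent where
  states := Set.univ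
  acts := (E.toMA s₀).enabled
  states_nonempty := ⟨s₀, trivial⟩
  acts_nonempty s _ := (E.toMA s₀).enabled_nonempty s
  acts_enabled _ _ := subset_rfl
  acts_eq_empty s hs := absurd (Set.mem_univ s) hs
  closed _ _ _ _ _ _ := trivial
  connected := by
    have key : ∀ (s : E.states) (t : S),
        Relation.ReflTransGen (fun a b => ∃ c ∈ E.acts a, M.jump a c b ≠ 0) s t →
        ∃ ht : t ∈ E.states, Relation.ReflTransGen
          (fun a b => ∃ c ∈ (E.toMA s₀).enabled a, (E.toMA s₀).jump a c b ≠ 0) s ⟨t, ht⟩ := by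
      intro s t h
      induction h with
      | refl => exact ⟨s.2, Relation.ReflTransGen.refl⟩
      | @tail a b _ hab ih =>
        obtain ⟨ha, ih⟩ := ih
        obtain ⟨c, hc, hab⟩ := hab
        have hb := E.closed a ha c hc b hab
        obtain ⟨c', hc', rfl⟩ := E.exists_liftChoice_eq s₀ (s := ⟨a, ha⟩) hc
        have h2 := E.map_jump_toMA s₀ hc'
        refine ⟨hb, ih.tail ⟨c', hc', ?_⟩⟩
        rwa [← PMF.map_subtype_val_apply, h2]
    intro s _ t _
    exact (key s t (E.connected s s.2 t t.2)).2

/-- The minimal long-run average of an end component is at most the one from each of its states. -/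
lemma infLraMin_le (ℓ : LimitReading) (G : Set S) (s : E.states) :
    E.lraMin ℓ G ≤ (E.toMA s₀).lraMin ℓ s (Subtype.val ⁻¹' G) :=
  (iInf_le _ s₀).trans_eq ((E.toMA s₀).lraMin_eq_of_mem ℓ _ (E.self s₀) trivial trivial)

/-- On paths that always conform to an end component, the long-run average is almost surely at least
the minimal one of the end component. -/
lemma ae_alwaysStep_imp (ℓ : LimitReading) (G : Set S) (D : M.MAPolicy) (x : M.Record)
    (hx : x.2.2 ∈ E.states) :
    ∀ᵐ π ∂(M.prFrom D x), π ∈ alwaysStep E.steps →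
      E.lraMin ℓ G ≤ M.longRunFraction ℓ G π := by
  classical
  set s₀ : E.states := ⟨x.2.2, hx⟩
  set x₀ : (E.toMA s₀).Record := (Choice.bot, 0, s₀)
  let B : Set (ℕ → M.Record) := {π | M.longRunFraction ℓ G π < E.lraMin ℓ G}
  have hB : MeasurableSet B := measurableSet_lt (M.measurable_longRunFraction ℓ G) measurable_const
  have hK := measurableSet_alwaysStep E.measurableSet_steps
  let r : M.Record → M.Record := fun y => if y.2.2 = x.2.2 then x else y
  have hr : Measurable r := Measurable.ite
    (M.measurable_recordState (MeasurableSet.singleton x.2.2)) measurable_const measurable_id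
  have hs : ∀ y, (r y).2.2 = y.2.2 := by
    intro y
    by_cases h : y.2.2 = x.2.2 <;> simp [r, h]
  have hcons : ∀ y π, pathCons (r y) π ∈ B ∩ alwaysStep E.steps
      ↔ pathCons y π ∈ B ∩ alwaysStep E.steps := by
    intro y π
    refine and_congr ?_ (forall_congr' fun n => ?_)
    · change M.longRunFraction ℓ G (pathCons (r y) π) < E.lraMin ℓ G
        ↔ M.longRunFraction ℓ G (pathCons y π) < E.lraMin ℓ G
      rw [longRunFraction_pathCons, longRunFraction_pathCons]
    · cases n with
      | zero =>
        change (π 0).1 ∈ E.acts (r y).2.2 ↔ (π 0).1 ∈ E.acts y.2.2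
        rw [hs]
      | succ n => exact Iff.rfl
  have h1 := D.lintegral_comapFirst M.measurable_recordState M.law r hr hs
    (F := (B ∩ alwaysStep E.steps).indicator 1) (measurable_one.indicator (hB.inter hK))
    (fun y π => by
      by_cases h : pathCons y π ∈ B ∩ alwaysStep E.steps
      · rw [Set.indicator_of_mem h, Set.indicator_of_mem ((hcons y π).2 h)]; rfl
      · rw [Set.indicator_of_notMem h, Set.indicator_of_notMem (fun h' => h ((hcons y π).1 h'))])
    (E.liftRecord s₀ x₀)
  have hrx : r (E.liftRecord s₀ x₀) = x := by simp [r, liftRecord, x₀, s₀]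
  rw [hrx, lintegral_indicator_one (hB.inter hK), lintegral_indicator_one (hB.inter hK)] at h1
  set D' := D.comapFirst r hr hs
  have hι := E.measurable_liftRecord s₀
  have h2 := Follows.restrict_le_map
    (Policy.follows_pathMeasure (E.toMA s₀).measurable_recordState (E.toMA s₀).law
      (E.restrictPolicy s₀ D') x₀)
    (Policy.follows_pathMeasure M.measurable_recordState M.law D' (E.liftRecord s₀ x₀)) hι
    (K := E.steps) E.measurableSet_steps (by
        have h1 := pathLaw_map_zero (D'.stepKernel M.measurable_recordState M.law)
          (E.liftRecord s₀ x₀)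
        have h2 := pathLaw_map_zero ((E.restrictPolicy s₀ D').stepKernel
          (E.toMA s₀).measurable_recordState (E.toMA s₀).law) x₀
        have h3 := congrArg (Measure.map (E.liftRecord s₀)) h2
        rw [Measure.map_map hι (measurable_pi_apply 0), Measure.map_dirac' hι] at h3
        exact (h1.trans h3.symm).le)
    (fun n => Eventually.of_forall fun π =>
      E.stepKernel_restrict_le s₀ D' n (Preorder.frestrictLe (π := fun _ => _) n π))
  have h3 : ∀ᵐ π ∂((E.toMA s₀).prFrom (E.restrictPolicy s₀ D') x₀),
      E.lraMin ℓ G ≤ (E.toMA s₀).longRunFraction ℓ (Subtype.val ⁻¹' G) π := by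
    refine Policy.ae_le_of_forall_le_lintegral _ _ ((E.toMA s₀).measurable_longRunFraction ℓ _)
      ((E.toMA s₀).longRunFraction_le_one ℓ _) ((E.toMA s₀).longRunFraction_pathCons ℓ _) ?_ _ _
    intro D x
    exact (E.infLraMin_le s₀ ℓ G x.2.2).trans ((E.toMA s₀).lraMin_le_lintegral ℓ _ D x)
  have hιp : Measurable (fun (π : ℕ → (E.toMA s₀).Record) n => E.liftRecord s₀ (π n)) :=
    measurable_pi_lambda _ fun n => hι.comp (measurable_pi_apply n)
  have h4 := h2 B
  rw [Measure.restrict_apply hB, Measure.map_apply hιp hB] at h4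
  have h5 : (E.toMA s₀).prFrom (E.restrictPolicy s₀ D') x₀
      ((fun (π : ℕ → (E.toMA s₀).Record) n => E.liftRecord s₀ (π n)) ⁻¹' B) = 0 := by
    refine measure_eq_zero_iff_ae_notMem.2 ?_
    filter_upwards [h3] with π hπ hπ'
    have hπ'' : M.longRunFraction ℓ G (fun n => E.liftRecord s₀ (π n)) < E.lraMin ℓ G := hπ'
    rw [longRunFraction_liftRecord] at hπ''
    exact absurd hπ (not_le.2 hπ'')
  have h6 : M.prFrom D x (B ∩ alwaysStep E.steps) = 0 := by
    rw [prFrom, ← h1]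
    exact le_antisymm (h4.trans h5.le) zero_le
  filter_upwards [measure_eq_zero_iff_ae_notMem.1 h6] with π hπ hπ'
  by_contra hlt
  exact hπ ⟨not_le.1 hlt, hπ'⟩

/-- On paths that eventually stay in an end component, the long-run average is almost surely at
least the minimal one of the end component. -/
theorem ae_eventually_imp (ℓ : LimitReading) (G : Set S) (D : M.MAPolicy) (x : M.Record) :
    ∀ᵐ π ∂(M.prFrom D x),
      (∀ᶠ n in atTop, M.stateAt π n ∈ E.states ∧ (π (n + 1)).1 ∈ E.acts (M.stateAt π n)) →
      E.lraMin ℓ G ≤ M.longRunFraction ℓ G π := by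
  let B : ℕ → Set (ℕ → M.Record) := fun m => {π | M.longRunFraction ℓ G π < E.lraMin ℓ G ∧
    (π m).2.2 ∈ E.states ∧ ∀ n, (π (m + n), π (m + n + 1)) ∈ E.steps}
  have hBm : ∀ m, MeasurableSet (B m) := by
    intro m
    refine (measurableSet_lt (M.measurable_longRunFraction ℓ G) measurable_const).inter
      (MeasurableSet.inter ?_
        (?_ : MeasurableSet {π : ℕ → M.Record | ∀ n, (π (m + n), π (m + n + 1)) ∈ E.steps}))
    · exact (M.measurable_recordState.comp (measurable_pi_apply m))
        (MeasurableSet.of_discrete (s := E.states))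
    · rw [Set.ofPred_forall]
      exact MeasurableSet.iInter fun n =>
        ((measurable_pi_apply _).prodMk (measurable_pi_apply _)) E.measurableSet_steps
  have key : ∀ m (D : M.MAPolicy) x, M.prFrom D x (B m) = 0 := by
    intro m
    induction m with
    | zero =>
      intro D x
      refine measure_eq_zero_iff_ae_notMem.2 ?_
      by_cases hx : x.2.2 ∈ E.states
      · filter_upwards [E.ae_alwaysStep_imp ℓ G D x hx] with π hπ hB
        refine absurd (hπ fun n => ?_) (not_le.2 hB.1)
        simpa using hB.2.2 n
      · have := ae_pathLaw_zero (D.stepKernel M.measurable_recordState M.law) (x₀ := x)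
          (p := fun y => y.2.2 ∉ E.states)
          (M.measurable_recordState (MeasurableSet.of_discrete (s := E.statesᶜ))) hx
        filter_upwards [this] with π hπ hB
        exact hπ hB.2.1
    | succ m ih =>
      intro D x
      rw [← lintegral_indicator_one (hBm (m + 1)), prFrom,
        Policy.lintegral_pathMeasure _ _ _ _ (measurable_one.indicator (hBm (m + 1)))]
      refine lintegral_eq_zero_of_ae_eq_zero (Eventually.of_forall fun y => ?_)
      have e : ∀ π, ((B (m + 1)).indicator 1 (pathCons x π) : ℝ≥0∞) = (B m).indicator 1 π := by
        intro π
        have : pathCons x π ∈ B (m + 1) ↔ π ∈ B m := by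
          simp only [B, Set.mem_ofPred_eq, longRunFraction_pathCons, pathCons_succ,
            Nat.add_right_comm m 1]
        by_cases h : π ∈ B m
        · rw [Set.indicator_of_mem h, Set.indicator_of_mem (this.2 h)]; rfl
        · rw [Set.indicator_of_notMem h, Set.indicator_of_notMem (fun h' => h (this.1 h'))]
      simp_rw [e]
      rw [lintegral_indicator_one (hBm m)]
      exact ih _ y
  have : ∀ᵐ π ∂(M.prFrom D x), ∀ m, π ∉ B m :=
    ae_all_iff.2 fun m => measure_eq_zero_iff_ae_notMem.1 (key m D x)
  filter_upwards [this] with π hπ hev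
  obtain ⟨N, hN⟩ := eventually_atTop.1 hev
  by_contra hlt
  exact hπ N ⟨not_le.1 hlt, (hN N le_rfl).1, fun n => (hN (N + n) (Nat.le_add_right _ _)).2⟩

end EndComponent

end MarkovAutomaton

/-- A bounded function of the state that does not decrease in expectation by any choice is at most
the expectation of its upper limit along a path. -/
lemma Policy.le_lintegral_limsup {X C S : Type*} [MeasurableSpace X] [MeasurableSpace C]
    [MeasurableSpace S] {state : X → S} {enabled : S → Set C} (hstate : Measurable state)
    (law : Kernel (S × C) X) [IsMarkovKernel law] (D : Policy state enabled) (x₀ : X)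
    {φ : S → ℝ≥0∞} (hφ : Measurable φ) (hφ1 : ∀ s, φ s ≤ 1)
    (H : ∀ s, ∀ c ∈ enabled s, φ s ≤ ∫⁻ x, φ (state x) ∂(law (s, c))) :
    φ (state x₀) ≤ ∫⁻ π, limsup (fun n => φ (state (π n))) atTop
      ∂(D.pathMeasure hstate law x₀) := by
  have h1 : φ (state x₀)
      ≤ limsup (fun n => ∫⁻ π, φ (state (π n)) ∂(D.pathMeasure hstate law x₀)) atTop :=
    le_limsup_of_frequently_le (Eventually.frequently (Eventually.of_forall fun n =>
      D.le_lintegral_of_subharmonic hstate law x₀ hφ H n))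
  refine h1.trans (limsup_lintegral_le (g := fun _ => 1)
    (fun n => hφ.comp (hstate.comp (measurable_pi_apply n)))
    (fun n => Eventually.of_forall fun π => hφ1 _) (by simp))

namespace SSP
open PathLaw

variable {X C : Type*} [Countable X] [MeasurableSpace X] [DiscreteMeasurableSpace X]
  [Countable C] [MeasurableSpace C] [DiscreteMeasurableSpace C] (N : SSP X C)

section law

lemma law_apply (p : X × C) :
    N.law p = (Measure.dirac p.2).prod (N.trans p.1 p.2).toMeasure := rfl

lemma ae_law_choice (p : X × C) : ∀ᵐ r ∂(N.law p), r.1 = p.2 := by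
  have h : ∀ᵐ c ∂((N.law p).map Prod.fst), c = p.2 := by
    rw [law_apply, Measure.map_fst_prod, measure_univ, one_smul]
    exact (ae_dirac_iff (MeasurableSet.of_discrete (s := {c | c = p.2}))).2 rfl
  exact ae_of_ae_map measurable_fst.aemeasurable h

lemma map_snd_law (p : X × C) : (N.law p).map Prod.snd = (N.trans p.1 p.2).toMeasure := by
  rw [law_apply, Measure.map_snd_prod, measure_univ, one_smul]

lemma ae_law_trans (p : X × C) : ∀ᵐ r ∂(N.law p), N.trans p.1 p.2 r.2 ≠ 0 := by
  have h : ∀ᵐ y ∂((N.law p).map Prod.snd), N.trans p.1 p.2 y ≠ 0 := by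
    rw [map_snd_law, ae_iff, PMF.toMeasure_apply_eq_zero_iff _ MeasurableSet.of_discrete,
      Set.disjoint_left]
    exact fun y hy hy' => hy' ((PMF.mem_support_iff _ _).1 hy)
  exact ae_of_ae_map measurable_snd.aemeasurable h

lemma lintegral_law (p : X × C) (φ : X → ℝ≥0∞) :
    ∫⁻ r, φ r.2 ∂(N.law p) = ∑' y, N.trans p.1 p.2 y * φ y := by
  rw [← lintegral_map (f := φ) (g := fun r : C × X => r.2) (measurable_of_countable φ)
    measurable_snd, map_snd_law, lintegral_countable']
  refine tsum_congr fun y => ?_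
  rw [PMF.toMeasure_apply_singleton _ _ (MeasurableSet.singleton y), mul_comm]

lemma law_state (p : X × C) (y : X) : N.law p {r | r.2 = y} = N.trans p.1 p.2 y := by
  have : (N.law p).map Prod.snd {y} = N.trans p.1 p.2 y := by
    rw [map_snd_law, PMF.toMeasure_apply_singleton _ _ (MeasurableSet.singleton y)]
  rw [← this, Measure.map_apply measurable_snd (MeasurableSet.singleton y)]
  rfl

lemma ae_step (D : N.MDPPolicy) (r : C × X) :
    ∀ᵐ ρ ∂(D.pathMeasure measurable_snd N.law r), ∀ n, (ρ (n + 1)).1 ∈ N.enabled (ρ n).2 ∧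
      N.trans (ρ n).2 (ρ (n + 1)).1 (ρ (n + 1)).2 ≠ 0 := by
  let K : Set ((C × X) × (C × X)) :=
    {q | q.2.1 ∈ N.enabled q.1.2 ∧ N.trans q.1.2 q.2.1 q.2.2 ≠ 0}
  have hK : MeasurableSet K := MeasurableSet.of_discrete
  refine D.ae_alwaysStep measurable_snd N.law r hK fun n h => ?_
  filter_upwards [D.mem_enabled n h] with c hc
  filter_upwards [N.ae_law_choice (h.last.2, c), N.ae_law_trans (h.last.2, c)] with y h1 h2
  exact ⟨by rw [h1]; exact hc, by rw [h1]; exact h2⟩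

end law

section pathCost

variable {N}

omit [Countable X] [MeasurableSpace X] [DiscreteMeasurableSpace X]
  [Countable C] [MeasurableSpace C] [DiscreteMeasurableSpace C]

lemma pathCost_of_first (h0 : ∀ x c, N.cost x c = 0) {ρ : ℕ → C × X} {k : ℕ}
    (hk : (ρ k).2 ∈ N.goal) (hlt : ∀ j < k, (ρ j).2 ∉ N.goal) :
    N.pathCost ρ = N.terminal (ρ k).2 := by
  classical
  have h : ∃ k, (ρ k).2 ∈ N.goal := ⟨k, hk⟩
  have hf : Nat.find h = k := (Nat.find_eq_iff h).2 ⟨hk, hlt⟩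
  unfold pathCost
  rw [dif_pos h]
  simp only [h0, Finset.sum_const_zero, zero_add]
  convert! rfl
  exact hf.symm

lemma pathCost_of_forall_notMem {ρ : ℕ → C × X} (h : ∀ k, (ρ k).2 ∉ N.goal) :
    N.pathCost ρ = ∞ := by
  rw [pathCost, dif_neg (not_exists.2 h)]

lemma exists_first {ρ : ℕ → C × X} (h : ∃ k, (ρ k).2 ∈ N.goal) :
    ∃ k, (ρ k).2 ∈ N.goal ∧ ∀ j < k, (ρ j).2 ∉ N.goal := by
  classical
  exact ⟨Nat.find h, Nat.find_spec h, fun j hj => Nat.find_min h hj⟩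

lemma pathCost_congr (h0 : ∀ x c, N.cost x c = 0) {ρ ρ' : ℕ → C × X}
    (h : ∀ n, (ρ n).2 = (ρ' n).2) : N.pathCost ρ = N.pathCost ρ' := by
  by_cases hg : ∃ k, (ρ k).2 ∈ N.goal
  · obtain ⟨k, hk, hlt⟩ := exists_first hg
    rw [pathCost_of_first h0 hk hlt, h k]
    exact (pathCost_of_first h0 (h k ▸ hk) fun j hj => h j ▸ hlt j hj).symm
  · push Not at hg
    rw [pathCost_of_forall_notMem hg, pathCost_of_forall_notMem fun k => h k ▸ hg k]

lemma pathCost_pathCons (h0 : ∀ x c, N.cost x c = 0) {r : C × X} (hr : r.2 ∉ N.goal)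
    (ρ : ℕ → C × X) : N.pathCost (pathCons r ρ) = N.pathCost ρ := by
  by_cases hg : ∃ k, (ρ k).2 ∈ N.goal
  · obtain ⟨k, hk, hlt⟩ := exists_first hg
    rw [pathCost_of_first h0 hk hlt]
    refine pathCost_of_first (ρ := pathCons r ρ) (k := k + 1) h0 hk fun j hj => ?_
    cases j with
    | zero => exact hr
    | succ j => exact hlt j (by omega)
  · push Not at hg
    rw [pathCost_of_forall_notMem hg]
    refine pathCost_of_forall_notMem fun k => ?_
    cases k with
    | zero => exact hr
    | succ k => exact hg k

lemma pathCost_eq_iInf (h0 : ∀ x c, N.cost x c = 0) (ρ : ℕ → C × X) :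
    N.pathCost ρ = ⨅ k, ⨅ _ : (ρ k).2 ∈ N.goal ∧ ∀ j < k, (ρ j).2 ∉ N.goal,
      N.terminal (ρ k).2 := by
  by_cases hg : ∃ k, (ρ k).2 ∈ N.goal
  · obtain ⟨k, hk, hlt⟩ := exists_first hg
    refine le_antisymm (le_iInf₂ fun k h => ?_) (iInf₂_le_of_le k ⟨hk, hlt⟩ ?_)
    · rw [pathCost_of_first h0 h.1 h.2]
    · rw [pathCost_of_first h0 hk hlt]
  · push Not at hg
    rw [pathCost_of_forall_notMem hg, eq_comm, iInf_eq_top]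
    exact fun k => iInf_eq_top.2 fun h => absurd h.1 (hg k)

end pathCost

variable {N}

omit [Countable C] [DiscreteMeasurableSpace C] in
lemma measurable_pathCost (h0 : ∀ x c, N.cost x c = 0) : Measurable N.pathCost := by
  classical
  have : N.pathCost = fun ρ => ⨅ k, if (ρ k).2 ∈ N.goal ∧ ∀ j < k, (ρ j).2 ∉ N.goal then
      N.terminal (ρ k).2 else ∞ := by
    funext ρ
    rw [pathCost_eq_iInf h0]
    refine iInf_congr fun k => ?_
    by_cases h : (ρ k).2 ∈ N.goal ∧ ∀ j < k, (ρ j).2 ∉ N.goal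
    · rw [if_pos h, iInf_pos h]
    · rw [if_neg h, iInf_neg h]
  rw [this]
  have hs : ∀ (k : ℕ) (B : Set X), MeasurableSet {ρ : ℕ → C × X | (ρ k).2 ∈ B} := fun k B =>
    (measurable_snd.comp (measurable_pi_apply k)) (MeasurableSet.of_discrete (s := B))
  refine Measurable.iInf fun k => Measurable.ite ?_ ?_ measurable_const
  · refine (hs k N.goal).inter
      (?_ : MeasurableSet {ρ : ℕ → C × X | ∀ j < k, (ρ j).2 ∉ N.goal})
    have : {ρ : ℕ → C × X | ∀ j < k, (ρ j).2 ∉ N.goal}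
        = ⋂ j, ⋂ _ : j < k, {ρ | (ρ j).2 ∈ N.goalᶜ} := by
      ext; simp
    rw [this]
    exact MeasurableSet.iInter fun j => MeasurableSet.iInter fun _ => hs j _
  · exact (measurable_of_countable N.terminal).comp
      (measurable_snd.comp (measurable_pi_apply k))

/-- The minimal cost does not decrease in expectation by any choice outside the goal. -/
theorem minCost_le_tsum (h0 : ∀ x c, N.cost x c = 0) {x : X} (hx : x ∉ N.goal) {c : C}
    (hc : c ∈ N.enabled x) : N.minCost x ≤ ∑' y, N.trans x c y * N.minCost y := by
  have := Policy.iInf_lintegral_subharmonic measurable_snd N.law N.enabled_nonempty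
    (dummy := fun x => ((N.enabled_nonempty x).some, x)) (measurable_of_countable _)
    (fun _ => rfl) (measurable_pathCost h0)
    (fun r π => pathCost_congr h0 fun n => by cases n <;> rfl)
    (s := x) (fun π => pathCost_pathCons h0 hx π) hc
  exact this.trans_eq (N.lintegral_law (x, c) N.minCost)

lemma minCost_le_terminal (h0 : ∀ x c, N.cost x c = 0) {x : X} (hx : x ∈ N.goal) :
    N.minCost x ≤ N.terminal x := by
  let D : N.MDPPolicy := Policy.stationary measurable_snd
    (c := fun x => (N.enabled_nonempty x).some) (measurable_of_countable _)
    (fun x => (N.enabled_nonempty x).some_mem)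
  refine (iInf_le _ D).trans ?_
  have h : ∀ᵐ ρ ∂(N.pr D x), (ρ 0).2 = x :=
    ae_pathLaw_zero _ (p := fun r : C × X => r.2 = x)
      (measurable_snd (MeasurableSet.of_discrete (s := {x}))) rfl
  have : IsProbabilityMeasure (N.pr D x) :=
    inferInstanceAs (IsProbabilityMeasure (D.pathMeasure measurable_snd N.law _))
  calc ∫⁻ ρ, N.pathCost ρ ∂(N.pr D x) = ∫⁻ _, N.terminal x ∂(N.pr D x) := by
        refine lintegral_congr_ae ?_
        filter_upwards [h] with ρ hρ
        rw [pathCost_of_first (k := 0) h0 (hρ ▸ hx) (by simp), hρ]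
    _ ≤ _ := by simp

/-- A bounded function that does not decrease in expectation by any choice is at most the minimal
cost, if it is at most the terminal cost and goal states are absorbing. -/
theorem le_minCost (h0 : ∀ x c, N.cost x c = 0)
    (habs : ∀ x ∈ N.goal, ∀ c ∈ N.enabled x, ∀ y, N.trans x c y ≠ 0 → y = x)
    {φ : X → ℝ≥0∞} (hφ1 : ∀ x, φ x ≤ 1) (hterm : ∀ x ∈ N.goal, φ x ≤ N.terminal x)
    (hsub : ∀ x, ∀ c ∈ N.enabled x, φ x ≤ ∑' y, N.trans x c y * φ y) (x : X) :
    φ x ≤ N.minCost x := by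
  refine le_iInf fun D => ?_
  refine (D.le_lintegral_limsup measurable_snd N.law ((N.enabled_nonempty x).some, x)
    (measurable_of_countable φ) hφ1
    (fun x c hc => (hsub x c hc).trans_eq (N.lintegral_law (x, c) φ).symm)).trans ?_
  refine lintegral_mono_ae ?_
  filter_upwards [N.ae_step D ((N.enabled_nonempty x).some, x)] with ρ hρ
  by_cases hg : ∃ k, (ρ k).2 ∈ N.goal
  · obtain ⟨k, hk, hlt⟩ := exists_first hg
    rw [pathCost_of_first h0 hk hlt]
    have hstay : ∀ n, (ρ (k + n)).2 = (ρ k).2 := by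
      intro n
      induction n with
      | zero => rfl
      | succ n ih =>
        have := hρ (k + n)
        rw [ih] at this
        exact habs _ hk _ this.1 _ this.2
    refine limsup_le_of_le (by isBoundedDefault) (eventually_atTop.2 ⟨k, fun n hn => ?_⟩)
    obtain ⟨m, rfl⟩ := Nat.exists_eq_add_of_le hn
    rw [hstay m]
    exact hterm _ hk
  · push Not at hg
    rw [pathCost_of_forall_notMem hg]
    exact le_top

/-- The minimal cost is bounded by the terminal cost, if no nonempty set of states outside the goal
is closed under all choices. -/
theorem minCost_le_one [Finite X] (h0 : ∀ x c, N.cost x c = 0) (hterm : ∀ x, N.terminal x ≤ 1)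
    (hclosed : ∀ B : Set X, Disjoint B N.goal →
      (∀ x ∈ B, ∀ c ∈ N.enabled x, ∀ y, N.trans x c y ≠ 0 → y ∈ B) → B = ∅) (x : X) :
    N.minCost x ≤ 1 := by
  classical
  let reach : ℕ → Set X := fun n => Nat.rec (motive := fun _ => Set X) N.goal (fun _ R =>
    {x | ∃ c ∈ N.enabled x, ∃ y ∈ R, N.trans x c y ≠ 0}) n
  have hreach : ∀ x, ∃ n, x ∈ reach n := by
    have : (⋃ n, reach n)ᶜ = ∅ := by
      refine hclosed _ (Set.disjoint_left.2 fun x hx hg => hx (Set.mem_iUnion.2 ⟨0, hg⟩)) ?_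
      intro x hx c hc y hy hy'
      obtain ⟨n, hn⟩ := Set.mem_iUnion.1 hy'
      exact hx (Set.mem_iUnion.2 ⟨n + 1, c, hc, y, hn, hy⟩)
    intro x
    rw [Set.compl_empty_iff] at this
    exact Set.mem_iUnion.1 (this ▸ Set.mem_univ x)
  let rank : X → ℕ := fun x => Nat.find (hreach x)
  have hrank : ∀ x, ∃ c ∈ N.enabled x, x ∉ N.goal → ∃ y, N.trans x c y ≠ 0 ∧ rank y < rank x := by
    intro x
    by_cases hx : x ∈ N.goal
    · exact ⟨_, (N.enabled_nonempty x).some_mem, fun h => absurd hx h⟩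
    · have h1 : x ∈ reach (rank x) := Nat.find_spec (hreach x)
      rcases hr : rank x with _ | n
      · rw [hr] at h1
        exact absurd h1 hx
      · rw [hr] at h1
        obtain ⟨c, hc, y, hy, hxy⟩ := h1
        exact ⟨c, hc, fun _ => ⟨y, hxy, Nat.lt_succ_of_le
          (Nat.find_min' (p := fun n => y ∈ reach n) (hreach y) hy)⟩⟩
  choose c hc hy using hrank
  let D : N.MDPPolicy :=
    Policy.stationary measurable_snd (c := c) (measurable_of_countable _) hc
  let r : C × X := ((N.enabled_nonempty x).some, x)
  have h1 : ∀ᵐ ρ ∂(N.pr D x), ∀ n, (ρ (n + 1)).1 = c (ρ n).2 := by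
    refine D.ae_alwaysStep measurable_snd N.law r
      (K := {q : (C × X) × (C × X) | q.2.1 = c q.1.2}) MeasurableSet.of_discrete fun n h => ?_
    have : ∀ᵐ c' ∂(D.choose n h), c' = c h.last.2 :=
      (ae_dirac_iff (MeasurableSet.of_discrete (s := {c' | c' = c h.last.2}))).2 rfl
    filter_upwards [this] with c' hc'
    filter_upwards [N.ae_law_choice (h.last.2, c')] with y hy
    exact hy.trans hc'
  have h2 : ∀ᵐ ρ ∂(N.pr D x), ∀ x y, N.trans x (c x) y ≠ 0 →
      (∃ᶠ n in atTop, (ρ n).2 = x ∧ (ρ (n + 1)).1 = c x) →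
      ∃ᶠ n in atTop, ((ρ n).2 = x ∧ (ρ (n + 1)).1 = c x) ∧ (ρ (n + 1)).2 = y := by
    refine ae_all_iff.2 fun x => ae_all_iff.2 fun y => ?_
    by_cases hxy : N.trans x (c x) y = 0
    · exact Eventually.of_forall fun π h => absurd hxy h
    have := D.ae_frequently_of_frequently measurable_snd N.law r
      (choice := Prod.fst) measurable_fst N.ae_law_choice x (c x) (B := {r | r.2 = y})
      (measurable_snd (MeasurableSet.singleton y)) (by rw [law_state]; exact hxy)
    filter_upwards [this] with π hπ _
    exact hπ
  have : IsProbabilityMeasure (N.pr D x) :=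
    inferInstanceAs (IsProbabilityMeasure (D.pathMeasure measurable_snd N.law r))
  calc N.minCost x ≤ ∫⁻ ρ, N.pathCost ρ ∂(N.pr D x) := iInf_le _ D
    _ ≤ ∫⁻ _, 1 ∂(N.pr D x) := by
        refine lintegral_mono_ae ?_
        filter_upwards [h1, h2] with ρ h1 h2
        obtain ⟨z, hz⟩ := MarkovAutomaton.exists_frequently_eq (fun n => (ρ n).2)
          (p := fun _ => True) (Eventually.frequently (by simp))
        obtain ⟨m, hm, hmin⟩ := Set.exists_min_image {z | ∃ᶠ n in atTop, (ρ n).2 = z} rank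
          (Set.toFinite _) ⟨z, hz.mono fun n hn => hn.2⟩
        have hg : m ∈ N.goal := by
          by_contra hg
          obtain ⟨y, hy1, hy2⟩ := hy m hg
          have h3 : ∃ᶠ n in atTop, (ρ n).2 = m := hm
          have h4 := (h2 m y hy1 (h3.mono fun n hn => ⟨hn, by rw [h1, hn]⟩)).mono
            fun n hn => hn.2
          exact absurd (hmin y ((tendsto_add_atTop_nat 1).frequently h4)) (not_le.2 hy2)
        have h3 : ∃ᶠ n in atTop, (ρ n).2 = m := hm
        obtain ⟨n, hn⟩ := h3.exists
        obtain ⟨k, hk, hlt⟩ := exists_first (N := N) (ρ := ρ) ⟨n, hn ▸ hg⟩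
        rw [pathCost_of_first h0 hk hlt]
        exact hterm _
    _ = 1 := by simp

end SSP

lemma PMF.tsum_map_mul {α β : Type*} (p : PMF α) (f : α → β) (g : β → ℝ≥0∞) :
    ∑' y, p.map f y * g y = ∑' a, p a * g (f a) := by
  classical
  simp_rw [PMF.map_apply, ← ENNReal.tsum_mul_right]
  rw [ENNReal.tsum_comm]
  refine tsum_congr fun a => ?_
  rw [tsum_eq_single (f a) fun y hy => by rw [if_neg hy, zero_mul], if_pos rfl]

lemma PMF.tsum_pure_mul {α : Type*} (a : α) (g : α → ℝ≥0∞) :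
    ∑' y, PMF.pure a y * g y = g a := by
  rw [tsum_eq_single a fun y hy => by rw [PMF.pure_apply_of_ne _ _ hy, zero_mul],
    PMF.pure_apply_self, one_mul]

namespace MarkovAutomaton
open PathLaw

variable {S A : Type*} [Finite S] [MeasurableSpace S] [DiscreteMeasurableSpace S]
  (M : MarkovAutomaton S A) (ℓ : LimitReading) (G : Set S)

omit [MeasurableSpace S] [DiscreteMeasurableSpace S] in
lemma collapse_of_forall_notMem {s : S} (h : ∀ E : M.MEC, s ∉ E.1.states) :
    M.collapse s = .old s h := by
  rw [collapse, dif_neg (not_exists.2 h)]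

omit [MeasurableSpace S] [DiscreteMeasurableSpace S] in
/-- The only choice of a Markovian state of an end component does not leave the component. -/
lemma EndComponent.mem_states_of_bot {M : MarkovAutomaton S A} (E : M.EndComponent) {s s' : S}
    (hs : s ∈ E.states) (hM : M.IsMarkovian s) (h : M.jump s Choice.bot s' ≠ 0) :
    s' ∈ E.states := by
  obtain ⟨c, hc⟩ := E.acts_nonempty s hs
  rcases E.acts_enabled s hs hc with ⟨x, rfl, hx⟩ | ⟨rfl, _⟩
  · exact absurd ⟨x.1, x.2, hx⟩ hM
  · exact E.closed s hs _ hc s' h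

lemma sspLRA_cost (x : M.SSPState) (c : M.Choice) : (M.sspLRA ℓ G).cost x c = 0 := rfl

lemma EndComponent.infLraMin_le_one {M : MarkovAutomaton S A} (E : M.EndComponent) :
    E.lraMin ℓ G ≤ 1 := by
  obtain ⟨s, hs⟩ := E.states_nonempty
  exact (E.infLraMin_le ⟨s, hs⟩ ℓ G ⟨s, hs⟩).trans (lraMin_le_one _ ℓ _ _)

lemma sspLRA_terminal_le_one (x : M.SSPState) : (M.sspLRA ℓ G).terminal x ≤ 1 := by
  cases x with
  | old s h => exact zero_le
  | u E => exact zero_le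
  | q E => exact E.1.infLraMin_le_one ℓ G

/-- No nonempty set of states outside the goal is closed under all choices. -/
lemma eq_empty_of_closed {B : Set M.SSPState} (hB : Disjoint B (Set.range .q))
    (hclosed : ∀ x ∈ B, ∀ c ∈ M.sspEnabled x, ∀ y, M.sspTrans x c y ≠ 0 → y ∈ B) : B = ∅ := by
  have hu : ∀ E : M.MEC, .u E ∉ B := fun E hE =>
    Set.disjoint_left.1 hB (hclosed _ hE Choice.bot (Or.inl rfl) (.q E) (by
      change PMF.pure (SSPState.q E) (.q E) ≠ 0
      rw [PMF.pure_apply_self]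
      exact one_ne_zero)) ⟨E, rfl⟩
  have hstep : ∀ s, M.collapse s ∈ B → ∀ c ∈ M.enabled s, ∀ s', M.jump s c s' ≠ 0 →
      M.collapse s' ∈ B := by
    intro s hs c hc s' hs'
    by_cases h : ∃ E : M.MEC, s ∈ E.1.states
    · obtain ⟨E, hE⟩ := h
      rw [M.collapse_of_mem E hE] at hs
      exact absurd hs (hu E)
    · push Not at h
      rw [M.collapse_of_forall_notMem h] at hs
      refine hclosed _ hs c hc _ ?_
      change (M.jump s c).map M.collapse (M.collapse s') ≠ 0
      rw [← PMF.mem_support_iff, PMF.mem_support_map_iff]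
      exact ⟨s', (PMF.mem_support_iff _ _).2 hs', rfl⟩
  have hold : ∀ s, M.collapse s ∉ B := by
    intro s hs
    have h0 : ∀ᵐ π ∂(M.prFrom M.defaultPolicy (Choice.bot, 0, s)), (π 0).2.2 = s :=
      ae_pathLaw_zero _ (p := fun x : M.Record => x.2.2 = s)
        (M.measurable_recordState (MeasurableSet.of_discrete (s := {s}))) rfl
    obtain ⟨π, h0, h1, E, hE⟩ := (h0.and ((M.ae_step M.defaultPolicy _).and
      (M.ae_eventually_mem_mec M.defaultPolicy _))).exists
    have h2 : ∀ n, M.collapse (M.stateAt π n) ∈ B := by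
      intro n
      induction n with
      | zero => rw [stateAt, h0]; exact hs
      | succ n ih => exact hstep _ ih _ (h1 n).1 _ (h1 n).2
    obtain ⟨n, hn⟩ := hE.exists
    have := h2 n
    rw [M.collapse_of_mem E hn.1] at this
    exact hu E this
  refine Set.eq_empty_of_forall_notMem fun x hx => ?_
  cases x with
  | old s h => exact hold s (by rwa [M.collapse_of_forall_notMem h])
  | u E => exact hu E hx
  | q E => exact Set.disjoint_left.1 hB hx ⟨E, rfl⟩

lemma minCost_sspLRA_le_one (x : M.SSPState) : (M.sspLRA ℓ G).minCost x ≤ 1 :=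
  SSP.minCost_le_one (M.sspLRA_cost ℓ G) (M.sspLRA_terminal_le_one ℓ G)
    (fun _ hB hclosed => M.eq_empty_of_closed hB hclosed) x

lemma minCost_u_le (E : M.MEC) : (M.sspLRA ℓ G).minCost (.u E) ≤ E.1.lraMin ℓ G := by
  refine (SSP.minCost_le_tsum (M.sspLRA_cost ℓ G) (x := .u E) (c := Choice.bot) ?_
    (Or.inl rfl)).trans ?_
  · rintro ⟨F, hF⟩
    cases hF
  · refine (PMF.tsum_pure_mul (SSPState.q E) _).trans_le ?_
    exact SSP.minCost_le_terminal (M.sspLRA_cost ℓ G) ⟨E, rfl⟩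

/-- The minimal cost does not decrease in expectation by any choice of the automaton. -/
lemma minCost_collapse_le_tsum {s : S} {c : M.Choice} (hc : c ∈ M.enabled s) :
    (M.sspLRA ℓ G).minCost (M.collapse s)
      ≤ ∑' s', M.jump s c s' * (M.sspLRA ℓ G).minCost (M.collapse s') := by
  by_cases h : ∃ E : M.MEC, s ∈ E.1.states
  · obtain ⟨E, hE⟩ := h
    rw [M.collapse_of_mem E hE]
    by_cases hstay : ∀ s', M.jump s c s' ≠ 0 → s' ∈ E.1.states
    · have : ∀ s', M.jump s c s' * (M.sspLRA ℓ G).minCost (M.collapse s')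
          = M.jump s c s' * (M.sspLRA ℓ G).minCost (.u E) := by
        intro s'
        by_cases hs' : M.jump s c s' = 0
        · simp [hs']
        · rw [M.collapse_of_mem E (hstay s' hs')]
      simp_rw [this]
      rw [ENNReal.tsum_mul_right, PMF.tsum_coe, one_mul]
    · push Not at hstay
      obtain ⟨s', hs', hsE⟩ := hstay
      rcases hc with ⟨x, rfl, hx⟩ | ⟨rfl, hM⟩
      · refine (SSP.minCost_le_tsum (M.sspLRA_cost ℓ G) (x := .u E) (c := Choice.act x) ?_
          (Or.inr ⟨x, rfl, hx ▸ hE, s', hsE, hs'⟩)).trans_eq ?_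
        · rintro ⟨F, hF⟩
          cases hF
        · exact PMF.tsum_map_mul x.1.2.2 M.collapse _
      · exact absurd (E.1.mem_states_of_bot hE hM hs') hsE
  · push Not at h
    rw [M.collapse_of_forall_notMem h]
    refine (SSP.minCost_le_tsum (M.sspLRA_cost ℓ G) (x := .old s h) (c := c) ?_ hc).trans_eq ?_
    · rintro ⟨F, hF⟩
      cases hF
    · exact PMF.tsum_map_mul (M.jump s c) M.collapse _

/-- The minimal cost of the SSP is at most the minimal long-run average. -/
theorem minCost_collapse_le_lraMin (s : S) :
    (M.sspLRA ℓ G).minCost (M.collapse s) ≤ M.lraMin ℓ s G := by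
  refine le_iInf fun D => ?_
  refine (D.le_lintegral_limsup M.measurable_recordState M.law (Choice.bot, 0, s)
    (φ := fun s => (M.sspLRA ℓ G).minCost (M.collapse s)) (measurable_of_countable _)
    (fun s => M.minCost_sspLRA_le_one ℓ G _)
    (fun s c hc => (M.minCost_collapse_le_tsum ℓ G hc).trans_eq
      (M.lintegral_law (s, c) fun s => (M.sspLRA ℓ G).minCost (M.collapse s)).symm)).trans ?_
  refine lintegral_mono_ae ?_
  have h : ∀ᵐ π ∂(M.prFrom D (Choice.bot, 0, s)), ∀ E : M.MEC,
      (∀ᶠ n in atTop, M.stateAt π n ∈ E.1.states ∧ (π (n + 1)).1 ∈ E.1.acts (M.stateAt π n)) →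
      E.1.lraMin ℓ G ≤ M.longRunFraction ℓ G π :=
    ae_all_iff.2 fun E => E.1.ae_eventually_imp ℓ G D _
  filter_upwards [h, M.ae_eventually_mem_mec D (Choice.bot, 0, s)] with π hπ hE
  obtain ⟨E, hE⟩ := hE
  refine (limsup_le_of_le (by isBoundedDefault) ?_).trans (hπ E hE)
  filter_upwards [hE] with n hn
  change (M.sspLRA ℓ G).minCost (M.collapse (M.stateAt π n)) ≤ _
  rw [M.collapse_of_mem E hn.1]
  exact M.minCost_u_le ℓ G E

/-- The minimal long-run averages, as a function on the states of the SSP. -/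
def sspValue : M.SSPState → ℝ≥0∞
  | .old s _ => M.lraMin ℓ s G
  | .u E => M.lraMin ℓ E.1.states_nonempty.some G
  | .q E => E.1.lraMin ℓ G

lemma sspValue_u (E : M.MEC) {s : S} (hs : s ∈ E.1.states) :
    M.sspValue ℓ G (.u E) = M.lraMin ℓ s G :=
  M.lraMin_eq_of_mem ℓ G E.1 E.1.states_nonempty.some_mem hs

lemma sspValue_collapse (s : S) : M.sspValue ℓ G (M.collapse s) = M.lraMin ℓ s G := by
  by_cases h : ∃ E : M.MEC, s ∈ E.1.states
  · obtain ⟨E, hE⟩ := h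
    rw [M.collapse_of_mem E hE, M.sspValue_u ℓ G E hE]
  · push Not at h
    rw [M.collapse_of_forall_notMem h]
    rfl

lemma sspValue_le_one (x : M.SSPState) : M.sspValue ℓ G x ≤ 1 := by
  cases x with
  | old s h => exact M.lraMin_le_one ℓ s G
  | u E => exact M.lraMin_le_one ℓ _ G
  | q E => exact E.1.infLraMin_le_one ℓ G

lemma sspValue_le_tsum (x : M.SSPState) {c : M.Choice} (hc : c ∈ M.sspEnabled x) :
    M.sspValue ℓ G x ≤ ∑' y, M.sspTrans x c y * M.sspValue ℓ G y := by
  cases x with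
  | old s h =>
    refine (M.lraMin_le_tsum ℓ G (s := s) (c := c) hc).trans_eq ?_
    refine ((PMF.tsum_map_mul (M.jump s c) M.collapse _).trans ?_).symm
    simp_rw [sspValue_collapse]
  | u E =>
    rcases hc with rfl | ⟨x, rfl, hx, -⟩
    · refine le_of_le_of_eq ?_ (PMF.tsum_pure_mul (SSPState.q E) _).symm
      refine le_iInf fun s => ?_
      rw [M.sspValue_u ℓ G E s.2]
      exact E.1.lraMin_le_lraMin_toMA s ℓ G s
    · rw [M.sspValue_u ℓ G E hx]
      refine (M.lraMin_le_tsum ℓ G (c := Choice.act x) (Or.inl ⟨x, rfl, rfl⟩)).trans_eq ?_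
      refine ((PMF.tsum_map_mul x.1.2.2 M.collapse _).trans ?_).symm
      simp_rw [sspValue_collapse]
      rfl
  | q E => exact (PMF.tsum_pure_mul (SSPState.q E) _).ge

/-- The minimal long-run average is at most the minimal cost of the SSP. -/
theorem lraMin_le_minCost_collapse (s : S) :
    M.lraMin ℓ s G ≤ (M.sspLRA ℓ G).minCost (M.collapse s) := by
  rw [← M.sspValue_collapse ℓ G s]
  refine SSP.le_minCost (M.sspLRA_cost ℓ G) ?_ (M.sspValue_le_one ℓ G) ?_
    (fun x c hc => M.sspValue_le_tsum ℓ G x hc) _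
  · rintro _ ⟨E, rfl⟩ c _ y hy
    by_contra hne
    exact hy (PMF.pure_apply_of_ne _ _ hne)
  · rintro _ ⟨E, rfl⟩
    exact le_rfl

end MarkovAutomaton

end

theorem theorem5 {S A : Type*} [Finite S] [MeasurableSpace S] [DiscreteMeasurableSpace S]
    (M : MarkovAutomaton S A) (hM : M.NonZeno) (G : Set S) (ℓ : LimitReading)
    (s : S) (hs : M.Reachable M.init s) :
    M.lraMin ℓ s G = (M.sspLRA ℓ G).minCost (M.collapse s) := by
  exact le_antisymm (M.lraMin_le_minCost_collapse ℓ G s) (M.minCost_collapse_le_lraMin ℓ G s)
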